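/- Let $d\ge 2$ and let $G=\mathrm{SO}^\circ(d,1)$ be the identity component of the group of real matrices of determinant $1$ preserving the form $x_0^2+\dots+x_{d-1}^2-x_d^2$, acting on hyperbolic space $\mathbb H^d=\{x: x_0^2+\dots+x_{d-1}^2-x_d^2=-1,\ x_d>0\}$. Let $v_o=e_0$ be the unit tangent vector at the point $o=e_d$, let $\mathcal M<G$ be the stabilizer of $v_o$, let $\mathcal A=\{a_t:t\in\mathbb R\}<G$ be the one-parameter group of boosts in the $(e_0,e_d)$-plane, so that $a_t o=(\cosh t)e_d+(\sinh t)e_0$, and let $\mathcal U=\{u\in G: a_{-t}ua_t\to e \text{ as } t\to+\infty\}$ be the contracting horospherical subgroup. In $G\times G$ put $H=\{(g,g):g\in G\}$, $A=\{(a,a):a\in\mathcal A\}$, $M=\{(m,m):m\in\mathcal M\}$, $U=\{(u,u):u\in\mathcal U\}$ and $U_2=\{e\}\times\mathcal U$. Let $\Gamma_1<G$ be a torsion-free, Zariski dense, convex cocompact discrete subgroup (convex cocompact: the quotient by $\Gamma_1$ of the convex hull in $\mathbb H^d$ of its limit set is compact), and let $\Gamma_2<G$ be a torsion-free cocompact lattice.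 Let $G\times G$ act by right translations on $Z=\Gamma_1\backslash G\times\Gamma_2\backslash G$, and set $$\Omega=\{x_1\in\Gamma_1\backslash G: x_1\mathcal A\text{ is bounded}\}\times\Gamma_2\backslash G ,$$ where bounded means relatively compact. Let $X\subset Z$ be a closed $H$-invariant subset, and let $Y\subset X$ be a $U$-minimal subset of $X$ with respect to $\Omega$; that is, $Y$ is a closed $U$-invariant subset of $X$, $Y\cap\Omega\neq\emptyset$, and $yU$ is dense in $Y$ for every $y\in Y\cap\Omega$. A one-parameter semigroup of $G\times G$ is a subset of the form $\{\exp(t\xi):t\ge 0\}$ with $\xi$ a non-zero element of the Lie algebra of $G\times G$. Then there exists a one-parameter semigroup $S\subset AMU_2$ such that $S\not\subset M$ and $YS\subset Y$. -/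

import Mathlib

open Filter Topology
open scoped Matrix Pointwise

noncomputable section

namespace OrbitClosure

/-! ## The group `G = SO°(d,1)` and its Lie algebra -/

/-- The Gram matrix `diag(1, …, 1, -1)` of the quadratic form of signature `(d,1)`. -/
def formJ (d : ℕ) : Matrix (Fin (d + 1)) (Fin (d + 1)) ℝ :=
  Matrix.diagonal fun i => if i = Fin.last d then -1 else 1

/-- `SO(d,1)`: the matrices of determinant one which preserve the form. -/
def SOd1 (d : ℕ) : Subgroup (Matrix.SpecialLinearGroup (Fin (d + 1)) ℝ) where
  carrier := {g | (g.1)ᵀ * formJ d * g.1 = formJ d}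
  mul_mem' := by
    intro a b ha hb
    simp only [Set.mem_ofPred_eq] at ha hb ⊢
    calc ((a * b).1)ᵀ * formJ d * (a * b).1 = (b.1)ᵀ * ((a.1)ᵀ * formJ d * a.1) * b.1 := by
          simp [Matrix.transpose_mul, Matrix.mul_assoc]
      _ = formJ d := by rw [ha, hb]
  one_mem' := by simp
  inv_mem' := by
    intro a ha
    simp only [Set.mem_ofPred_eq] at ha ⊢
    have h1 : a.1 * (a⁻¹).1 = 1 := by
      rw [← Matrix.SpecialLinearGroup.coe_mul, mul_inv_cancel, Matrix.SpecialLinearGroup.coe_one]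
    have h2 : ((a⁻¹).1)ᵀ * (a.1)ᵀ = 1 := by
      rw [← Matrix.transpose_mul, h1, Matrix.transpose_one]
    calc ((a⁻¹).1)ᵀ * formJ d * (a⁻¹).1
        = ((a⁻¹).1)ᵀ * ((a.1)ᵀ * formJ d * a.1) * (a⁻¹).1 := by rw [ha]
      _ = (((a⁻¹).1)ᵀ * (a.1)ᵀ) * formJ d * (a.1 * (a⁻¹).1) := by
          simp only [Matrix.mul_assoc]
      _ = formJ d := by rw [h1, h2]; simp

/-- `G = SO°(d,1)`, the identity component of `SO(d,1)`. -/
abbrev G (d : ℕ) : Type := Subgroup.connectedComponentOfOne (SOd1 d)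

/-- The matrix of an element of `G`. -/
def toMat {d : ℕ} (g : G d) : Matrix (Fin (d + 1)) (Fin (d + 1)) ℝ := g.1.1.1

/-- The Lie algebra `so(d,1)` of `G`: the matrices `ξ` with `ξᵀ J = -J ξ`. -/
abbrev so (d : ℕ) : Submodule ℝ (Matrix (Fin (d + 1)) (Fin (d + 1)) ℝ) :=
  skewAdjointMatricesSubmodule (formJ d)

theorem formJ_mul_self (d : ℕ) : formJ d * formJ d = 1 := by
  rw [formJ, Matrix.diagonal_mul_diagonal, ← Matrix.diagonal_one]
  congr 1
  funext i
  split_ifs <;> norm_num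

theorem exp_preserves {d : ℕ} (ξ : so d) :
    (NormedSpace.exp (ξ : Matrix (Fin (d + 1)) (Fin (d + 1)) ℝ))ᵀ * formJ d *
      NormedSpace.exp (ξ : Matrix (Fin (d + 1)) (Fin (d + 1)) ℝ) = formJ d := by
  obtain ⟨X, hX⟩ := ξ
  have hsk : Xᵀ * formJ d = formJ d * (-X) := by
    rw [mem_skewAdjointMatricesSubmodule] at hX
    exact hX
  have hJ := formJ_mul_self d
  have hu : IsUnit (formJ d) := ⟨⟨formJ d, formJ d, hJ, hJ⟩, rfl⟩
  have hinv : (formJ d)⁻¹ = formJ d := Matrix.inv_eq_right_inv hJ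
  have hT : Xᵀ = formJ d * (-X) * (formJ d)⁻¹ := by
    rw [hinv, ← hsk, Matrix.mul_assoc, hJ, Matrix.mul_one]
  have hcan : NormedSpace.exp (-X) * NormedSpace.exp X = 1 := by
    rw [← Matrix.exp_add_of_commute _ _ (Commute.neg_left (Commute.refl X))]
    simp
  change (NormedSpace.exp X)ᵀ * formJ d * NormedSpace.exp X = formJ d
  rw [← Matrix.exp_transpose, hT, Matrix.exp_conj _ _ hu, hinv]
  calc formJ d * NormedSpace.exp (-X) * formJ d * formJ d * NormedSpace.exp X
      = formJ d * NormedSpace.exp (-X) * (formJ d * formJ d) * NormedSpace.exp X := by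
        simp only [Matrix.mul_assoc]
    _ = formJ d * (NormedSpace.exp (-X) * NormedSpace.exp X) := by
        rw [hJ, Matrix.mul_one, Matrix.mul_assoc]
    _ = formJ d := by rw [hcan, Matrix.mul_one]

theorem continuous_exp_smul {d : ℕ} (X : Matrix (Fin (d + 1)) (Fin (d + 1)) ℝ) :
    Continuous fun t : ℝ => NormedSpace.exp (t • X) := by
  let : SeminormedRing (Matrix (Fin (d + 1)) (Fin (d + 1)) ℝ) := Matrix.linftyOpSemiNormedRing
  let : NormedRing (Matrix (Fin (d + 1)) (Fin (d + 1)) ℝ) := Matrix.linftyOpNormedRing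
  let : NormedAlgebra ℝ (Matrix (Fin (d + 1)) (Fin (d + 1)) ℝ) := Matrix.linftyOpNormedAlgebra
  let : NormedAlgebra ℚ (Matrix (Fin (d + 1)) (Fin (d + 1)) ℝ) :=
    NormedAlgebra.restrictScalars ℚ ℝ _
  exact NormedSpace.exp_continuous.comp (continuous_id.smul continuous_const)

theorem det_exp_so {d : ℕ} (ξ : so d) :
    (NormedSpace.exp (ξ : Matrix (Fin (d + 1)) (Fin (d + 1)) ℝ)).det = 1 := by
  have hsq : ∀ η : so d, (NormedSpace.exp (η : Matrix (Fin (d + 1)) (Fin (d + 1)) ℝ)).det ^ 2 = 1 := by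
    intro η
    have h := congrArg Matrix.det (exp_preserves η)
    have hJ := congrArg Matrix.det (formJ_mul_self d)
    simp only [Matrix.det_mul, Matrix.det_transpose, Matrix.det_one] at h hJ
    have hne : (formJ d).det ≠ 0 := by
      intro h0
      rw [h0] at hJ
      simp at hJ
    apply mul_right_cancel₀ hne
    linarith [h]
  have hhalf : (NormedSpace.exp (ξ : Matrix (Fin (d + 1)) (Fin (d + 1)) ℝ)) =
      NormedSpace.exp (((2 : ℝ)⁻¹ • ξ : so d) : Matrix (Fin (d + 1)) (Fin (d + 1)) ℝ) *
      NormedSpace.exp (((2 : ℝ)⁻¹ • ξ : so d) : Matrix (Fin (d + 1)) (Fin (d + 1)) ℝ) := by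
    rw [← Matrix.exp_add_of_commute _ _ (Commute.refl _)]
    congr 1
    simp only [Submodule.coe_smul]
    rw [← add_smul]
    norm_num
  rw [hhalf, Matrix.det_mul, ← pow_two, hsq]

/-- The exponential of an element of `so(d,1)`, as an element of `SO(d,1)`. -/
def expSO {d : ℕ} (ξ : so d) : SOd1 d :=
  ⟨⟨NormedSpace.exp (ξ : Matrix (Fin (d + 1)) (Fin (d + 1)) ℝ), det_exp_so ξ⟩, exp_preserves ξ⟩

theorem expSO_mem {d : ℕ} (ξ : so d) :
    expSO ξ ∈ Subgroup.connectedComponentOfOne (SOd1 d) := by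
  have hc : Continuous fun t : ℝ => expSO (t • ξ) := by
    refine Continuous.subtype_mk (Continuous.subtype_mk ?_ _) _
    exact continuous_exp_smul (ξ : Matrix (Fin (d + 1)) (Fin (d + 1)) ℝ)
  have h0 : expSO ((0 : ℝ) • ξ) = 1 := by
    apply Subtype.ext
    apply Subtype.ext
    change NormedSpace.exp (((0 : ℝ) • ξ : so d) : Matrix (Fin (d + 1)) (Fin (d + 1)) ℝ) = 1
    simp
  have hr : IsPreconnected (Set.range fun t : ℝ => expSO (t • ξ)) := isPreconnected_range hc
  have hsub := hr.subset_connectedComponent (x := 1) ⟨0, h0⟩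
  exact hsub ⟨1, by simp⟩

/-- The exponential map `so(d,1) → G`. -/
def expG {d : ℕ} (ξ : so d) : G d := ⟨expSO ξ, expSO_mem ξ⟩

/-! ## Hyperbolic space, limit sets, convex cocompactness

The hyperbolic space is the upper sheet of the hyperboloid, and its boundary sphere is the set of
null vectors whose last coordinate is `1`; a point `x` of the hyperboloid is the point `x / x_last`
of the projective (Klein) ball, in which geodesics are Euclidean segments. -/

/-- The quadratic form `x_0² + … + x_{d-1}² - x_d²`. -/
def quadForm (d : ℕ) (x : Fin (d + 1) → ℝ) : ℝ := x ⬝ᵥ (formJ d *ᵥ x)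

/-- The hyperbolic space `ℍ^d`. -/
def hypSpace (d : ℕ) : Set (Fin (d + 1) → ℝ) := {x | quadForm d x = -1 ∧ 0 < x (Fin.last d)}

/-- The boundary sphere `∂ℍ^d = 𝕊^{d-1}`. -/
def hypBoundary (d : ℕ) : Set (Fin (d + 1) → ℝ) := {x | quadForm d x = 0 ∧ x (Fin.last d) = 1}

/-- The point of the Klein ball which corresponds to a vector. -/
def klein {d : ℕ} (x : Fin (d + 1) → ℝ) : Fin (d + 1) → ℝ := (x (Fin.last d))⁻¹ • x

/-- The base point `o = e_d` of `ℍ^d`. -/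
def basePt (d : ℕ) : Fin (d + 1) → ℝ := Pi.single (Fin.last d) 1

/-- The unit tangent vector `v_o = e_0` at the base point `o` (for `d ≥ 1`). -/
def baseVec (d : ℕ) : Fin (d + 1) → ℝ := Pi.single 0 1

/-- The limit set of `Γ`: the accumulation points of the orbit `Γ o` in the boundary sphere. -/
def limitSet {d : ℕ} (Γ : Subgroup (G d)) : Set (Fin (d + 1) → ℝ) :=
  hypBoundary d ∩ closure {x | ∃ γ ∈ Γ, x = klein (toMat γ *ᵥ basePt d)}

/-- The convex hull in `ℍ^d` of a closed subset `Λ` of the boundary sphere. -/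
def hypHull (d : ℕ) (Λ : Set (Fin (d + 1) → ℝ)) : Set (Fin (d + 1) → ℝ) :=
  {x | x ∈ hypSpace d ∧ klein x ∈ convexHull ℝ Λ}

/-- `Γ` is convex cocompact: the quotient `Γ \ hull(Λ)` is compact. -/
def IsConvexCocompact {d : ℕ} (Γ : Subgroup (G d)) : Prop :=
  CompactSpace (Quot fun x y : hypHull d (limitSet Γ) =>
    ∃ γ ∈ Γ, toMat γ *ᵥ (x : Fin (d + 1) → ℝ) = y)

/-- `Γ` is Zariski dense in `G`: every real polynomial in the matrix entries which vanishes on `Γ`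
vanishes on `G`. -/
def IsZariskiDense {d : ℕ} (Γ : Subgroup (G d)) : Prop :=
  ∀ p : MvPolynomial (Fin (d + 1) × Fin (d + 1)) ℝ,
    (∀ γ ∈ Γ, MvPolynomial.eval (fun ij => toMat γ ij.1 ij.2) p = 0) →
      ∀ g : G d, MvPolynomial.eval (fun ij => toMat g ij.1 ij.2) p = 0

/-- `Γ` has no nontrivial element of finite order. -/
def IsTorsionFreeSubgroup {d : ℕ} (Γ : Subgroup (G d)) : Prop :=
  ∀ γ ∈ Γ, ∀ n : ℕ, 0 < n → γ ^ n = 1 → γ = 1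

/-! ## The subgroups `𝒜`, `ℳ`, `𝒰` of `G` and the associated subgroups of `G × G` -/

/-- The matrix which exchanges `e_0` and `e_d` and vanishes on the other basis vectors. -/
def boostMat (d : ℕ) : Matrix (Fin (d + 1)) (Fin (d + 1)) ℝ :=
  Matrix.of fun i j => if i ≠ j ∧ (i = 0 ∧ j = Fin.last d ∨ i = Fin.last d ∧ j = 0) then 1 else 0

theorem boostMat_mem (d : ℕ) : boostMat d ∈ so d := by
  rw [mem_skewAdjointMatricesSubmodule]
  change (boostMat d)ᵀ * formJ d = formJ d * (-boostMat d)
  ext i j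
  rw [formJ, Matrix.mul_diagonal, Matrix.diagonal_mul]
  simp only [boostMat, Matrix.transpose_apply, Matrix.of_apply, Matrix.neg_apply]
  by_cases hij : i = j
  · simp [hij]
  · grind

/-- The one-parameter group `a_t`: the boost in the plane of `o = e_d` and `v_o = e_0`, so that
`t ↦ a_t o = (cosh t) e_d + (sinh t) e_0` is the unit speed geodesic tangent to `v_o`. -/
def aElt (d : ℕ) (t : ℝ) : G d := expG (t • (⟨boostMat d, boostMat_mem d⟩ : so d))

/-- `𝒜 = {a_t}`. -/
def grpA (d : ℕ) : Set (G d) := Set.range (aElt d)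

/-- `ℳ`: the stabilizer in `G` of the unit tangent vector `v_o` at `o`. -/
def grpM (d : ℕ) : Set (G d) :=
  {m | toMat m *ᵥ basePt d = basePt d ∧ toMat m *ᵥ baseVec d = baseVec d}

/-- `𝒰`: the contracting horospherical subgroup of `G`. -/
def grpU (d : ℕ) : Set (G d) :=
  {u | Tendsto (fun t : ℝ => aElt d (-t) * u * aElt d t) atTop (𝓝 1)}

/-- The diagonal copy `{(g,g) : g ∈ S}` in `G × G` of a subset of `G`. -/
def diag {d : ℕ} (S : Set (G d)) : Set (G d × G d) := (fun g => (g, g)) '' S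

/-- The copy `{e} × S` in `G × G` of a subset of `G`. -/
def second {d : ℕ} (S : Set (G d)) : Set (G d × G d) := (fun g => (1, g)) '' S

/-- `A M U₂`, with `A`, `M` the diagonal copies of `𝒜`, `ℳ`, and `U₂ = {e} × 𝒰`. -/
def grpAMU₂ (d : ℕ) : Set (G d × G d) := diag (grpA d) * diag (grpM d) * second (grpU d)

/-- `S` is a one-parameter semigroup `{exp (t ξ) : t ≥ 0}` of `G × G`, where `ξ = (ξ₁, ξ₂)` is a
non-zero element of the Lie algebra `so(d,1) × so(d,1)`. -/
def IsOneParamSemigroup {d : ℕ} (S : Set (G d × G d)) : Prop :=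
  ∃ ξ : so d × so d, ξ ≠ 0 ∧
    S = (fun t : ℝ => (expG (t • ξ.1), expG (t • ξ.2))) '' Set.Ici 0

/-! ## The space `Z = Γ₁ \ G × Γ₂ \ G` and relatively minimal sets -/

/-- The quotient `Γ \ G`, with the quotient topology. -/
abbrev LeftQuot {d : ℕ} (Γ : Subgroup (G d)) : Type := Quotient (QuotientGroup.rightRel Γ)

/-- The right translation action of `G` on `Γ \ G`: `[h] g = [h g]`. -/
def LeftQuot.tr {d : ℕ} {Γ : Subgroup (G d)} (x : LeftQuot Γ) (g : G d) : LeftQuot Γ :=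
  Quotient.map (· * g) (fun a b h => by
    change QuotientGroup.rightRel Γ a b at h
    change QuotientGroup.rightRel Γ (a * g) (b * g)
    rw [QuotientGroup.rightRel_apply] at h ⊢
    simpa [mul_assoc] using h) x

/-- `Z = Γ₁ \ G × Γ₂ \ G`. -/
abbrev ZSpace {d : ℕ} (Γ₁ Γ₂ : Subgroup (G d)) : Type := LeftQuot Γ₁ × LeftQuot Γ₂

/-- The right translation action of `G × G` on `Z`. -/
def ztr {d : ℕ} {Γ₁ Γ₂ : Subgroup (G d)} (x : ZSpace Γ₁ Γ₂) (g : G d × G d) : ZSpace Γ₁ Γ₂ :=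
  (x.1.tr g.1, x.2.tr g.2)

/-- `X T ⊆ X` for a subset `T` of `G × G`. -/
def IsInvariantUnder {d : ℕ} {Γ₁ Γ₂ : Subgroup (G d)} (X : Set (ZSpace Γ₁ Γ₂))
    (T : Set (G d × G d)) : Prop :=
  ∀ x ∈ X, ∀ g ∈ T, ztr x g ∈ X

/-- `RF`: the points of `Γ \ G` whose `𝒜`-orbit is bounded, that is, relatively compact. -/
def RF {d : ℕ} (Γ : Subgroup (G d)) : Set (LeftQuot Γ) :=
  {x | IsCompact (closure ((fun a => x.tr a) '' grpA d))}

/-- `Ω = RF × Γ₂ \ G`. -/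
def OmegaSet {d : ℕ} (Γ₁ Γ₂ : Subgroup (G d)) : Set (ZSpace Γ₁ Γ₂) := RF Γ₁ ×ˢ Set.univ

/-- `Y` is a `U`-minimal subset of `X` with respect to `Ω`: it is a closed `U`-invariant subset of
`X` which meets `Ω`, and `y U` is dense in `Y` for every `y ∈ Y ∩ Ω`. -/
structure IsUMinimal {d : ℕ} {Γ₁ Γ₂ : Subgroup (G d)} (X Y : Set (ZSpace Γ₁ Γ₂)) : Prop where
  isClosed : IsClosed Y
  subset : Y ⊆ X
  invariant : IsInvariantUnder Y (diag (grpU d))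
  meets : (Y ∩ OmegaSet Γ₁ Γ₂).Nonempty
  dense_orbit : ∀ y ∈ Y ∩ OmegaSet Γ₁ Γ₂, Y ⊆ closure ((fun u => ztr y u) '' diag (grpU d))

end OrbitClosure

end

noncomputable section

set_option linter.unusedSectionVars false

namespace OrbitClosure

variable {d : ℕ}

/-! ## The linear action on `ℝ^{d+1}` -/

/-! Let W be the closed semigroup of all w in A M U₂ with Y w ⊆ Y (`stabSemigroup`). Such w
normalize U, so minimality makes membership cheap: if y ∈ Y ∩ Ω and y w ∈ Y, then y U w = y w U ⊆ Y,
and density of y U gives Y w ⊆ Y (`mem_stabSemigroup_of_minimal`). It remains to produce elements of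
W near M but not in M, and to extract a one-parameter semigroup from them.

Distance from diag(𝒰ℳ) is measured by `defect`, which vanishes exactly on that subgroup. Inside A M
U₂ its zero set is the compact group M.

Recurrence. A frame lies in `RF` exactly when both its endpoints are limit points (`EndsIn`), and by
convex cocompactness such frames form a compact set modulo Γ₁. Moving along 𝒰 keeps the forward
endpoint, so only the backward one matters; call s a visiting time of g when the backward endpoint
of g u_s is a limit point. Visiting times are unbounded, which yields k n and k n q n in the lift of
Y with q n → 1. The defect of q n is non-zero because a torsion-free cocompact Γ₂ has no parabolic
elements (`exists_recurrence`, `eq_one_of_conj_fixes_eP`).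

Unipotent blow-up. The coordinates of defect(u_{-s} q n) are polynomials in s with coefficients
tending to 0. Unless the defect is already invariant, rescaling s by some c n → ∞ gives a non-zero
limit polynomial Q that is small on the unit ball (`exists_renormalization`). Zariski density of Γ₁,
zoomed in by the boosts, provides a visiting time σ in the unit ball with Q(σ) ≠ 0
(`exists_endsIn_eval_ne_zero`), and σ is approximated by visiting times at scale c n. At these times
both points return to compact sets, and the limit w has small non-zero defect. A bounded change of
time is negligible at scale c n, so the defect of w is invariant under U, which forces w into A M U
(`normalizes_of_defect_invariant`); a right translation by U puts it in A M U₂.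

Extraction. W therefore contains elements of arbitrarily small non-zero defect, accumulating at its
compact subgroup of zero defect. Correct them by that subgroup so as to be as close to 1 as
possible, and rescale: the limit direction ξ has exp(tξ) in W for t ≥ 0, and optimality of the
correction prevents this semigroup from lying in the zero-defect subgroup (`exists_direction`). -/

theorem toMat_mul (g h : G d) : toMat (g * h) = toMat g * toMat h := rfl

theorem toMat_one : toMat (1 : G d) = 1 := rfl

theorem toMat_injective : Function.Injective (toMat : G d → _) := fun _ _ h =>
  Subtype.ext (Subtype.ext (Subtype.ext h))

theorem toMat_preserves (g : G d) : (toMat g)ᵀ * formJ d * toMat g = formJ d := g.1.2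

/-- The linear action of `G` on `ℝ^{d+1}`. -/
def act (g : G d) : (Fin (d + 1) → ℝ) →ₗ[ℝ] (Fin (d + 1) → ℝ) := (toMat g).mulVecLin

theorem act_apply (g : G d) (x : Fin (d + 1) → ℝ) : act g x = toMat g *ᵥ x := rfl

theorem act_mul (g h : G d) (x : Fin (d + 1) → ℝ) : act (g * h) x = act g (act h x) := by
  simp [act_apply, toMat_mul]

@[simp] theorem act_one (x : Fin (d + 1) → ℝ) : act (1 : G d) x = x := by
  simp [act_apply, toMat_one]

@[simp] theorem act_inv_act (g : G d) (x : Fin (d + 1) → ℝ) : act g⁻¹ (act g x) = x := by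
  rw [← act_mul]; simp

@[simp] theorem act_act_inv (g : G d) (x : Fin (d + 1) → ℝ) : act g (act g⁻¹ x) = x := by
  rw [← act_mul]; simp

theorem act_inv_eq_iff (g : G d) (x y : Fin (d + 1) → ℝ) : act g⁻¹ x = y ↔ x = act g y := by
  constructor
  · rintro rfl; simp
  · rintro rfl; simp

/-- The bilinear form of signature `(d,1)`. -/
def bil (d : ℕ) : LinearMap.BilinForm ℝ (Fin (d + 1) → ℝ) := Matrix.toBilin' (formJ d)

theorem bil_eq_dot (x y : Fin (d + 1) → ℝ) : bil d x y = x ⬝ᵥ (formJ d *ᵥ y) :=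
  Matrix.toBilin'_apply' _ _ _

theorem quadForm_eq (x : Fin (d + 1) → ℝ) : quadForm d x = bil d x x := (bil_eq_dot x x).symm

theorem bil_act (g : G d) (x y : Fin (d + 1) → ℝ) : bil d (act g x) (act g y) = bil d x y := by
  rw [bil_eq_dot, bil_eq_dot, act_apply, act_apply]
  conv_rhs => rw [← toMat_preserves g]
  rw [Matrix.mulVec_mulVec, Matrix.dotProduct_mulVec, Matrix.dotProduct_mulVec,
    Matrix.vecMul_mulVec, Matrix.mul_assoc]

theorem bil_act_left (g : G d) (x y : Fin (d + 1) → ℝ) :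
    bil d (act g x) y = bil d x (act g⁻¹ y) := by
  rw [← bil_act g⁻¹, act_inv_act]

theorem bil_eq_sum (x y : Fin (d + 1) → ℝ) :
    bil d x y = ∑ i, (if i = Fin.last d then -1 else 1) * (x i * y i) := by
  rw [bil_eq_dot, formJ, dotProduct]
  refine Finset.sum_congr rfl fun i _ => ?_
  rw [Matrix.mulVec_diagonal]; ring

theorem bil_comm (x y : Fin (d + 1) → ℝ) : bil d x y = bil d y x := by
  rw [bil_eq_sum, bil_eq_sum]
  exact Finset.sum_congr rfl fun i _ => by ring

/-! ## Coordinates adapted to the null vectors `o ± v_o` -/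

/-- The indices different from `0` and `d`. -/
abbrev Mid (d : ℕ) : Type := {i : Fin (d + 1) // i ≠ 0 ∧ i ≠ Fin.last d}

/-- Extension by zero of a vector indexed by `Mid d`. -/
def emb (d : ℕ) : (Mid d → ℝ) →ₗ[ℝ] (Fin (d + 1) → ℝ) where
  toFun s i := if h : i ≠ 0 ∧ i ≠ Fin.last d then s ⟨i, h⟩ else 0
  map_add' s t := by ext i; by_cases h : i ≠ 0 ∧ i ≠ Fin.last d <;> simp [h]
  map_smul' c s := by ext i; by_cases h : i ≠ 0 ∧ i ≠ Fin.last d <;> simp [h]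

@[simp] theorem emb_zero_index (s : Mid d → ℝ) : emb d s 0 = 0 := by simp [emb]

@[simp] theorem emb_last_index (s : Mid d → ℝ) : emb d s (Fin.last d) = 0 := by simp [emb]

@[simp] theorem emb_mid (s : Mid d → ℝ) (i : Mid d) : emb d s i = s i := by
  simp [emb, i.2.1, i.2.2]

/-- The coordinates in `Mid d`. -/
def restr (d : ℕ) : (Fin (d + 1) → ℝ) →ₗ[ℝ] (Mid d → ℝ) where
  toFun x i := x i
  map_add' _ _ := rfl
  map_smul' _ _ := rfl

@[simp] theorem restr_apply (x : Fin (d + 1) → ℝ) (i : Mid d) : restr d x i = x i := rfl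

/-- The attracting null vector `o + v_o`. -/
def eP (d : ℕ) : Fin (d + 1) → ℝ := basePt d + baseVec d

/-- The repelling null vector `o - v_o`. -/
def eM (d : ℕ) : Fin (d + 1) → ℝ := basePt d - baseVec d

@[simp] theorem restr_emb (s : Mid d → ℝ) : restr d (emb d s) = s := by ext i; simp

variable [hd : Fact (2 ≤ d)]

theorem last_ne_zero : Fin.last d ≠ 0 := by
  have := hd.out
  intro h
  have := congrArg Fin.val h
  simp at this
  omega

instance : Nonempty (Mid d) := by
  have := hd.out
  exact ⟨⟨⟨1, by omega⟩, by simp [Fin.ext_iff], by simp [Fin.ext_iff]; omega⟩⟩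

theorem sum_split (f : Fin (d + 1) → ℝ) :
    ∑ i, f i = f 0 + f (Fin.last d) + ∑ i : Mid d, f i := by
  have h := Fintype.sum_subtype_add_sum_subtype
    (fun i : Fin (d + 1) => i ≠ 0 ∧ i ≠ Fin.last d) f
  have h2 : ∑ i : {i : Fin (d + 1) // ¬ (i ≠ 0 ∧ i ≠ Fin.last d)}, f i = f 0 + f (Fin.last d) := by
    rw [← Finset.sum_pair (last_ne_zero (d := d)).symm]
    refine (Finset.sum_subtype _ (fun i => ?_) f).symm
    simp only [Finset.mem_insert, Finset.mem_singleton]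
    tauto
  linarith

theorem bil_split (x y : Fin (d + 1) → ℝ) :
    bil d x y = x 0 * y 0 - x (Fin.last d) * y (Fin.last d) + ∑ i : Mid d, x i * y i := by
  rw [bil_eq_sum, sum_split]
  have : ∑ i : Mid d, (if (i : Fin (d + 1)) = Fin.last d then (-1 : ℝ) else 1) * (x i * y i) =
      ∑ i : Mid d, x i * y i := Finset.sum_congr rfl fun i _ => by simp [i.2.2]
  rw [this]
  simp [(last_ne_zero (d := d)).symm]
  ring

@[simp] theorem eP_zero : eP d 0 = 1 := by
  simp [eP, basePt, baseVec, (last_ne_zero (d := d)).symm]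

@[simp] theorem eP_last : eP d (Fin.last d) = 1 := by
  simp [eP, basePt, baseVec, last_ne_zero (d := d)]

@[simp] theorem eM_zero : eM d 0 = -1 := by
  simp [eM, basePt, baseVec, (last_ne_zero (d := d)).symm]

@[simp] theorem eM_last : eM d (Fin.last d) = 1 := by
  simp [eM, basePt, baseVec, last_ne_zero (d := d)]

@[simp] theorem eP_mid (i : Mid d) : eP d i = 0 := by
  simp [eP, basePt, baseVec, i.2.1, i.2.2]

@[simp] theorem eM_mid (i : Mid d) : eM d i = 0 := by
  simp [eM, basePt, baseVec, i.2.1, i.2.2]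

theorem bil_eP (x : Fin (d + 1) → ℝ) : bil d x (eP d) = x 0 - x (Fin.last d) := by
  simp [bil_split]

theorem bil_eM (x : Fin (d + 1) → ℝ) : bil d x (eM d) = -x 0 - x (Fin.last d) := by
  simp [bil_split]

theorem bil_emb (x : Fin (d + 1) → ℝ) (s : Mid d → ℝ) :
    bil d x (emb d s) = ∑ i : Mid d, x i * s i := by
  simp [bil_split]

@[simp] theorem bil_eP_eP : bil d (eP d) (eP d) = 0 := by simp [bil_eP]

@[simp] theorem bil_eM_eM : bil d (eM d) (eM d) = 0 := by simp [bil_eM]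

@[simp] theorem bil_eM_eP : bil d (eM d) (eP d) = -2 := by simp [bil_eP]; norm_num

@[simp] theorem bil_eP_eM : bil d (eP d) (eM d) = -2 := by simp [bil_eM]; norm_num

@[simp] theorem bil_emb_eP (s : Mid d → ℝ) : bil d (emb d s) (eP d) = 0 := by simp [bil_eP]

@[simp] theorem bil_emb_eM (s : Mid d → ℝ) : bil d (emb d s) (eM d) = 0 := by simp [bil_eM]

@[simp] theorem bil_eP_emb (s : Mid d → ℝ) : bil d (eP d) (emb d s) = 0 := by simp [bil_emb]

@[simp] theorem bil_eM_emb (s : Mid d → ℝ) : bil d (eM d) (emb d s) = 0 := by simp [bil_emb]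

theorem bil_emb_emb (s t : Mid d → ℝ) : bil d (emb d s) (emb d t) = ∑ i, s i * t i := by
  simp [bil_emb]

theorem bil_emb_self_eq_zero (s : Mid d → ℝ) : bil d (emb d s) (emb d s) = 0 ↔ s = 0 := by
  rw [bil_emb_emb, Finset.sum_eq_zero_iff_of_nonneg fun i _ => mul_self_nonneg (s i)]
  simp [funext_iff]

/-- Coordinates agree as soon as they agree at `0`, `d` and on `Mid d`. -/
theorem vec_ext {x y : Fin (d + 1) → ℝ} (h0 : x 0 = y 0) (hl : x (Fin.last d) = y (Fin.last d))
    (hm : ∀ i : Mid d, x i = y i) : x = y := by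
  ext i
  by_cases h : i = 0
  · rw [h, h0]
  by_cases h' : i = Fin.last d
  · rw [h', hl]
  exact hm ⟨i, h, h'⟩

/-- The vectors `eP` and `eM` are isotropic, pair to -2, and are orthogonal to the middle
coordinates, so each null coefficient is read off by pairing with the opposite null vector. -/
theorem decomp (x : Fin (d + 1) → ℝ) :
    x = emb d (restr d x) + (-(bil d x (eM d)) / 2) • eP d + (-(bil d x (eP d)) / 2) • eM d := by
  apply vec_ext
  · simp [bil_eM, bil_eP]; ring
  · simp [bil_eM, bil_eP]; ring
  · intro i; simp

theorem bil_self_decomp (x : Fin (d + 1) → ℝ) :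
    bil d x x = bil d (emb d (restr d x)) (emb d (restr d x)) - bil d x (eM d) * bil d x (eP d) := by
  rw [bil_emb_emb, bil_split, bil_eM, bil_eP]
  simp only [restr_apply]
  ring

/-- The form is positive semidefinite on the orthogonal of `eP`, with radical the line of `eP`. -/
theorem eq_smul_eP_of_null {x : Fin (d + 1) → ℝ} (h : bil d x x = 0) (h' : bil d x (eP d) = 0) :
    x = (-(bil d x (eM d)) / 2) • eP d := by
  have := bil_self_decomp x
  rw [h, h', mul_zero, sub_zero, eq_comm, bil_emb_self_eq_zero] at this
  conv_lhs => rw [decomp x, this, h']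
  simp

/-- Two elements of `G` agree if they agree on the two null vectors and their orthogonal. -/
theorem ext_act {g h : G d} (hP : act g (eP d) = act h (eP d)) (hM : act g (eM d) = act h (eM d))
    (hs : ∀ s, act g (emb d s) = act h (emb d s)) : g = h := by
  apply toMat_injective
  apply Matrix.mulVec_injective
  funext x
  change act g x = act h x
  rw [decomp x]
  simp [hP, hM, hs]

/-! ## Exponentials -/

theorem exp_mulVec_eigen (A : Matrix (Fin (d + 1)) (Fin (d + 1)) ℝ) (x : Fin (d + 1) → ℝ) (c : ℝ)
    (h : A *ᵥ x = c • x) : NormedSpace.exp A *ᵥ x = Real.exp c • x := by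
  have hp : ∀ n : ℕ, (A ^ n) *ᵥ x = c ^ n • x := by
    intro n
    induction n with
    | zero => simp
    | succ n ih => rw [pow_succ', ← Matrix.mulVec_mulVec, ih, Matrix.mulVec_smul, h, smul_smul,
        pow_succ]
  have h1 : HasSum (fun n : ℕ => ((n.factorial : ℝ)⁻¹ • A ^ n) *ᵥ x) (NormedSpace.exp A *ᵥ x) := by
    have : HasSum (fun n : ℕ => ((n.factorial : ℝ)⁻¹ • A ^ n)) (NormedSpace.exp A) := by
      open scoped Matrix.Norms.Operator in
      exact NormedSpace.exp_series_hasSum_exp' (𝕂 := ℝ) A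
    exact this.map (⟨⟨fun M => M *ᵥ x, by simp⟩, fun a b => Matrix.add_mulVec a b x⟩ : _ →+ _)
      (continuous_id.matrix_mulVec continuous_const)
  have h2 : HasSum (fun n : ℕ => ((n.factorial : ℝ)⁻¹ • c ^ n) • x) (Real.exp c • x) := by
    rw [Real.exp_eq_exp_ℝ]
    exact (NormedSpace.exp_series_hasSum_exp' (𝕂 := ℝ) c).smul_const x
  refine h1.unique (h2.congr_fun ?_)
  intro n
  rw [Matrix.smul_mulVec, hp, smul_assoc]

theorem exp_eq_of_pow_three (A : Matrix (Fin (d + 1)) (Fin (d + 1)) ℝ) (h : A ^ 3 = 0) :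
    NormedSpace.exp A = 1 + A + (2⁻¹ : ℝ) • A ^ 2 := by
  have h1 : HasSum (fun n : ℕ => ((n.factorial : ℝ)⁻¹ • A ^ n)) (NormedSpace.exp A) := by
    open scoped Matrix.Norms.Operator in
    exact NormedSpace.exp_series_hasSum_exp' (𝕂 := ℝ) A
  have h2 := hasSum_sum_of_ne_finset_zero (L := SummationFilter.unconditional ℕ) (f := fun n : ℕ => ((n.factorial : ℝ)⁻¹ • A ^ n))
    (s := Finset.range 3) (fun n hn => by
      simp only [Finset.mem_range, not_lt] at hn
      rw [pow_eq_zero_of_le hn h, smul_zero])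
  rw [h1.unique h2]
  simp [Finset.sum_range_succ]

attribute [irreducible] act bil

theorem toMat_expG (ξ : so d) : toMat (expG ξ) = NormedSpace.exp (ξ : Matrix _ _ ℝ) := rfl

end OrbitClosure

end

noncomputable section

set_option linter.unusedSectionVars false

namespace OrbitClosure

variable {d : ℕ} [hd : Fact (2 ≤ d)]

/-! ## The horospherical group in coordinates -/

/-- The element of `so(d,1)` which spans the root space of `𝒰` in the direction `s`. -/
def nMat (d : ℕ) (s : Mid d → ℝ) : Matrix (Fin (d + 1)) (Fin (d + 1)) ℝ :=
  Matrix.vecMulVec (emb d s) (formJ d *ᵥ eP d) - Matrix.vecMulVec (eP d) (formJ d *ᵥ emb d s)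

theorem nMat_mulVec (s : Mid d → ℝ) (x : Fin (d + 1) → ℝ) :
    nMat d s *ᵥ x = bil d x (eP d) • emb d s - bil d x (emb d s) • eP d := by
  rw [nMat, Matrix.sub_mulVec, Matrix.vecMulVec_mulVec, Matrix.vecMulVec_mulVec, bil_eq_dot,
    bil_eq_dot, dotProduct_comm x, dotProduct_comm x]
  simp

theorem formJ_transpose : (formJ d)ᵀ = formJ d := by simp [formJ]

theorem nMat_mem (s : Mid d → ℝ) : nMat d s ∈ so d := by
  rw [mem_skewAdjointMatricesSubmodule]
  change (nMat d s)ᵀ * formJ d = formJ d * (-nMat d s)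
  rw [nMat, Matrix.transpose_sub, Matrix.transpose_vecMulVec, Matrix.transpose_vecMulVec,
    Matrix.sub_mul, Matrix.vecMulVec_mul, Matrix.vecMulVec_mul, neg_sub, Matrix.mul_sub,
    Matrix.mul_vecMulVec, Matrix.mul_vecMulVec]
  have h : ∀ x, x ᵥ* formJ d = formJ d *ᵥ x := fun x => by
    conv_lhs => rw [← formJ_transpose, Matrix.vecMul_transpose]
  rw [h, h]

/-- The element `u_s` of `𝒰`. -/
def uElt (s : Mid d → ℝ) : G d := expG ⟨nMat d s, nMat_mem s⟩

/-- The square of `nMat d s` has image in the line of `eP`, which `nMat d s` kills, so the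
exponential series stops at degree two. -/
theorem act_uElt (s : Mid d → ℝ) (x : Fin (d + 1) → ℝ) :
    act (uElt s) x = x + bil d x (eP d) • emb d s - bil d x (emb d s) • eP d
      - (2⁻¹ * bil d (emb d s) (emb d s) * bil d x (eP d)) • eP d := by
  have h2 : ∀ y : Fin (d + 1) → ℝ, nMat d s *ᵥ (nMat d s *ᵥ y) =
      -(bil d (emb d s) (emb d s) * bil d y (eP d)) • eP d := by
    intro y
    simp only [nMat_mulVec, map_sub, map_smul, LinearMap.sub_apply, LinearMap.smul_apply,
      bil_emb_eP, bil_eP_eP, bil_eP_emb, smul_eq_mul]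
    module
  have h3 : nMat d s ^ 3 = 0 := by
    apply Matrix.mulVec_injective
    funext y
    have : nMat d s ^ 3 = nMat d s * (nMat d s * nMat d s) := by rw [pow_succ', pow_two]
    rw [this, ← Matrix.mulVec_mulVec, ← Matrix.mulVec_mulVec, h2, nMat_mulVec]
    simp
  rw [act_apply, uElt, toMat_expG, exp_eq_of_pow_three _ h3, Matrix.add_mulVec, Matrix.add_mulVec,
    Matrix.smul_mulVec, pow_two, ← Matrix.mulVec_mulVec, h2, nMat_mulVec, Matrix.one_mulVec]
  ext i
  simp
  ring

@[simp] theorem act_uElt_eP (s : Mid d → ℝ) : act (uElt s) (eP d) = eP d := by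
  simp [act_uElt]

theorem act_uElt_eM (s : Mid d → ℝ) :
    act (uElt s) (eM d) = eM d - (2 : ℝ) • emb d s + bil d (emb d s) (emb d s) • eP d := by
  ext i
  simp [act_uElt]
  ring

theorem act_uElt_emb (s t : Mid d → ℝ) :
    act (uElt s) (emb d t) = emb d t - bil d (emb d t) (emb d s) • eP d := by
  simp [act_uElt]

@[simp] theorem uElt_zero : uElt (0 : Mid d → ℝ) = 1 := by
  apply ext_act <;> simp [act_uElt]

theorem uElt_add (s t : Mid d → ℝ) : uElt (s + t) = uElt s * uElt t := by
  apply ext_act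
  · simp [act_mul]
  · rw [act_mul, act_uElt_eM, act_uElt_eM]
    simp only [map_add, map_sub, map_smul, act_uElt_eM, act_uElt_emb, act_uElt_eP,
      LinearMap.add_apply]
    rw [bil_comm (emb d t) (emb d s)]
    ext i
    simp
    ring
  · intro r
    rw [act_mul, act_uElt_emb, act_uElt_emb]
    simp only [map_add, map_sub, map_smul, act_uElt_emb, act_uElt_eP]
    ext i
    simp
    ring

theorem uElt_neg (s : Mid d → ℝ) : uElt (-s) = (uElt s)⁻¹ := by
  rw [eq_inv_iff_mul_eq_one, ← uElt_add]
  simp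

theorem uElt_comm (s t : Mid d → ℝ) : uElt s * uElt t = uElt t * uElt s := by
  rw [← uElt_add, ← uElt_add, add_comm]

attribute [irreducible] uElt

/-! ## The boosts -/

theorem boostMat_mulVec (x : Fin (d + 1) → ℝ) (i : Fin (d + 1)) :
    (boostMat d *ᵥ x) i =
      if i = 0 then x (Fin.last d) else if i = Fin.last d then x 0 else 0 := by
  have h0 := last_ne_zero (d := d)
  rw [Matrix.mulVec, dotProduct]
  split_ifs with h h'
  · subst h
    rw [Finset.sum_eq_single (Fin.last d)]
    · simp [boostMat, h0.symm]
    · intro j _ hj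
      simp [boostMat, hj, h0.symm]
    · simp
  · subst h'
    rw [Finset.sum_eq_single 0]
    · simp [boostMat, h0]
    · intro j _ hj
      simp [boostMat, hj, h0]
    · simp
  · refine Finset.sum_eq_zero fun j _ => ?_
    simp [boostMat, h, h']

theorem act_aElt_of_eigen (t c : ℝ) (x : Fin (d + 1) → ℝ) (h : boostMat d *ᵥ x = c • x) :
    act (aElt d t) x = Real.exp (t * c) • x := by
  rw [act_apply, aElt, toMat_expG]
  apply exp_mulVec_eigen
  change (t • boostMat d) *ᵥ x = _
  rw [Matrix.smul_mulVec, h, smul_smul]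

@[simp] theorem act_aElt_eP (t : ℝ) : act (aElt d t) (eP d) = Real.exp t • eP d := by
  rw [act_aElt_of_eigen t 1, mul_one]
  apply vec_ext
  · simp [boostMat_mulVec]
  · simp [boostMat_mulVec]
  · intro i; simp [boostMat_mulVec, i.2.1, i.2.2]

@[simp] theorem act_aElt_eM (t : ℝ) : act (aElt d t) (eM d) = Real.exp (-t) • eM d := by
  rw [act_aElt_of_eigen t (-1), mul_neg, mul_one]
  apply vec_ext
  · simp [boostMat_mulVec]
  · simp [boostMat_mulVec, show d ≠ 0 from by have := hd.out; omega]
  · intro i; simp [boostMat_mulVec, i.2.1, i.2.2]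

@[simp] theorem act_aElt_emb (t : ℝ) (s : Mid d → ℝ) : act (aElt d t) (emb d s) = emb d s := by
  rw [act_aElt_of_eigen t 0, mul_zero, Real.exp_zero, one_smul]
  apply vec_ext
  · simp [boostMat_mulVec]
  · simp [boostMat_mulVec]
  · intro i; simp [boostMat_mulVec, i.2.1, i.2.2]

theorem aElt_add (s t : ℝ) : aElt d (s + t) = aElt d s * aElt d t := by
  apply ext_act
  · simp [act_mul, Real.exp_add, smul_smul, mul_comm]
  · simp [act_mul, Real.exp_add, smul_smul]
  · simp [act_mul]

@[simp] theorem aElt_zero : aElt d 0 = 1 := by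
  apply ext_act <;> simp

theorem aElt_neg (t : ℝ) : aElt d (-t) = (aElt d t)⁻¹ := by
  rw [eq_inv_iff_mul_eq_one, ← aElt_add]
  simp

/-- `u_s a_t = a_t u_{e^{-t} s}`. -/
theorem uElt_mul_aElt (s : Mid d → ℝ) (t : ℝ) :
    uElt s * aElt d t = aElt d t * uElt (Real.exp (-t) • s) := by
  apply ext_act
  · simp [act_mul]
  · simp only [act_mul, act_aElt_eM, map_smul, act_uElt_eM, map_add, map_sub, act_aElt_emb,
      act_aElt_eP, LinearMap.smul_apply]
    ext i
    simp
    rw [Real.exp_neg]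
    field_simp
  · intro r
    simp only [act_mul, act_uElt_emb, map_sub, map_smul, act_aElt_eP, act_aElt_emb]
    ext i
    simp
    rw [Real.exp_neg]
    field_simp

/-! ## Transitivity, stabilizers and centralizers -/

/-- In u_s e₋ = e₋ - 2 s + |s|² e₊ the middle coordinates determine s, and the coefficient of e₊ is
then forced by nullity. Hence 𝒰 acts transitively on null vectors with this pairing against e₊. -/
theorem act_uElt_transitive {y : Fin (d + 1) → ℝ} (h : bil d y y = 0) (h' : bil d y (eP d) = -2) :
    act (uElt (-(2⁻¹ : ℝ) • restr d y)) (eM d) = y := by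
  have h2 := bil_self_decomp y
  rw [h, h'] at h2
  rw [act_uElt_eM]
  conv_rhs => rw [decomp y, h']
  simp only [map_smul, LinearMap.smul_apply, smul_eq_mul]
  have : bil d y (eM d) = -(bil d (emb d (restr d y)) (emb d (restr d y))) / 2 := by linarith
  rw [this]
  ext i
  simp
  ring

/-- `𝒜ℳ`: the elements which preserve the two null lines. -/
def IsAM (h : G d) : Prop :=
  ∃ t : ℝ, act h (eP d) = Real.exp t • eP d ∧ act h (eM d) = Real.exp (-t) • eM d

theorem mem_grpM_iff (m : G d) :
    m ∈ grpM d ↔ act m (eP d) = eP d ∧ act m (eM d) = eM d := by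
  change toMat m *ᵥ basePt d = basePt d ∧ toMat m *ᵥ baseVec d = baseVec d ↔ _
  simp only [← act_apply, eP, eM, map_add, map_sub]
  constructor
  · rintro ⟨h1, h2⟩
    rw [h1, h2]; simp
  · rintro ⟨h1, h2⟩
    have a1 : (2 : ℝ) • act m (basePt d) = (2 : ℝ) • basePt d := by
      rw [two_smul, two_smul]; linear_combination (exp := 1) h1 + h2
    have a2 : (2 : ℝ) • act m (baseVec d) = (2 : ℝ) • baseVec d := by
      rw [two_smul, two_smul]; linear_combination (exp := 1) h1 - h2
    exact ⟨smul_right_injective _ two_ne_zero a1, smul_right_injective _ two_ne_zero a2⟩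

theorem bil_act_emb_eq_zero {h : G d} {c : ℝ} {e : Fin (d + 1) → ℝ} (hc : c ≠ 0)
    (he : act h e = c • e) (s : Mid d → ℝ) (hs : bil d (emb d s) e = 0) :
    bil d (act h (emb d s)) e = 0 := by
  have := bil_act h (emb d s) e
  rw [he, hs, map_smul, smul_eq_mul] at this
  exact (mul_eq_zero.1 this).resolve_left hc

/-- Elements which preserve both null lines act on the orthogonal of these lines. -/
theorem IsAM.act_emb {h : G d} (hh : IsAM h) (s : Mid d → ℝ) :
    ∃ s', act h (emb d s) = emb d s' := by
  obtain ⟨t, hP, hM⟩ := hh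
  refine ⟨restr d (act h (emb d s)), ?_⟩
  conv_lhs => rw [decomp (act h (emb d s)),
    bil_act_emb_eq_zero (Real.exp_ne_zero _) hP s (bil_emb_eP s),
    bil_act_emb_eq_zero (Real.exp_ne_zero _) hM s (bil_emb_eM s)]
  simp

theorem IsAM.mul_aElt {h : G d} (hh : IsAM h) (t : ℝ) : h * aElt d t = aElt d t * h := by
  have hh' := hh
  obtain ⟨c, hP, hM⟩ := hh
  apply ext_act
  · simp [act_mul, hP, smul_smul, mul_comm]
  · simp [act_mul, hM, smul_smul, mul_comm]
  · intro s
    obtain ⟨s', hs'⟩ := hh'.act_emb s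
    simp [act_mul, hs']

theorem isAM_of_mem_grpM {m : G d} (hm : m ∈ grpM d) : IsAM m := by
  rw [mem_grpM_iff] at hm
  exact ⟨0, by simp [hm.1], by simp [hm.2]⟩

theorem IsAM.one : IsAM (1 : G d) := ⟨0, by simp, by simp⟩

theorem IsAM.mul {g h : G d} (hg : IsAM g) (hh : IsAM h) : IsAM (g * h) := by
  obtain ⟨s, h1, h2⟩ := hg
  obtain ⟨t, h3, h4⟩ := hh
  refine ⟨s + t, ?_, ?_⟩
  · rw [act_mul, h3, map_smul, h1, smul_smul, Real.exp_add, mul_comm]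
  · rw [act_mul, h4, map_smul, h2, smul_smul, neg_add, Real.exp_add, mul_comm]

theorem IsAM.inv {g : G d} (hg : IsAM g) : IsAM g⁻¹ := by
  obtain ⟨s, h1, h2⟩ := hg
  refine ⟨-s, ?_, ?_⟩
  · rw [act_inv_eq_iff, map_smul, h1, smul_smul, ← Real.exp_add]; simp
  · rw [act_inv_eq_iff, map_smul, h2, smul_smul, ← Real.exp_add]; simp

theorem IsAM.exists_mul {h : G d} (hh : IsAM h) :
    ∃ t, ∃ m ∈ grpM d, h = aElt d t * m := by
  obtain ⟨t, hP, hM⟩ := hh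
  refine ⟨t, (aElt d t)⁻¹ * h, ?_, by simp⟩
  rw [mem_grpM_iff, ← aElt_neg]
  simp [act_mul, hP, hM, smul_smul, ← Real.exp_add]

/-- Elements of `𝒜ℳ` normalize `𝒰`. -/
theorem IsAM.conj_uElt {h : G d} (hh : IsAM h) (s : Mid d → ℝ) :
    ∃ s', h * uElt s * h⁻¹ = uElt s' := by
  have hh' := hh
  obtain ⟨t, hP, hM⟩ := hh
  obtain ⟨s', hs'⟩ := hh'.act_emb (Real.exp t • s)
  refine ⟨s', ?_⟩
  rw [mul_inv_eq_iff_eq_mul]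
  have hn : bil d (emb d s') (emb d s') = Real.exp t ^ 2 * bil d (emb d s) (emb d s) := by
    rw [← hs', bil_act]
    simp
    ring
  have hl : Real.exp t • act h (emb d s) = emb d s' := by rw [← hs']; simp
  apply ext_act
  · simp [act_mul, hP]
  · simp only [act_mul, act_uElt_eM, map_add, map_sub, map_smul, hM, hP, hn]
    rw [← hl]
    ext i
    simp
    rw [Real.exp_neg]
    field_simp
  · intro r
    obtain ⟨r', hr'⟩ := hh'.act_emb r
    simp only [act_mul, act_uElt_emb, map_sub, map_smul, hP, hr']
    rw [← hl, ← hr', map_smul, bil_act]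
    ext i
    simp
    ring

/-- The stabilizer of `o + v_o` is `𝒰ℳ`. -/
theorem exists_uElt_mul_of_act_eP {g : G d} (hg : act g (eP d) = eP d) :
    ∃ s, ∃ m ∈ grpM d, g = uElt s * m := by
  have hn : bil d (act g (eM d)) (act g (eM d)) = 0 := by rw [bil_act]; simp
  have hb : bil d (act g (eM d)) (eP d) = -2 := by
    conv_lhs => rw [← hg]
    rw [bil_act]; simp
  refine ⟨-(2⁻¹ : ℝ) • restr d (act g (eM d)),
    (uElt (-(2⁻¹ : ℝ) • restr d (act g (eM d))))⁻¹ * g, ?_, by simp⟩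
  rw [mem_grpM_iff, act_mul, act_mul]
  constructor
  · rw [act_inv_eq_iff, hg]; simp
  · rw [act_inv_eq_iff, act_uElt_transitive hn hb]

/-- A non-zero direction s, available because d ≥ 2, shows that x is orthogonal to e₊. Taking s to
be the middle part of x then shows that this part has norm zero. -/
theorem eq_smul_eP_of_fixed {x : Fin (d + 1) → ℝ} (h : ∀ s, act (uElt s) x = x) :
    x = (-(bil d x (eM d)) / 2) • eP d := by
  have key : ∀ s, bil d x (eP d) • emb d s - bil d x (emb d s) • eP d
      - (2⁻¹ * bil d (emb d s) (emb d s) * bil d x (eP d)) • eP d = 0 := by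
    intro s
    have := h s
    rw [act_uElt] at this
    linear_combination (exp := 1) this
  have h0 : bil d x (eP d) = 0 := by
    obtain ⟨i⟩ := (inferInstance : Nonempty (Mid d))
    have := congrFun (key (Pi.single i 1)) i
    simpa using this
  have h1 : restr d x = 0 := by
    rw [← bil_emb_self_eq_zero]
    have := congrFun (key (restr d x)) 0
    rw [h0] at this
    simp [bil_emb] at this
    simp [bil_emb]
    linarith
  conv_lhs => rw [decomp x, h0, h1]
  simp

end OrbitClosure

end

noncomputable section

set_option linter.unusedSectionVars false

namespace OrbitClosure

variable {d : ℕ} [hd : Fact (2 ≤ d)]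

/-! ## The topology of `G` -/

theorem isClosedEmbedding_toMat :
    IsClosedEmbedding (toMat : G d → Matrix (Fin (d + 1)) (Fin (d + 1)) ℝ) := by
  have h1 : IsClosedEmbedding (Subtype.val : G d → SOd1 d) :=
    IsClosed.isClosedEmbedding_subtypeVal isClosed_connectedComponent
  have h3 : IsClosedEmbedding (Subtype.val : Matrix.SpecialLinearGroup (Fin (d + 1)) ℝ →
      Matrix (Fin (d + 1)) (Fin (d + 1)) ℝ) := by
    apply IsClosed.isClosedEmbedding_subtypeVal
    exact isClosed_eq (continuous_id.matrix_det) continuous_const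
  have h2 : IsClosedEmbedding (Subtype.val : SOd1 d → Matrix.SpecialLinearGroup (Fin (d + 1)) ℝ) := by
    apply IsClosed.isClosedEmbedding_subtypeVal
    change IsClosed {g : Matrix.SpecialLinearGroup (Fin (d + 1)) ℝ |
      (g.1)ᵀ * formJ d * g.1 = formJ d}
    refine isClosed_eq ?_ continuous_const
    exact (h3.continuous.matrix_transpose.matrix_mul continuous_const).matrix_mul h3.continuous
  exact h3.comp (h2.comp h1)

theorem continuous_toMat : Continuous (toMat : G d → _) := isClosedEmbedding_toMat.continuous

instance : FirstCountableTopology (Matrix (Fin (d + 1)) (Fin (d + 1)) ℝ) :=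
  inferInstanceAs (FirstCountableTopology (Fin (d + 1) → Fin (d + 1) → ℝ))

instance : T2Space (G d) := isClosedEmbedding_toMat.isEmbedding.t2Space

instance : FirstCountableTopology (G d) :=
  isClosedEmbedding_toMat.isInducing.firstCountableTopology

theorem toMat_apply (g : G d) (i j : Fin (d + 1)) : toMat g i j = act g (Pi.single j 1) i := by
  simp [act_apply]

theorem continuous_act_pair :
    Continuous fun p : G d × (Fin (d + 1) → ℝ) => act p.1 p.2 := by
  simp only [act_apply]
  exact (continuous_toMat.comp continuous_fst).matrix_mulVec continuous_snd

theorem continuous_act (x : Fin (d + 1) → ℝ) : Continuous fun g : G d => act g x :=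
  continuous_act_pair.comp (continuous_id.prodMk continuous_const)

theorem tendsto_act {α : Type*} {l : Filter α} {f : α → G d} {g : G d}
    {y : α → Fin (d + 1) → ℝ} {x : Fin (d + 1) → ℝ} (hf : Tendsto f l (𝓝 g))
    (hy : Tendsto y l (𝓝 x)) : Tendsto (fun a => act (f a) (y a)) l (𝓝 (act g x)) :=
  (continuous_act_pair.tendsto (g, x)).comp (hf.prodMk_nhds hy)

theorem tendsto_iff_act {α : Type*} {l : Filter α} {f : α → G d} {g : G d} :
    Tendsto f l (𝓝 g) ↔ ∀ x, Tendsto (fun a => act (f a) x) l (𝓝 (act g x)) := by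
  refine ⟨fun h x => tendsto_act h tendsto_const_nhds, fun h => ?_⟩
  rw [isClosedEmbedding_toMat.tendsto_nhds_iff]
  refine tendsto_pi_nhds.2 fun i => ?_
  rw [tendsto_pi_nhds]
  intro j
  simpa [toMat_apply] using (tendsto_pi_nhds.1 (h (Pi.single j 1)) i)

theorem continuous_bil : Continuous fun p : (Fin (d + 1) → ℝ) × (Fin (d + 1) → ℝ) =>
    bil d p.1 p.2 := by
  simp only [bil_eq_sum]
  fun_prop

theorem continuous_emb : Continuous (emb d) := LinearMap.continuous_of_finiteDimensional _

theorem continuous_restr : Continuous (restr d) := LinearMap.continuous_of_finiteDimensional _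

theorem continuous_uElt : Continuous (uElt : (Mid d → ℝ) → G d) := by
  rw [continuous_iff_continuousAt]
  intro s
  rw [ContinuousAt, tendsto_iff_act]
  intro x
  refine Continuous.tendsto (f := fun a => act (uElt a) x) ?_ s
  simp only [act_uElt]
  have h1 := continuous_emb (d := d)
  have h2 : Continuous fun a => bil d x (emb d a) :=
    continuous_bil.comp (continuous_const.prodMk h1)
  have h3 : Continuous fun a => bil d (emb d a) (emb d a) :=
    continuous_bil.comp (h1.prodMk h1)
  fun_prop

/-! ## The future cone -/

theorem basePt_eq : basePt d = (2⁻¹ : ℝ) • (eP d + eM d) := by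
  rw [eP, eM]; module

@[simp] theorem basePt_zero : basePt d 0 = 0 := by simp [basePt_eq]

@[simp] theorem basePt_last : basePt d (Fin.last d) = 1 := by simp [basePt]

@[simp] theorem basePt_mid (i : Mid d) : basePt d i = 0 := by simp [basePt_eq]

theorem bil_basePt (x : Fin (d + 1) → ℝ) : bil d x (basePt d) = -x (Fin.last d) := by
  simp [bil_split]

theorem bil_eq_sum_erase (x y : Fin (d + 1) → ℝ) :
    bil d x y = ∑ i ∈ Finset.univ.erase (Fin.last d), x i * y i
      - x (Fin.last d) * y (Fin.last d) := by
  rw [bil_eq_sum, ← Finset.sum_erase_add _ _ (Finset.mem_univ (Fin.last d))]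
  have : ∑ i ∈ Finset.univ.erase (Fin.last d),
      (if i = Fin.last d then (-1 : ℝ) else 1) * (x i * y i) =
      ∑ i ∈ Finset.univ.erase (Fin.last d), x i * y i :=
    Finset.sum_congr rfl fun i hi => by simp [Finset.ne_of_mem_erase hi]
  rw [this]
  simp
  ring

/-- The form is positive on the coordinates other than the last, so the last coordinate and the
value of the form control all the others. -/
theorem sq_le_of_bil (x : Fin (d + 1) → ℝ) (i : Fin (d + 1)) :
    (x i) ^ 2 ≤ max 0 (bil d x x) + (x (Fin.last d)) ^ 2 := by
  by_cases h : i = Fin.last d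
  · subst h; linarith [le_max_left 0 (bil d x x)]
  · have h1 := bil_eq_sum_erase x x
    have h2 : x i * x i ≤ ∑ j ∈ Finset.univ.erase (Fin.last d), x j * x j :=
      Finset.single_le_sum (f := fun j => x j * x j) (fun j _ => mul_self_nonneg _)
        (Finset.mem_erase.2 ⟨h, Finset.mem_univ _⟩)
    nlinarith [le_max_right 0 (bil d x x)]

/-- Reversed Cauchy–Schwarz: ordinary Cauchy–Schwarz on the spatial coordinates makes their
contribution smaller than the product of the last ones. -/
theorem bil_neg_of_future {x y : Fin (d + 1) → ℝ} (hx : bil d x x ≤ 0) (hx' : 0 < x (Fin.last d))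
    (hy : bil d y y < 0) (hy' : 0 < y (Fin.last d)) : bil d x y < 0 := by
  rw [bil_eq_sum_erase] at *
  set S := Finset.univ.erase (Fin.last d)
  have cs := Finset.sum_mul_sq_le_sq_mul_sq S x y
  simp only [pow_two (x _), pow_two (y _)] at cs
  have hx0 : 0 ≤ ∑ i ∈ S, x i * x i := Finset.sum_nonneg fun i _ => mul_self_nonneg _
  have hlt : (∑ i ∈ S, x i * y i) ^ 2 < (x (Fin.last d) * y (Fin.last d)) ^ 2 := by
    have hxx : 0 < x (Fin.last d) * x (Fin.last d) := mul_pos hx' hx'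
    calc _ ≤ _ := cs
      _ ≤ (x (Fin.last d) * x (Fin.last d)) * ∑ i ∈ S, y i * y i := by
        gcongr
        · exact Finset.sum_nonneg fun i _ => mul_self_nonneg _
        · linarith
      _ < (x (Fin.last d) * x (Fin.last d)) * (y (Fin.last d) * y (Fin.last d)) := by
        gcongr; linarith
      _ = _ := by ring
  have := abs_lt_of_sq_lt_sq hlt (mul_pos hx' hy').le
  linarith [(abs_lt.1 this).2]

theorem bil_basePt_basePt : bil d (basePt d) (basePt d) = -1 := by simp [bil_basePt]

/-- On all of `SOd1 d` the last diagonal entry has square at least 1. On the identity component it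
cannot change sign, and it equals 1 at the identity. -/
theorem one_le_act_basePt_last (g : G d) : 1 ≤ act g (basePt d) (Fin.last d) := by
  have key : ∀ g : SOd1 d, 1 ≤ (g.1.1 (Fin.last d) (Fin.last d)) ^ 2 := by
    intro g
    have h := congrFun (congrFun g.2 (Fin.last d)) (Fin.last d)
    rw [formJ, Matrix.mul_apply] at h
    simp only [Matrix.mul_diagonal, Matrix.transpose_apply, Matrix.diagonal_apply_eq] at h
    rw [← Finset.sum_erase_add _ _ (Finset.mem_univ (Fin.last d))] at h
    have : 0 ≤ ∑ i ∈ Finset.univ.erase (Fin.last d),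
      g.1.1 i (Fin.last d) * (if i = Fin.last d then (-1 : ℝ) else 1) * g.1.1 i (Fin.last d) :=
      Finset.sum_nonneg fun i hi => by
        simp [Finset.ne_of_mem_erase hi, mul_self_nonneg]
    simp at h this
    nlinarith
  have hcont : Continuous fun g : SOd1 d => g.1.1 (Fin.last d) (Fin.last d) := by
    have h : Continuous fun g : SOd1 d => g.1.1 :=
      continuous_subtype_val.comp continuous_subtype_val
    exact h.matrix_elem _ _
  have hpre : IsPreconnected ((fun g : SOd1 d => g.1.1 (Fin.last d) (Fin.last d)) ''
      connectedComponent 1) := isPreconnected_connectedComponent.image _ hcont.continuousOn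
  have hg : act g (basePt d) (Fin.last d) = g.1.1.1 (Fin.last d) (Fin.last d) := by
    rw [basePt, ← toMat_apply]; rfl
  rw [hg]
  by_contra hlt
  push Not at hlt
  have h2 := key g.1
  have hneg : g.1.1.1 (Fin.last d) (Fin.last d) ≤ 0 := by nlinarith
  have h1 : (1 : ℝ) ∈ (fun g : SOd1 d => g.1.1 (Fin.last d) (Fin.last d)) ''
      connectedComponent 1 := ⟨1, mem_connectedComponent, by simp⟩
  -- A negative value at g would give, by connectedness, a k in the component whose entry is 0.
  obtain ⟨k, -, hk⟩ := hpre.Icc_subset ⟨g.1, g.2, rfl⟩ h1 ⟨hneg, zero_le_one⟩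
  have := key k
  simp only at hk
  rw [hk] at this
  norm_num at this

/-- `G` preserves the future cone. -/
theorem act_last_pos (g : G d) {x : Fin (d + 1) → ℝ} (hx : bil d x x ≤ 0)
    (hx' : 0 < x (Fin.last d)) : 0 < act g x (Fin.last d) := by
  have h : bil d (act g x) (basePt d) = bil d x (act g⁻¹ (basePt d)) := bil_act_left g _ _
  rw [bil_basePt] at h
  have := bil_neg_of_future hx hx' (y := act g⁻¹ (basePt d))
    (by rw [bil_act, bil_basePt_basePt]; norm_num)
    (by linarith [one_le_act_basePt_last (g⁻¹ : G d)])
  linarith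

theorem act_inv_basePt_last (g : G d) :
    act g⁻¹ (basePt d) (Fin.last d) = act g (basePt d) (Fin.last d) := by
  have h := bil_act_left g (basePt d) (basePt d)
  rw [bil_basePt, bil_comm, bil_basePt] at h
  linarith

/-- The last coordinate of column j is, up to sign, the j-th coordinate of g⁻¹ o. It is bounded
through the height of g⁻¹, which equals that of g; the whole column follows. -/
theorem sq_toMat_le (g : G d) (i j : Fin (d + 1)) :
    (toMat g i j) ^ 2 ≤ 1 + (act g (basePt d) (Fin.last d)) ^ 2 := by
  have h1 := sq_le_of_bil (act g (Pi.single j 1)) i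
  rw [bil_act] at h1
  have h2 : max 0 (bil d (Pi.single j 1) (Pi.single j 1)) ≤ 1 := by
    apply max_le zero_le_one
    rw [bil_eq_sum, Finset.sum_eq_single j]
    · split_ifs <;> simp
    · intro k _ hk; simp [hk]
    · simp
  have h3 : act g (Pi.single j 1) (Fin.last d) = -bil d (Pi.single j 1) (act g⁻¹ (basePt d)) := by
    rw [← bil_act_left, bil_basePt]; ring
  have h4 : (act g (Pi.single j 1) (Fin.last d)) ^ 2 = (act g⁻¹ (basePt d) j) ^ 2 := by
    rw [h3, bil_eq_sum, Finset.sum_eq_single j]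
    · split_ifs <;> simp
    · intro k _ hk; simp [hk]
    · simp
  have h5 := sq_le_of_bil (act g⁻¹ (basePt d)) j
  rw [bil_act, bil_basePt_basePt, act_inv_basePt_last] at h5
  rw [toMat_apply]
  norm_num at h5
  linarith

/-- Properness of the action on ℍ^d. Compactness in G is always obtained below by bounding this
height. -/
theorem isCompact_act_basePt_le (R : ℝ) :
    IsCompact {g : G d | act g (basePt d) (Fin.last d) ≤ R} := by
  have hK : IsCompact (Set.univ.pi fun _ : Fin (d + 1) => Set.univ.pi fun _ : Fin (d + 1) =>
      Set.Icc (-(1 + |R|)) (1 + |R|)) :=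
    isCompact_univ_pi fun _ => isCompact_univ_pi fun _ => isCompact_Icc
  refine (isClosedEmbedding_toMat.isCompact_preimage hK).of_isClosed_subset
    (isClosed_le ((continuous_apply _).comp (continuous_act _)) continuous_const) ?_
  intro g hg
  refine fun i _ j _ => ?_
  change toMat g i j ∈ _
  rw [Set.mem_Icc, ← abs_le]
  have h1 := sq_toMat_le g i j
  have h2 := one_le_act_basePt_last g
  have hg' : act g (basePt d) (Fin.last d) ≤ R := hg
  apply abs_le_of_sq_le_sq _ (by positivity)
  nlinarith [le_abs_self R]

/-! ## Closed conditions -/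

/-- Preservation of the future cone gives c > 0, and preservation of the pairing of e₊ with e₋ gives
c c' = 1. -/
theorem isAM_of_smul {h : G d} {c c' : ℝ} (hP : act h (eP d) = c • eP d)
    (hM : act h (eM d) = c' • eM d) : IsAM h := by
  have hc : 0 < c := by
    have := act_last_pos h (x := eP d) (by simp) (by simp)
    rw [hP] at this
    simpa using this
  have hcc : c * c' = 1 := by
    have := bil_act h (eP d) (eM d)
    rw [hP, hM] at this
    simp at this
    linarith
  refine ⟨Real.log c, by rw [Real.exp_log hc, hP], ?_⟩
  rw [hM, Real.exp_neg, Real.exp_log hc, eq_inv_of_mul_eq_one_right hcc]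

theorem IsAM.smul_bil {h : G d} (hh : IsAM h) :
    act h (eP d) = (-(bil d (act h (eP d)) (eM d)) / 2) • eP d ∧
    act h (eM d) = (-(bil d (act h (eM d)) (eP d)) / 2) • eM d := by
  obtain ⟨t, h1, h2⟩ := hh
  constructor
  · rw [h1]; simp
  · rw [h2]; simp

theorem isClosed_isAM : IsClosed {h : G d | IsAM h} := by
  have : {h : G d | IsAM h} = {h : G d |
      act h (eP d) = (-(bil d (act h (eP d)) (eM d)) / 2) • eP d ∧
      act h (eM d) = (-(bil d (act h (eM d)) (eP d)) / 2) • eM d} := by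
    ext h
    exact ⟨fun hh => hh.smul_bil, fun hh => isAM_of_smul hh.1 hh.2⟩
  rw [this]
  have h1 := continuous_act (eP d)
  have h2 := continuous_act (eM d)
  have h3 : Continuous fun h : G d => bil d (act h (eP d)) (eM d) :=
    continuous_bil.comp (h1.prodMk continuous_const)
  have h4 : Continuous fun h : G d => bil d (act h (eM d)) (eP d) :=
    continuous_bil.comp (h2.prodMk continuous_const)
  exact (isClosed_eq h1 (by fun_prop)).inter (isClosed_eq h2 (by fun_prop))

/-- The parameter s is recovered continuously from u_s e₋, so 𝒰 is the fixed set of a continuous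
self-map of G. -/
theorem isClosed_range_uElt : IsClosed (Set.range (uElt : (Mid d → ℝ) → G d)) := by
  have : Set.range (uElt : (Mid d → ℝ) → G d) =
      {g | uElt (-(2⁻¹ : ℝ) • restr d (act g (eM d))) = g} := by
    ext g
    constructor
    · rintro ⟨s, rfl⟩
      simp only [Set.mem_ofPred_eq]
      congr 1
      rw [act_uElt_eM]
      ext i
      simp
    · intro hg
      exact ⟨_, hg⟩
  rw [this]
  have h' : Continuous fun g : G d => restr d (act g (eM d)) :=
    continuous_restr.comp (continuous_act _)
  have h : Continuous fun g : G d => -(2⁻¹ : ℝ) • restr d (act g (eM d)) := by fun_prop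
  exact isClosed_eq (continuous_uElt.comp h) continuous_id

theorem isClosed_grpM : IsClosed (grpM d) := by
  have : grpM d = {m : G d | act m (eP d) = eP d ∧ act m (eM d) = eM d} := by
    ext m; exact mem_grpM_iff m
  rw [this]
  exact (isClosed_eq (continuous_act _) continuous_const).inter
    (isClosed_eq (continuous_act _) continuous_const)

theorem isCompact_grpM : IsCompact (grpM d) := by
  refine (isCompact_act_basePt_le 1).of_isClosed_subset isClosed_grpM ?_
  intro m hm
  have : act m (basePt d) = basePt d := by rw [act_apply]; exact hm.1
  simp [this]

/-! ### The contracting subgroup in coordinates and its centralizer -/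

theorem tendsto_conj_uElt (s : Mid d → ℝ) :
    Tendsto (fun t : ℝ => aElt d (-t) * uElt s * aElt d t) atTop (𝓝 1) := by
  have h : ∀ t : ℝ, aElt d (-t) * uElt s * aElt d t = uElt (Real.exp (-t) • s) := by
    intro t
    rw [mul_assoc, uElt_mul_aElt, ← mul_assoc, aElt_neg, inv_mul_cancel, one_mul]
  simp only [h]
  rw [← uElt_zero]
  refine (continuous_uElt.tendsto 0).comp ?_
  have : Tendsto (fun t : ℝ => Real.exp (-t)) atTop (𝓝 0) :=
    Real.tendsto_exp_neg_atTop_nhds_zero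
  simpa using this.smul_const s

/-- Pairing a_{-t} u a_t e₊ with e₊ gives e^{2t}⟨u e₊, e₊⟩, which stays bounded only if u e₊ is
orthogonal, hence proportional, to e₊; the limit fixes the factor to 1. Thus u = u_s m with m in ℳ,
and m commutes with the boosts, so it survives in the limit and must be 1. -/
theorem mem_grpU_iff (u : G d) : u ∈ grpU d ↔ ∃ s, u = uElt s := by
  constructor
  · intro hu
    have hu' : Tendsto (fun t : ℝ => aElt d (-t) * u * aElt d t) atTop (𝓝 1) := hu
    have hP : Tendsto (fun t : ℝ => Real.exp t • act (aElt d (-t)) (act u (eP d))) atTop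
        (𝓝 (eP d)) := by
      have := tendsto_iff_act.1 hu' (eP d)
      simpa [act_mul] using this
    have h0 : bil d (act u (eP d)) (eP d) = 0 := by
      have h1 : Tendsto (fun t : ℝ => bil d (Real.exp t • act (aElt d (-t)) (act u (eP d))) (eP d))
          atTop (𝓝 (bil d (eP d) (eP d))) :=
        (continuous_bil.tendsto (eP d, eP d)).comp (hP.prodMk_nhds tendsto_const_nhds)
      have h2 : ∀ t : ℝ, bil d (Real.exp t • act (aElt d (-t)) (act u (eP d))) (eP d) =
          Real.exp (2 * t) * bil d (act u (eP d)) (eP d) := by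
        intro t
        rw [map_smul, LinearMap.smul_apply, bil_act_left, ← aElt_neg, neg_neg, act_aElt_eP,
          map_smul, smul_eq_mul, smul_eq_mul, ← mul_assoc, ← Real.exp_add]
        ring_nf
      simp only [h2, bil_eP_eP] at h1
      by_contra hne
      have h3 := h1.mul_const (bil d (act u (eP d)) (eP d))⁻¹
      simp only [mul_assoc, mul_inv_cancel₀ hne, mul_one, zero_mul] at h3
      exact not_tendsto_nhds_of_tendsto_atTop
        (Real.tendsto_exp_atTop.comp (tendsto_id.const_mul_atTop two_pos)) _ h3
    have h1 : act u (eP d) = eP d := by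
      have hn := eq_smul_eP_of_null (x := act u (eP d)) (by rw [bil_act]; simp) h0
      set c := -(bil d (act u (eP d)) (eM d)) / 2
      rw [hn] at hP
      have : ∀ t : ℝ, Real.exp t • act (aElt d (-t)) (c • eP d) = c • eP d := by
        intro t
        rw [map_smul, act_aElt_eP, smul_comm c, smul_smul, ← Real.exp_add]
        simp
      simp only [this] at hP
      rw [hn]
      exact tendsto_nhds_unique tendsto_const_nhds hP
    obtain ⟨s, m, hm, rfl⟩ := exists_uElt_mul_of_act_eP h1
    refine ⟨s, ?_⟩
    have h2 : ∀ t : ℝ, aElt d (-t) * (uElt s * m) * aElt d t =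
        (aElt d (-t) * uElt s * aElt d t) * m := by
      intro t
      rw [mul_assoc, mul_assoc, (isAM_of_mem_grpM hm).mul_aElt]
      simp only [mul_assoc]
    simp only [h2] at hu'
    have h3 := (tendsto_conj_uElt s).mul_const m
    rw [one_mul] at h3
    rw [tendsto_nhds_unique h3 hu', mul_one]
  · rintro ⟨s, rfl⟩
    exact tendsto_conj_uElt s

/-- `𝒰` is its own centralizer. -/
theorem eq_uElt_of_commute {q : G d} (h : ∀ s, q * uElt s = uElt s * q) : ∃ s, q = uElt s := by
  have hP : act q (eP d) = (-(bil d (act q (eP d)) (eM d)) / 2) • eP d := by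
    apply eq_smul_eP_of_fixed
    intro s
    rw [← act_mul, ← h, act_mul, act_uElt_eP]
  set c := -(bil d (act q (eP d)) (eM d)) / 2
  have hc : 0 < c := by
    have := act_last_pos q (x := eP d) (by simp) (by simp)
    rw [hP] at this
    simpa using this
  have hb : bil d (c • act q (eM d)) (eP d) = -2 := by
    have := bil_act q (eM d) (eP d)
    rw [hP] at this
    simpa using this
  have htr := act_uElt_transitive (y := c • act q (eM d)) (by simp [bil_act]) hb
  set s₀ := -(2⁻¹ : ℝ) • restr d (c • act q (eM d))
  -- Removing the unipotent part leaves an element that preserves both null lines and still commutes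
  -- with 𝒰.
  set k := (uElt s₀)⁻¹ * q with hk
  have hkP : act k (eP d) = c • eP d := by
    rw [hk, act_mul, act_inv_eq_iff, hP]; simp
  have hkM : act k (eM d) = c⁻¹ • eM d := by
    rw [hk, act_mul, act_inv_eq_iff, map_smul, htr, smul_smul, inv_mul_cancel₀ hc.ne', one_smul]
  have hkc : ∀ s, k * uElt s = uElt s * k := by
    intro s
    rw [hk, mul_assoc, h, ← mul_assoc, ← mul_assoc, ← uElt_neg, uElt_comm]
  have hkAM : IsAM k := isAM_of_smul hkP hkM
  -- Apply k u_s = u_s k to e₋: the coefficients of e₊ give the first identity, hence c = 1 below,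
  -- and the middle coordinates give the second.
  have hcomp : ∀ s, c * bil d (emb d s) (emb d s) = c⁻¹ * bil d (emb d s) (emb d s) ∧
      act k (emb d s) = c⁻¹ • emb d s := by
    intro s
    have h1 : act (k * uElt s) (eM d) = act (uElt s * k) (eM d) := by rw [hkc]
    obtain ⟨s', hs'⟩ := hkAM.act_emb s
    rw [act_mul k, act_mul _ k, hkM, act_uElt_eM, map_smul, act_uElt_eM, map_add, map_sub, map_smul,
      map_smul, hkM, hkP, hs'] at h1
    constructor
    · have := congrArg (fun x => bil d x (eM d)) h1
      simp at this
      linarith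
    · rw [hs']
      ext i
      by_cases hi : i ≠ 0 ∧ i ≠ Fin.last d
      · obtain ⟨j, rfl⟩ : ∃ j : Mid d, i = j := ⟨⟨i, hi⟩, rfl⟩
        have := congrFun h1 j
        simp at this
        simp
        linarith
      · simp [emb, hi]
  have hc1 : c = 1 := by
    obtain ⟨i⟩ := (inferInstance : Nonempty (Mid d))
    have h1 := (hcomp (Pi.single i 1)).1
    have h2 : bil d (emb d (Pi.single i 1)) (emb d (Pi.single i 1)) ≠ 0 := by
      rw [Ne, bil_emb_self_eq_zero]
      simp
    have h3 := mul_right_cancel₀ h2 h1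
    field_simp at h3
    nlinarith
  refine ⟨s₀, ?_⟩
  have : k = 1 := by
    apply ext_act
    · simp [hkP, hc1]
    · simp [hkM, hc1]
    · intro s
      simp [(hcomp s).2, hc1]
  rw [hk, inv_mul_eq_one] at this
  exact this.symm

end OrbitClosure

end

noncomputable section

set_option linter.unusedSectionVars false

namespace OrbitClosure

variable {d : ℕ} [hd : Fact (2 ≤ d)]

/-! ## The quotients `Γ \ G` -/

/-- The height of `g`: the hyperbolic cosine of the distance from `o` to `g o`. -/
def ht (g : G d) : ℝ := act g (basePt d) (Fin.last d)

theorem continuous_ht : Continuous (ht : G d → ℝ) :=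
  (continuous_apply _).comp (continuous_act _)

/-- The projection `G → Γ \ G`. -/
def proj (Γ : Subgroup (G d)) (g : G d) : LeftQuot Γ := Quotient.mk _ g

theorem proj_surjective (Γ : Subgroup (G d)) : Function.Surjective (proj Γ) :=
  Quotient.mk_surjective

theorem proj_eq_iff {Γ : Subgroup (G d)} {g h : G d} :
    proj Γ g = proj Γ h ↔ ∃ γ ∈ Γ, h = γ * g := by
  rw [proj, proj, Quotient.eq, QuotientGroup.rightRel_apply]
  constructor
  · intro hh
    exact ⟨h * g⁻¹, hh, by simp⟩
  · rintro ⟨γ, hγ, rfl⟩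
    simpa using hγ

theorem proj_mul_left {Γ : Subgroup (G d)} {γ : G d} (hγ : γ ∈ Γ) (g : G d) :
    proj Γ (γ * g) = proj Γ g := (proj_eq_iff.2 ⟨γ, hγ, rfl⟩).symm

theorem tr_proj {Γ : Subgroup (G d)} (g h : G d) : (proj Γ g).tr h = proj Γ (g * h) := rfl

theorem continuous_proj (Γ : Subgroup (G d)) : Continuous (proj Γ) := continuous_quotient_mk'

theorem isOpenMap_proj (Γ : Subgroup (G d)) : IsOpenMap (proj Γ) := by
  intro V hV
  change IsOpen (proj Γ ⁻¹' (proj Γ '' V))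
  have : proj Γ ⁻¹' (proj Γ '' V) = ⋃ γ ∈ Γ, (fun g => γ * g) ⁻¹' V := by
    ext g
    simp only [Set.mem_preimage, Set.mem_image, Set.mem_iUnion, exists_prop]
    constructor
    · rintro ⟨v, hv, h⟩
      obtain ⟨γ, hγ, rfl⟩ := proj_eq_iff.1 h.symm
      exact ⟨γ, hγ, hv⟩
    · rintro ⟨γ, hγ, h⟩
      exact ⟨γ * g, h, proj_mul_left hγ g⟩
  rw [this]
  exact isOpen_biUnion fun γ _ => hV.preimage (continuous_const_mul γ)

theorem continuous_tr {Γ : Subgroup (G d)} (g : G d) :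
    Continuous fun x : LeftQuot Γ => x.tr g := by
  refine (isOpenMap_proj Γ).isQuotientMap (continuous_proj Γ) (proj_surjective Γ)
    |>.continuous_iff.2 ?_
  exact (continuous_proj Γ).comp (continuous_mul_const g)

theorem continuous_ztr {Γ₁ Γ₂ : Subgroup (G d)} (g : G d × G d) :
    Continuous fun x : ZSpace Γ₁ Γ₂ => ztr x g :=
  ((continuous_tr g.1).comp continuous_fst).prodMk ((continuous_tr g.2).comp continuous_snd)

/-- Compact subsets of `Γ \ G` lift to sets of bounded height. -/
theorem exists_ht_le_of_isCompact {Γ : Subgroup (G d)} {C : Set (LeftQuot Γ)} (hC : IsCompact C) :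
    ∃ R : ℝ, ∀ g, proj Γ g ∈ C → ∃ γ ∈ Γ, ht (γ * g) ≤ R := by
  obtain ⟨n, hn⟩ := hC.elim_directed_cover (fun n : ℕ => proj Γ '' {g | ht g < n})
    (fun n => isOpenMap_proj Γ _ (isOpen_lt continuous_ht continuous_const))
    (fun x _ => by
      obtain ⟨g, rfl⟩ := proj_surjective Γ x
      obtain ⟨n, hn⟩ := exists_nat_gt (ht g)
      exact Set.mem_iUnion.2 ⟨n, g, hn, rfl⟩)
    (directed_of_isDirected_le fun m n hmn => Set.image_mono fun g (hg : ht g < m) =>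
      hg.trans_le (by exact_mod_cast hmn))
  refine ⟨n, fun g hg => ?_⟩
  obtain ⟨h, hh, heq⟩ := hn hg
  obtain ⟨γ, hγ, rfl⟩ := proj_eq_iff.1 heq.symm
  exact ⟨γ, hγ, le_of_lt hh⟩

/-! ## Limit sets -/

theorem klein_smul {c : ℝ} (hc : c ≠ 0) (x : Fin (d + 1) → ℝ) : klein (c • x) = klein x := by
  rw [klein, klein, smul_smul]
  congr 1
  simp only [Pi.smul_apply, smul_eq_mul, mul_inv]
  field_simp

theorem continuousAt_klein {x : Fin (d + 1) → ℝ} (hx : x (Fin.last d) ≠ 0) :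
    ContinuousAt (klein (d := d)) x := by
  unfold klein
  exact ((continuous_apply _).continuousAt.inv₀ hx).smul continuousAt_id

theorem klein_act_klein (g : G d) {x : Fin (d + 1) → ℝ} (hx : x (Fin.last d) ≠ 0) :
    klein (act g (klein x)) = klein (act g x) := by
  conv_lhs => rw [klein.eq_def x, map_smul]
  exact klein_smul (inv_ne_zero hx) _

theorem klein_last {x : Fin (d + 1) → ℝ} (hx : x (Fin.last d) ≠ 0) :
    klein x (Fin.last d) = 1 := by
  simp [klein, hx]

theorem klein_mem_hypBoundary {x : Fin (d + 1) → ℝ} (h : bil d x x = 0)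
    (hx : x (Fin.last d) ≠ 0) : klein x ∈ hypBoundary d :=
  ⟨by rw [quadForm_eq, klein]; simp [h], klein_last hx⟩

theorem act_eP_last_pos (g : G d) : 0 < act g (eP d) (Fin.last d) :=
  act_last_pos g (by simp) (by simp)

theorem act_eM_last_pos (g : G d) : 0 < act g (eM d) (Fin.last d) :=
  act_last_pos g (by simp) (by simp)

theorem isClosed_limitSet (Γ : Subgroup (G d)) : IsClosed (limitSet Γ) := by
  refine IsClosed.inter ?_ isClosed_closure
  have h : Continuous (quadForm d) := by
    rw [show quadForm d = fun x => bil d x x from funext quadForm_eq]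
    exact continuous_bil.comp (continuous_id.prodMk continuous_id)
  exact (isClosed_eq h continuous_const).inter (isClosed_eq (continuous_apply _) continuous_const)

theorem klein_act_mem_limitSet {Γ : Subgroup (G d)} {γ : G d} (hγ : γ ∈ Γ)
    {x : Fin (d + 1) → ℝ} (hx : klein x ∈ limitSet Γ) : klein (act γ x) ∈ limitSet Γ := by
  have hxl : x (Fin.last d) ≠ 0 := by
    intro h0
    have := hx.1.2
    simp [klein, h0] at this
  rw [← klein_act_klein γ hxl]
  obtain ⟨⟨hb, hl⟩, hc⟩ := hx
  rw [quadForm_eq] at hb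
  have hpos : 0 < act γ (klein x) (Fin.last d) := act_last_pos γ hb.le (by rw [hl]; exact one_pos)
  refine ⟨klein_mem_hypBoundary (by rw [bil_act, hb]) hpos.ne', ?_⟩
  have hcont : ContinuousAt (fun y => klein (act γ y)) (klein x) :=
    ContinuousAt.comp (f := act γ) (g := klein) (continuousAt_klein hpos.ne')
      (LinearMap.continuous_of_finiteDimensional (act γ)).continuousAt
  refine closure_mono ?_ (mem_closure_image (f := fun y => klein (act γ y)) hcont hc)
  rintro _ ⟨_, ⟨γ', hγ', rfl⟩, rfl⟩
  refine ⟨γ * γ', Γ.mul_mem hγ hγ', ?_⟩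
  rw [← act_apply, ← act_apply, act_mul]
  refine klein_act_klein γ ?_
  exact (lt_of_lt_of_le one_pos (one_le_act_basePt_last γ')).ne'

/-- Both endpoints of the geodesic of the frame `g` lie in the limit set. -/
def EndsIn (Γ : Subgroup (G d)) (g : G d) : Prop :=
  klein (act g (eP d)) ∈ limitSet Γ ∧ klein (act g (eM d)) ∈ limitSet Γ

theorem EndsIn.mul_left {Γ : Subgroup (G d)} {g γ : G d} (hg : EndsIn Γ g) (hγ : γ ∈ Γ) :
    EndsIn Γ (γ * g) := by
  rw [EndsIn, act_mul, act_mul]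
  exact ⟨klein_act_mem_limitSet hγ hg.1, klein_act_mem_limitSet hγ hg.2⟩

theorem EndsIn.mul_aElt {Γ : Subgroup (G d)} {g : G d} (hg : EndsIn Γ g) (t : ℝ) :
    EndsIn Γ (g * aElt d t) := by
  rw [EndsIn, act_mul, act_mul, act_aElt_eP, act_aElt_eM, map_smul, map_smul,
    klein_smul (Real.exp_ne_zero _), klein_smul (Real.exp_ne_zero _)]
  exact hg

/-- Moving along 𝒰 does not change the forward endpoint, so only the backward one has to be tested.
-/
theorem endsIn_mul_uElt {Γ : Subgroup (G d)} {g : G d} (hg : EndsIn Γ g) {s : Mid d → ℝ}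
    (hs : klein (act (g * uElt s) (eM d)) ∈ limitSet Γ) : EndsIn Γ (g * uElt s) :=
  ⟨by rw [act_mul, act_uElt_eP]; exact hg.1, hs⟩

theorem isClosed_endsIn (Γ : Subgroup (G d)) : IsClosed {g : G d | EndsIn Γ g} := by
  have h1 : Continuous fun g : G d => klein (act g (eP d)) :=
    continuous_iff_continuousAt.2 fun g =>
      ContinuousAt.comp (f := fun g : G d => act g (eP d)) (g := klein)
        (continuousAt_klein (act_eP_last_pos g).ne') (continuous_act _).continuousAt
  have h2 : Continuous fun g : G d => klein (act g (eM d)) :=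
    continuous_iff_continuousAt.2 fun g =>
      ContinuousAt.comp (f := fun g : G d => act g (eM d)) (g := klein)
        (continuousAt_klein (act_eM_last_pos g).ne') (continuous_act _).continuousAt
  exact ((isClosed_limitSet Γ).preimage h1).inter ((isClosed_limitSet Γ).preimage h2)

/-- Since o is half the sum of e₊ and e₋, the Klein point of g o lies on the segment joining the two
endpoints. -/
theorem EndsIn.act_basePt_mem_hull {Γ : Subgroup (G d)} {g : G d} (hg : EndsIn Γ g) :
    act g (basePt d) ∈ hypHull d (limitSet Γ) := by
  have hp := act_eP_last_pos g
  have hm := act_eM_last_pos g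
  refine ⟨⟨by rw [quadForm_eq, bil_act, bil_basePt_basePt],
    lt_of_lt_of_le one_pos (one_le_act_basePt_last g)⟩, ?_⟩
  set p := act g (eP d) (Fin.last d)
  set m := act g (eM d) (Fin.last d)
  have : klein (act g (basePt d)) =
      (p / (p + m)) • klein (act g (eP d)) + (m / (p + m)) • klein (act g (eM d)) := by
    rw [basePt_eq, map_smul, klein_smul (by norm_num), map_add, klein, klein, klein, Pi.add_apply,
      smul_smul, smul_smul, smul_add]
    change (p + m)⁻¹ • _ + (p + m)⁻¹ • _ = (p / (p + m) * p⁻¹) • _ + (m / (p + m) * m⁻¹) • _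
    congr 2 <;> field_simp
  rw [this]
  refine convex_convexHull ℝ _ (subset_convexHull ℝ _ hg.1) (subset_convexHull ℝ _ hg.2)
    (by positivity) (by positivity) (by field_simp)

/-- The frames with endpoints in the limit set of a convex cocompact group form a set which is
compact modulo the group. -/
theorem exists_ht_le_of_endsIn {Γ : Subgroup (G d)} (hΓ : IsConvexCocompact Γ) :
    ∃ R : ℝ, ∀ g, EndsIn Γ g → ∃ γ ∈ Γ, ht (γ * g) ≤ R := by
  set r : hypHull d (limitSet Γ) → hypHull d (limitSet Γ) → Prop :=
    fun x y => ∃ γ ∈ Γ, toMat γ *ᵥ (x : Fin (d + 1) → ℝ) = y with hr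
  have hcs : CompactSpace (Quot r) := hΓ
  have hequiv : Equivalence r := by
    refine ⟨fun x => ⟨1, Γ.one_mem, by rw [← act_apply]; simp⟩, ?_, ?_⟩
    · rintro x y ⟨γ, hγ, h⟩
      refine ⟨γ⁻¹, Γ.inv_mem hγ, ?_⟩
      rw [← act_apply] at h ⊢
      rw [← h, act_inv_act]
    · rintro x y z ⟨γ, hγ, h⟩ ⟨γ', hγ', h'⟩
      refine ⟨γ' * γ, Γ.mul_mem hγ' hγ, ?_⟩
      rw [← act_apply] at h h' ⊢
      rw [act_mul, h, h']
  let V : ℕ → Set (hypHull d (limitSet Γ)) := fun n =>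
    {x | ∃ γ ∈ Γ, act γ (x : Fin (d + 1) → ℝ) (Fin.last d) < n}
  have hVopen : ∀ n, IsOpen (V n) := by
    intro n
    have : V n = ⋃ γ ∈ Γ,
        {x : hypHull d (limitSet Γ) | act γ (x : Fin (d + 1) → ℝ) (Fin.last d) < n} := by
      ext x
      simp only [V, Set.mem_ofPred_eq, Set.mem_iUnion, exists_prop]
    rw [this]
    refine isOpen_biUnion fun γ _ => isOpen_lt ?_ continuous_const
    exact (continuous_apply _).comp
      ((LinearMap.continuous_of_finiteDimensional (act γ)).comp continuous_subtype_val)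
  -- Saturation under Γ turns the open sets V n into open sets of the quotient, to which compactness
  -- applies.
  have hVsat : ∀ n, Quot.mk r ⁻¹' (Quot.mk r '' V n) = V n := by
    intro n
    refine Set.Subset.antisymm ?_ (Set.subset_preimage_image _ _)
    rintro x ⟨y, ⟨γ, hγ, hy⟩, hxy⟩
    obtain ⟨γ', hγ', h⟩ := hequiv.symm (hequiv.quot_mk_eq_iff y x |>.1 hxy)
    refine ⟨γ * γ', Γ.mul_mem hγ hγ', ?_⟩
    rw [← act_apply] at h
    rwa [act_mul, h]
  obtain ⟨n, hn⟩ := (isCompact_univ (X := Quot r)).elim_directed_cover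
    (fun n : ℕ => Quot.mk r '' V n)
    (fun n => by
      rw [← isQuotientMap_quot_mk.isOpen_preimage, hVsat]
      exact hVopen n)
    (fun x _ => by
      obtain ⟨y, rfl⟩ := Quot.exists_rep x
      obtain ⟨n, hn⟩ := exists_nat_gt ((y : Fin (d + 1) → ℝ) (Fin.last d))
      exact Set.mem_iUnion.2 ⟨n, y, ⟨1, Γ.one_mem, by simpa using hn⟩, rfl⟩)
    (directed_of_isDirected_le fun m n hmn => Set.image_mono fun x ⟨γ, hγ, hx⟩ =>
      ⟨γ, hγ, hx.trans_le (by exact_mod_cast hmn)⟩)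
  refine ⟨n, fun g hg => ?_⟩
  have hx : (⟨act g (basePt d), hg.act_basePt_mem_hull⟩ : hypHull d (limitSet Γ)) ∈ V n := by
    rw [← hVsat]
    exact hn (Set.mem_univ _)
  obtain ⟨γ, hγ, h⟩ := hx
  refine ⟨γ, hγ, ?_⟩
  rw [ht, act_mul]
  exact h.le

/-! ### Bounded 𝒜-orbits and endpoints in the limit set -/

theorem isCompact_ht_le (R : ℝ) : IsCompact {g : G d | ht g ≤ R} := isCompact_act_basePt_le R

/-- Frames with endpoints in the limit set have bounded `𝒜`-orbits. -/
theorem EndsIn.mem_RF {Γ : Subgroup (G d)} [DiscreteTopology Γ] (hΓ : IsConvexCocompact Γ)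
    {g : G d} (hg : EndsIn Γ g) : proj Γ g ∈ RF Γ := by
  obtain ⟨R, hR⟩ := exists_ht_le_of_endsIn hΓ
  have hΓc : IsClosed (Γ : Set (G d)) := Subgroup.isClosed_of_discrete
  -- The preimage of this image is Γ times a compact set, hence closed since Γ is closed. This
  -- replaces an appeal to a Hausdorff quotient.
  have hcl : IsClosed (proj Γ '' {g : G d | ht g ≤ R}) := by
    rw [← ((isOpenMap_proj Γ).isQuotientMap (continuous_proj Γ)
      (proj_surjective Γ)).isClosed_preimage]
    have : proj Γ ⁻¹' (proj Γ '' {g : G d | ht g ≤ R}) = (Γ : Set (G d)) * {g : G d | ht g ≤ R} := by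
      ext g
      simp only [Set.mem_preimage, Set.mem_image, Set.mem_mul, SetLike.mem_coe]
      constructor
      · rintro ⟨v, hv, h⟩
        obtain ⟨γ, hγ, rfl⟩ := proj_eq_iff.1 h
        exact ⟨γ, hγ, v, hv, rfl⟩
      · rintro ⟨γ, hγ, v, hv, rfl⟩
        exact ⟨v, hv, (proj_mul_left hγ v).symm⟩
    rw [this]
    exact hΓc.mul_right_of_isCompact (isCompact_ht_le R)
  refine ((isCompact_ht_le R).image (continuous_proj Γ)).of_isClosed_subset isClosed_closure ?_
  refine closure_minimal ?_ hcl
  rintro _ ⟨_, ⟨t, rfl⟩, rfl⟩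
  obtain ⟨γ, hγ, h⟩ := hR _ (hg.mul_aElt t)
  exact ⟨γ * (g * aElt d t), h, proj_mul_left hγ _⟩

/-- Points of ℍ^d whose distance has hyperbolic cosine at most C become close in the Klein ball as
they approach the boundary: the norm of the difference is at most 2C divided by the product of the
heights. -/
theorem sq_klein_sub_le {x y : Fin (d + 1) → ℝ} (hx : bil d x x = -1) (hy : bil d y y = -1)
    (hx' : 0 < x (Fin.last d)) (hy' : 1 ≤ y (Fin.last d)) {C : ℝ} (hC : -bil d x y ≤ C)
    (hC0 : 0 ≤ C) (i : Fin (d + 1)) :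
    (klein x i - klein y i) ^ 2 ≤ 2 * C / x (Fin.last d) := by
  have h1 := sq_le_of_bil (klein x - klein y) i
  have h2 : (klein x - klein y) (Fin.last d) = 0 := by
    rw [Pi.sub_apply, klein_last hx'.ne', klein_last (by linarith), sub_self]
  have hy0 : 0 < y (Fin.last d) := by linarith
  have h3 : bil d (klein x - klein y) (klein x - klein y) ≤ 2 * C / x (Fin.last d) := by
    simp only [klein, map_sub, map_smul, LinearMap.sub_apply, LinearMap.smul_apply, smul_eq_mul,
      hx, hy, bil_comm y x]
    set a := x (Fin.last d)
    set b := y (Fin.last d)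
    have : 2 * C / a ≥ 2 * (a⁻¹ * b⁻¹ * C) := by
      have hb : b⁻¹ ≤ 1 := inv_le_one_of_one_le₀ hy'
      have : a⁻¹ * C * b⁻¹ ≤ a⁻¹ * C * 1 := by gcongr
      rw [div_eq_mul_inv]; nlinarith
    have h4 : a⁻¹ * b⁻¹ * (-bil d x y) ≤ a⁻¹ * b⁻¹ * C := by gcongr
    have h5 := mul_self_nonneg a⁻¹
    have h6 := mul_self_nonneg b⁻¹
    nlinarith
  rw [h2] at h1
  have h4 : 0 ≤ 2 * C / x (Fin.last d) := by positivity
  have h5 := max_le h4 h3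
  simp only [Pi.sub_apply] at h1
  linarith

/-- A frame whose forward geodesic ray stays bounded modulo `Γ` ends in the limit set. -/
theorem klein_mem_limitSet_of_tendsto {Γ : Subgroup (G d)} {g : ℕ → G d} {R : ℝ}
    {x : Fin (d + 1) → ℝ} (hx : bil d x x = 0) (hx' : 0 < x (Fin.last d)) {c : ℕ → ℝ}
    (hc : Tendsto c atTop atTop)
    (hg : Tendsto (fun n => (c n)⁻¹ • act (g n) (basePt d)) atTop (𝓝 x))
    (hR : ∀ n, ∃ γ ∈ Γ, ht (γ * g n) ≤ R) : klein x ∈ limitSet Γ := by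
  refine ⟨klein_mem_hypBoundary hx hx'.ne', ?_⟩
  choose γ hγ hγR using hR
  have h1 : Tendsto (fun n => klein (act (g n) (basePt d))) atTop (𝓝 (klein x)) := by
    refine (((continuousAt_klein hx'.ne').tendsto).comp hg).congr' ?_
    filter_upwards [hc.eventually_gt_atTop 0] with n hn
    exact klein_smul (inv_ne_zero hn.ne') _
  have hlast : Tendsto (fun n => ht (g n)) atTop atTop := by
    have h2 : Tendsto (fun n => (c n)⁻¹ * ht (g n)) atTop (𝓝 (x (Fin.last d))) :=
      (tendsto_pi_nhds.1 hg) (Fin.last d)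
    refine (hc.atTop_mul_pos hx' h2).congr' ?_
    filter_upwards [hc.eventually_gt_atTop 0] with n hn
    field_simp
  have hR1 : 0 ≤ R := le_trans zero_le_one
    ((one_le_act_basePt_last (γ 0 * g 0)).trans (hγR 0))
  have hdiff : ∀ i, Tendsto (fun n => klein (act (g n) (basePt d)) i -
      klein (act (γ n)⁻¹ (basePt d)) i) atTop (𝓝 0) := by
    intro i
    have hb : ∀ n, (klein (act (g n) (basePt d)) i - klein (act (γ n)⁻¹ (basePt d)) i) ^ 2 ≤
        2 * R / ht (g n) := by
      intro n
      refine sq_klein_sub_le (by rw [bil_act, bil_basePt_basePt])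
        (by rw [bil_act, bil_basePt_basePt])
        (lt_of_lt_of_le one_pos (one_le_act_basePt_last _)) (one_le_act_basePt_last _) ?_ hR1 i
      rw [← bil_act_left, ← act_mul, bil_basePt, neg_neg]
      exact hγR n
    have h0 : Tendsto (fun n => 2 * R / ht (g n)) atTop (𝓝 0) := hlast.const_div_atTop _
    have hsq := squeeze_zero (fun n => sq_nonneg _) hb h0
    have := (Real.continuous_sqrt.tendsto 0).comp hsq
    simp only [Function.comp_def, Real.sqrt_sq_eq_abs, Real.sqrt_zero] at this
    exact (tendsto_zero_iff_abs_tendsto_zero _).2 this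
  have h3 : Tendsto (fun n => klein (act (γ n)⁻¹ (basePt d))) atTop (𝓝 (klein x)) := by
    rw [tendsto_pi_nhds] at h1 ⊢
    intro i
    simpa using (h1 i).sub (hdiff i)
  refine mem_closure_of_tendsto h3 (Eventually.of_forall fun n => ?_)
  exact ⟨(γ n)⁻¹, Γ.inv_mem (hγ n), by rw [← act_apply]⟩

/-- Since a_t o = (e^t e₊ + e^{-t} e₋)/2, rescaling by e^{-t} tends to e₊/2 as t → ∞; t → -∞
likewise gives e₋/2. Boundedness of the orbit keeps Γ o at bounded distance from both rays. -/
theorem endsIn_of_mem_RF {Γ : Subgroup (G d)} {g : G d} (hg : proj Γ g ∈ RF Γ) : EndsIn Γ g := by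
  obtain ⟨R, hR⟩ := exists_ht_le_of_isCompact (Γ := Γ) hg
  have hR' : ∀ t, ∃ γ ∈ Γ, ht (γ * (g * aElt d t)) ≤ R := fun t =>
    hR _ (subset_closure ⟨aElt d t, ⟨t, rfl⟩, tr_proj _ _⟩)
  have hexp : Tendsto (fun n : ℕ => Real.exp n) atTop atTop :=
    Real.tendsto_exp_atTop.comp tendsto_natCast_atTop_atTop
  have hexp2 : Tendsto (fun n : ℕ => Real.exp (-n) * Real.exp (-n)) atTop (𝓝 0) := by
    have : Tendsto (fun n : ℕ => Real.exp (-n)) atTop (𝓝 0) :=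
      Real.tendsto_exp_neg_atTop_nhds_zero.comp tendsto_natCast_atTop_atTop
    simpa using this.mul this
  have hcomb : ∀ (n : ℕ) (x y : Fin (d + 1) → ℝ),
      (2⁻¹ : ℝ) • (x + (Real.exp (-n) * Real.exp (-n)) • y) =
        (Real.exp n)⁻¹ • (2⁻¹ : ℝ) • (Real.exp n • x + Real.exp (-n) • y) := by
    intro n x y
    have h := Real.exp_ne_zero n
    rw [Real.exp_neg]
    ext i
    simp
    field_simp
  have hsmul : ∀ x y : Fin (d + 1) → ℝ, Tendsto (fun n : ℕ => (2⁻¹ : ℝ) •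
      (x + (Real.exp (-n) * Real.exp (-n)) • y)) atTop (𝓝 ((2⁻¹ : ℝ) • x)) := by
    intro x y
    simpa using ((hexp2.smul_const y).const_add x).const_smul (2⁻¹ : ℝ)
  constructor
  · rw [← klein_smul (show (2⁻¹ : ℝ) ≠ 0 by norm_num)]
    refine klein_mem_limitSet_of_tendsto (g := fun n : ℕ => g * aElt d n) (by simp [bil_act])
      (by simpa using act_eP_last_pos g) hexp ?_ (fun n => hR' _)
    refine (hsmul (act g (eP d)) (act g (eM d))).congr fun n => ?_
    rw [hcomb, act_mul, basePt_eq]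
    simp
  · rw [← klein_smul (show (2⁻¹ : ℝ) ≠ 0 by norm_num)]
    refine klein_mem_limitSet_of_tendsto (g := fun n : ℕ => g * aElt d (-n)) (by simp [bil_act])
      (by simpa using act_eM_last_pos g) hexp ?_ (fun n => hR' _)
    refine (hsmul (act g (eM d)) (act g (eP d))).congr fun n => ?_
    rw [hcomb, act_mul, basePt_eq, add_comm (eP d)]
    simp

end OrbitClosure

end

noncomputable section

set_option linter.unusedSectionVars false

namespace OrbitClosure

variable {d : ℕ} [hd : Fact (2 ≤ d)]

/-! ## Local Zariski density of the recurrence times -/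

theorem restr_act_uElt_eM (s : Mid d → ℝ) : restr d (act (uElt s) (eM d)) = (-2 : ℝ) • s := by
  rw [act_uElt_eM]
  ext i
  simp

theorem bil_act_uElt_eM_eP (s : Mid d → ℝ) : bil d (act (uElt s) (eM d)) (eP d) = -2 := by
  simp [act_uElt_eM]

/-- A null vector which is not on the attracting line is a multiple of some `u_s e_-`. -/
theorem exists_smul_act_uElt_eM {y : Fin (d + 1) → ℝ} (h : bil d y y = 0)
    (h' : bil d y (eP d) ≠ 0) :
    act (uElt ((bil d y (eP d))⁻¹ • restr d y)) (eM d) = (-2 / bil d y (eP d)) • y := by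
  rw [← act_uElt_transitive (y := (-2 / bil d y (eP d)) • y) (by simp [h])
    (by simp [div_mul_cancel₀ _ h'])]
  congr 2
  rw [map_smul, smul_smul]
  congr 1
  field_simp

/-- Lower semicontinuity of the set of times at which a limit point is visited. -/
theorem exists_tendsto_uElt {h : ℕ → G d} {h₀ : G d} (hh : Tendsto h atTop (𝓝 h₀))
    (σ : Mid d → ℝ) : ∃ τ : ℕ → Mid d → ℝ, Tendsto τ atTop (𝓝 σ) ∧ ∀ᶠ n in atTop,
      klein (act (h n * uElt (τ n)) (eM d)) = klein (act (h₀ * uElt σ) (eM d)) := by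
  set x := act (h₀ * uElt σ) (eM d) with hx
  have hxn : bil d x x = 0 := by rw [hx, bil_act]; simp
  have hy : Tendsto (fun n => act (h n)⁻¹ x) atTop (𝓝 (act (uElt σ) (eM d))) := by
    have h1 : Tendsto (fun n => act (h n)⁻¹ x) atTop (𝓝 (act h₀⁻¹ x)) :=
      tendsto_act hh.inv tendsto_const_nhds
    rwa [show act h₀⁻¹ x = act (uElt σ) (eM d) by rw [hx, act_mul, act_inv_act]] at h1
  have hb : Tendsto (fun n => bil d (act (h n)⁻¹ x) (eP d)) atTop (𝓝 (-2)) := by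
    rw [← bil_act_uElt_eM_eP σ]
    exact (continuous_bil.tendsto (act (uElt σ) (eM d), eP d)).comp
      (hy.prodMk_nhds tendsto_const_nhds)
  refine ⟨fun n => (bil d (act (h n)⁻¹ x) (eP d))⁻¹ • restr d (act (h n)⁻¹ x), ?_, ?_⟩
  · have h1 := ((continuous_restr (d := d)).tendsto _).comp hy
    have h2 := (hb.inv₀ (by norm_num)).smul h1
    rw [restr_act_uElt_eM, smul_smul] at h2
    simpa using h2
  · filter_upwards [hb.eventually_lt_const (show (-2 : ℝ) < 0 by norm_num)] with n hn
    rw [act_mul, exists_smul_act_uElt_eM (by rw [bil_act, hxn]) hn.ne, map_smul, act_act_inv,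
      klein_smul (div_ne_zero (by norm_num) hn.ne)]

theorem eval_smul_of_isHomogeneous {σ : Type*} [Fintype σ] {F : MvPolynomial σ ℝ} {k : ℕ}
    (hF : F.IsHomogeneous k) (c : ℝ) (s : σ → ℝ) :
    MvPolynomial.eval (c • s) F = c ^ k * MvPolynomial.eval s F := by
  rw [MvPolynomial.eval_eq', MvPolynomial.eval_eq', Finset.mul_sum]
  refine Finset.sum_congr rfl fun e he => ?_
  have hk : ∑ i, e i = k := by
    rw [← hF (MvPolynomial.mem_support_iff.1 he), Finsupp.weight_apply, Finsupp.sum_fintype _ _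
      (by simp)]
    simp
  simp only [Pi.smul_apply, smul_eq_mul, mul_pow]
  rw [Finset.prod_mul_distrib, Finset.prod_pow_eq_pow_sum, hk]
  ring

/-- The limit set of a Zariski dense group is not contained in an algebraic subset. -/
theorem exists_eval_ne_zero_of_isHomogeneous {Γ : Subgroup (G d)} (hΓ : IsZariskiDense Γ) {h : G d}
    (hh : EndsIn Γ h) {F : MvPolynomial (Mid d) ℝ} {k : ℕ} (hk : F.IsHomogeneous k) (hF : F ≠ 0) :
    ∃ s, klein (act (h * uElt s) (eM d)) ∈ limitSet Γ ∧ MvPolynomial.eval s F ≠ 0 := by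
  by_contra hcon
  push Not at hcon
  -- Y is the vector y = h⁻¹ g h e₋ as a polynomial in the entries of g. For g in Γ it represents a
  -- limit point seen from h.
  let Y : Fin (d + 1) → MvPolynomial (Fin (d + 1) × Fin (d + 1)) ℝ := fun i =>
    ∑ j, ∑ l, MvPolynomial.C (toMat h⁻¹ i j * act h (eM d) l) * MvPolynomial.X (j, l)
  have hY : ∀ (g : G d) i, MvPolynomial.eval (fun ij => toMat g ij.1 ij.2) (Y i) =
      act (h⁻¹ * g * h) (eM d) i := by
    intro g i
    rw [mul_assoc, act_mul, act_mul, act_apply h⁻¹, act_apply g]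
    simp only [Y, map_sum, map_mul, MvPolynomial.eval_C, MvPolynomial.eval_X, Matrix.mulVec,
      dotProduct, Finset.mul_sum]
    refine Finset.sum_congr rfl fun j _ => Finset.sum_congr rfl fun l _ => ?_
    ring
  -- The visiting time of y is its middle part divided by ⟨y, e₊⟩. Homogeneity of F removes the
  -- denominator, and the factor ⟨y, e₊⟩ covers the y on the line of e₊, which have no visiting
  -- time. At g = h u_s h⁻¹ the vanishing of P gives F(s) = 0.
  let P := (Y 0 - Y (Fin.last d)) * MvPolynomial.bind₁ (fun i : Mid d => Y i) F
  have hP : ∀ g : G d, MvPolynomial.eval (fun ij => toMat g ij.1 ij.2) P =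
      bil d (act (h⁻¹ * g * h) (eM d)) (eP d) *
        MvPolynomial.eval (restr d (act (h⁻¹ * g * h) (eM d))) F := by
    intro g
    have : MvPolynomial.eval (fun ij => toMat g ij.1 ij.2)
        (MvPolynomial.bind₁ (fun i : Mid d => Y i) F) =
        MvPolynomial.eval (restr d (act (h⁻¹ * g * h) (eM d))) F := by
      rw [MvPolynomial.hom_bind₁]
      have hid : (MvPolynomial.eval fun ij : Fin (d + 1) × Fin (d + 1) =>
          toMat g ij.1 ij.2).comp MvPolynomial.C = RingHom.id ℝ := by ext; simp
      rw [hid]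
      simp only [hY]
      rfl
    rw [map_mul, this, map_sub, hY, hY, bil_eP]
  have hzero := hΓ P (fun γ hγ => by
    rw [hP]
    set y := act (h⁻¹ * γ * h) (eM d) with hy
    by_cases hb : bil d y (eP d) = 0
    · rw [hb, zero_mul]
    · have h1 := exists_smul_act_uElt_eM (y := y) (by rw [hy, bil_act]; simp) hb
      have h2 := hcon ((bil d y (eP d))⁻¹ • restr d y) (by
        rw [act_mul, h1, map_smul, klein_smul (div_ne_zero (by norm_num) hb), hy, ← act_mul]
        have := klein_act_mem_limitSet hγ hh.2
        rwa [← act_mul, show γ * h = h * (h⁻¹ * γ * h) by group] at this)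
      rw [eval_smul_of_isHomogeneous hk] at h2
      rw [(mul_eq_zero.1 h2).resolve_left (pow_ne_zero _ (inv_ne_zero hb)), mul_zero])
  apply hF
  refine MvPolynomial.funext fun s => ?_
  have := hzero (h * uElt s * h⁻¹)
  rw [hP, show h⁻¹ * (h * uElt s * h⁻¹) * h = uElt s by group, bil_act_uElt_eM_eP,
    restr_act_uElt_eM, eval_smul_of_isHomogeneous hk] at this
  simpa using this

/-- Compactness modulo Γ of the frames with endpoints in the limit set; it provides the limit frames
for zooming in or out with the boosts. -/
theorem exists_subseq_of_endsIn {Γ : Subgroup (G d)} (hΓ : IsConvexCocompact Γ) {g : ℕ → G d}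
    (hg : ∀ n, EndsIn Γ (g n)) : ∃ γ : ℕ → G d, (∀ n, γ n ∈ Γ) ∧ ∃ h, EndsIn Γ h ∧
      ∃ φ : ℕ → ℕ, StrictMono φ ∧ Tendsto (fun n => γ (φ n) * g (φ n)) atTop (𝓝 h) := by
  obtain ⟨R, hR⟩ := exists_ht_le_of_endsIn hΓ
  choose γ hγ hγR using fun n => hR (g n) (hg n)
  have hK : IsCompact ({g : G d | ht g ≤ R} ∩ {g : G d | EndsIn Γ g}) :=
    (isCompact_ht_le R).inter_right (isClosed_endsIn Γ)
  obtain ⟨h, hh, φ, hφ, hlim⟩ := hK.tendsto_subseq (x := fun n => γ n * g n)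
    fun n => ⟨hγR n, (hg n).mul_left (hγ n)⟩
  exact ⟨γ, hγ, h, hh.2, φ, hφ, hlim⟩

/-- Visiting times scale under the boosts. -/
theorem klein_mul_aElt_uElt {Γ : Subgroup (G d)} {γ g : G d} (hγ : γ ∈ Γ) (t : ℝ) (s : Mid d → ℝ) :
    klein (act (γ * (g * aElt d t) * uElt s) (eM d)) ∈ limitSet Γ ↔
      klein (act (g * uElt (Real.exp t • s)) (eM d)) ∈ limitSet Γ := by
  have h1 : γ * (g * aElt d t) * uElt s = γ * (g * uElt (Real.exp t • s) * aElt d t) := by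
    rw [mul_assoc g, uElt_mul_aElt, smul_smul, ← Real.exp_add]
    simp [mul_assoc]
  have h2 : klein (act (g * uElt (Real.exp t • s) * aElt d t) (eM d)) =
      klein (act (g * uElt (Real.exp t • s)) (eM d)) := by
    rw [act_mul, act_aElt_eM, map_smul, klein_smul (Real.exp_ne_zero _)]
  rw [h1, act_mul, ← h2]
  refine ⟨fun h => ?_, fun h => klein_act_mem_limitSet hγ h⟩
  have := klein_act_mem_limitSet (Γ.inv_mem hγ) h
  rwa [act_inv_act] at this

/-- The visiting times near `0` are Zariski dense. -/
theorem exists_endsIn_eval_ne_zero {Γ : Subgroup (G d)} (hcc : IsConvexCocompact Γ)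
    (hzd : IsZariskiDense Γ) {g : G d} (hg : EndsIn Γ g) {F : MvPolynomial (Mid d) ℝ} (hF : F ≠ 0)
    {r : ℝ} (hr : 0 < r) :
    ∃ s, ‖s‖ < r ∧ klein (act (g * uElt s) (eM d)) ∈ limitSet Γ ∧ MvPolynomial.eval s F ≠ 0 := by
  by_contra hcon
  push Not at hcon
  have hex : ∃ k, MvPolynomial.homogeneousComponent k F ≠ 0 := by
    by_contra hall
    push Not at hall
    apply hF
    rw [← MvPolynomial.sum_homogeneousComponent F]
    exact Finset.sum_eq_zero fun i _ => hall i
  classical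
  -- The lowest non-zero homogeneous part of F, which dominates F near 0.
  set k := Nat.find hex
  have hk : MvPolynomial.homogeneousComponent k F ≠ 0 := Nat.find_spec hex
  have hlt : ∀ j < k, MvPolynomial.homogeneousComponent j F = 0 := fun j hj => by
    simpa using Nat.find_min hex hj
  have hexp : ∀ (c : ℝ) (s : Mid d → ℝ), c ≠ 0 → MvPolynomial.eval (c • s) F = c ^ k *
      ∑ j ∈ Finset.range (F.totalDegree + 1), c ^ (j - k) *
        MvPolynomial.eval s (MvPolynomial.homogeneousComponent j F) := by
    intro c s hc
    conv_lhs => rw [← MvPolynomial.sum_homogeneousComponent F, map_sum]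
    rw [Finset.mul_sum]
    refine Finset.sum_congr rfl fun j _ => ?_
    rcases lt_or_ge j k with hj | hj
    · simp [hlt j hj]
    · rw [eval_smul_of_isHomogeneous (MvPolynomial.homogeneousComponent_isHomogeneous j F),
        ← mul_assoc, ← pow_add, Nat.add_sub_cancel' hj]
  -- The visiting times of g a_{-n} are those of g multiplied by e^n, so this magnifies a
  -- neighbourhood of 0. Dividing F(c τ) by c^k leaves the lowest part of F in the limit, and it is
  -- non-zero at a visiting time σ of the limit frame.
  obtain ⟨γ, hγ, h, hh, φ, hφ, hlim⟩ := exists_subseq_of_endsIn hcc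
    (g := fun n : ℕ => g * aElt d (-n)) fun n => hg.mul_aElt _
  obtain ⟨σ, hσ, hσF⟩ := exists_eval_ne_zero_of_isHomogeneous hzd hh
    (MvPolynomial.homogeneousComponent_isHomogeneous k F) hk
  obtain ⟨τ, hτ, hτk⟩ := exists_tendsto_uElt hlim σ
  set c : ℕ → ℝ := fun n => Real.exp (-(φ n : ℝ))
  have hc : Tendsto c atTop (𝓝 0) := Real.tendsto_exp_neg_atTop_nhds_zero.comp
    (tendsto_natCast_atTop_atTop.comp hφ.tendsto_atTop)
  have hz : ∀ᶠ n in atTop, ∑ j ∈ Finset.range (F.totalDegree + 1), c n ^ (j - k) *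
      MvPolynomial.eval (τ n) (MvPolynomial.homogeneousComponent j F) = 0 := by
    have hsmall : Tendsto (fun n => ‖c n • τ n‖) atTop (𝓝 0) := by
      simpa using (hc.smul hτ).norm
    filter_upwards [hτk, hsmall.eventually_lt_const hr] with n hn hn'
    rw [← hn] at hσ
    have h1 := hcon _ hn' ((klein_mul_aElt_uElt (hγ _) _ _).1 hσ)
    have hcn : c n ≠ 0 := Real.exp_ne_zero _
    rw [hexp _ _ hcn] at h1
    exact (mul_eq_zero.1 h1).resolve_left (pow_ne_zero _ hcn)
  have hcont : Tendsto (fun n => ∑ j ∈ Finset.range (F.totalDegree + 1), c n ^ (j - k) *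
      MvPolynomial.eval (τ n) (MvPolynomial.homogeneousComponent j F)) atTop
      (𝓝 (∑ j ∈ Finset.range (F.totalDegree + 1), 0 ^ (j - k) *
        MvPolynomial.eval σ (MvPolynomial.homogeneousComponent j F))) :=
    tendsto_finsetSum _ fun j _ => (hc.pow _).mul
      (((MvPolynomial.continuous_eval _).tendsto σ).comp hτ)
  have hlim0 := tendsto_nhds_unique (hcont.congr' hz) tendsto_const_nhds
  apply hσF
  rw [← hlim0]
  have hkmem : k ∈ Finset.range (F.totalDegree + 1) := by
    rw [Finset.mem_range]
    by_contra hnot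
    exact hk (MvPolynomial.homogeneousComponent_eq_zero _ _ (by omega))
  rw [Finset.sum_eq_single k]
  · simp
  · intro j _ hj
    rcases lt_or_gt_of_ne hj with hj | hj
    · simp [hlt j hj]
    · rw [zero_pow (by omega), zero_mul]
  · intro hnot; exact absurd hkmem hnot

/-- The set of visiting times is unbounded. -/
theorem exists_endsIn_norm_ge {Γ : Subgroup (G d)} (hcc : IsConvexCocompact Γ)
    (hzd : IsZariskiDense Γ) {g : G d} (hg : EndsIn Γ g) (R : ℝ) :
    ∃ s, R ≤ ‖s‖ ∧ EndsIn Γ (g * uElt s) := by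
  obtain ⟨γ, hγ, h, hh, φ, hφ, hlim⟩ := exists_subseq_of_endsIn hcc
    (g := fun n : ℕ => g * aElt d n) fun n => hg.mul_aElt _
  obtain ⟨i⟩ := (inferInstance : Nonempty (Mid d))
  -- Any coordinate polynomial serves here: it only has to force σ ≠ 0, so that the times e^n τ n of
  -- g go to infinity.
  obtain ⟨σ, -, hσ, hσ0⟩ := exists_endsIn_eval_ne_zero hcc hzd hh
    (MvPolynomial.X_ne_zero (R := ℝ) i) one_pos
  rw [MvPolynomial.eval_X] at hσ0
  have hpos : 0 < ‖σ‖ := norm_pos_iff.2 fun h0 => hσ0 (by simp [h0])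
  obtain ⟨τ, hτ, hτk⟩ := exists_tendsto_uElt hlim σ
  have hc : Tendsto (fun n => Real.exp (φ n : ℝ)) atTop atTop := Real.tendsto_exp_atTop.comp
    (tendsto_natCast_atTop_atTop.comp hφ.tendsto_atTop)
  have hbig : Tendsto (fun n => ‖Real.exp (φ n : ℝ) • τ n‖) atTop atTop := by
    simp only [norm_smul, Real.norm_eq_abs, Real.abs_exp]
    exact hc.atTop_mul_pos hpos hτ.norm
  obtain ⟨n, hn, hn'⟩ := (hτk.and (hbig.eventually_ge_atTop R)).exists
  rw [← hn] at hσ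
  exact ⟨_, hn', endsIn_mul_uElt hg ((klein_mul_aElt_uElt (hγ _) _ _).1 hσ)⟩

/-! ## Cocompact torsion-free groups contain no parabolic elements -/

/-- A discrete group meets a compact set in a finite set, so two powers of γ coincide and
torsion-freeness applies. -/
theorem eq_one_of_mem_compact {Γ : Subgroup (G d)} [DiscreteTopology Γ]
    (htf : IsTorsionFreeSubgroup Γ) {K : Set (G d)} (hK : IsCompact K) {γ : G d} (hγ : γ ∈ Γ)
    (h : ∀ n : ℕ, γ ^ n ∈ K) : γ = 1 := by
  have hcl : IsClosed (Γ : Set (G d)) := Subgroup.isClosed_of_discrete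
  have hfin : ((Γ : Set (G d)) ∩ K).Finite := by
    have hc : IsCompact ((Γ : Set (G d)) ∩ K) := hK.inter_left hcl
    refine hc.finite ?_
    exact ⟨DiscreteTopology.of_subset (s := (Γ : Set (G d))) ‹_› Set.inter_subset_left⟩
  obtain ⟨m, n, hmn, heq⟩ := Set.Finite.exists_lt_map_eq_of_forall_mem
    (f := fun n : ℕ => γ ^ n) 
    (fun n => (⟨Γ.pow_mem hγ n, h n⟩ : γ ^ n ∈ (Γ : Set (G d)) ∩ K)) hfin
  refine htf γ hγ (n - m) (by omega) ?_
  have := pow_sub γ hmn.le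
  rw [this, ← heq, mul_inv_cancel]

theorem eventually_eq_of_tendsto_discrete {Γ : Subgroup (G d)} [DiscreteTopology Γ] {γ : ℕ → G d}
    (hγ : ∀ n, γ n ∈ Γ) {g : G d} (h : Tendsto γ atTop (𝓝 g)) :
    g ∈ Γ ∧ ∀ᶠ n in atTop, γ n = g := by
  have hcl : IsClosed (Γ : Set (G d)) := Subgroup.isClosed_of_discrete
  have hg : g ∈ Γ := hcl.mem_of_tendsto h (Eventually.of_forall hγ)
  refine ⟨hg, ?_⟩
  have h' : Tendsto (fun n => (⟨γ n, hγ n⟩ : Γ)) atTop (𝓝 ⟨g, hg⟩) :=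
    tendsto_subtype_rng.2 h
  rw [nhds_discrete, tendsto_pure] at h'
  filter_upwards [h'] with n hn
  exact congrArg Subtype.val hn

/-- Write the conjugate as u_s m. Conjugation by the boosts contracts u_s and leaves m;
cocompactness brings the moving frames back by Γ, so conjugates of γ in Γ converge to a conjugate of
m. By discreteness they eventually equal it. Its powers stay in a compact set, so it is 1, and so is
γ. -/
theorem eq_one_of_conj_fixes_eP {Γ : Subgroup (G d)} [DiscreteTopology Γ]
    (htf : IsTorsionFreeSubgroup Γ) (hc : CompactSpace (LeftQuot Γ)) {γ k : G d} (hγ : γ ∈ Γ)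
    (h : act (k⁻¹ * γ * k) (eP d) = eP d) : γ = 1 := by
  obtain ⟨R, hR⟩ := exists_ht_le_of_isCompact (Γ := Γ) isCompact_univ
  obtain ⟨s, m, hm, hg⟩ := exists_uElt_mul_of_act_eP h
  choose η hη hηR using fun n : ℕ => hR (k * aElt d n) (Set.mem_univ _)
  obtain ⟨κ, -, φ, hφ, hlim⟩ := (isCompact_ht_le R).tendsto_subseq
    (x := fun n => η n * (k * aElt d n)) hηR
  have h1 : ∀ t : ℝ, aElt d (-t) * (k⁻¹ * γ * k) * aElt d t =
      (aElt d (-t) * uElt s * aElt d t) * m := by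
    intro t
    rw [hg, mul_assoc, mul_assoc, (isAM_of_mem_grpM hm).mul_aElt]
    simp only [mul_assoc]
  have h2 : Tendsto (fun n => aElt d (-(φ n : ℝ)) * (k⁻¹ * γ * k) * aElt d (φ n : ℝ)) atTop
      (𝓝 m) := by
    simp only [h1]
    have := ((tendsto_conj_uElt s).comp
      (tendsto_natCast_atTop_atTop.comp hφ.tendsto_atTop)).mul_const m
    simpa using this
  have h3 := (hlim.mul h2).mul hlim.inv
  have h4 : Tendsto (fun n => η (φ n) * γ * (η (φ n))⁻¹) atTop (𝓝 (κ * m * κ⁻¹)) := by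
    refine h3.congr fun n => ?_
    simp only [Function.comp_apply, aElt_neg]
    group
  obtain ⟨hmem, hev⟩ := eventually_eq_of_tendsto_discrete
    (fun n => Γ.mul_mem (Γ.mul_mem (hη (φ n)) hγ) (Γ.inv_mem (hη (φ n)))) h4
  obtain ⟨n, hn⟩ := hev.exists
  have hK : IsCompact ((fun x => κ * x * κ⁻¹) '' grpM d) :=
    isCompact_grpM.image (by fun_prop)
  have hone : κ * m * κ⁻¹ = 1 := by
    refine eq_one_of_mem_compact htf hK hmem fun j => ?_
    refine ⟨m ^ j, ?_, by rw [conj_pow]⟩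
    rw [mem_grpM_iff] at hm ⊢
    induction j with
    | zero => simp
    | succ j ih => rw [pow_succ, act_mul, act_mul, hm.1, hm.2]; exact ih
  rw [hone] at hn
  simpa using hn

end OrbitClosure

end

noncomputable section

set_option linter.unusedSectionVars false

namespace OrbitClosure

/-! ## Renormalization of sequences of polynomials -/

section Renormalization

variable {ι κ : Type*} [Fintype ι] [Fintype κ]

theorem eval_eq_sum_of_support_subset {P : MvPolynomial ι ℝ} {I : Finset (ι →₀ ℕ)}
    (h : P.support ⊆ I) (c : ℝ) (s : ι → ℝ) :
    MvPolynomial.eval (c • s) P = ∑ α ∈ I, (P.coeff α * c ^ (∑ i, α i)) * ∏ i, s i ^ α i := by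
  rw [MvPolynomial.eval_eq']
  have : ∀ α ∈ I, α ∉ P.support → P.coeff α * ∏ i, (c • s) i ^ α i = 0 := fun α _ hα => by
    rw [MvPolynomial.notMem_support_iff.1 hα, zero_mul]
  rw [Finset.sum_subset h this]
  refine Finset.sum_congr rfl fun α _ => ?_
  simp only [Pi.smul_apply, smul_eq_mul, mul_pow, Finset.prod_mul_distrib,
    Finset.prod_pow_eq_pow_sum]
  ring

/-- Polynomial maps whose coefficients tend to zero have a non-zero limit of prescribed size after
rescaling the variables, if none of them is constant. -/
theorem exists_renormalization (P : ℕ → κ → MvPolynomial ι ℝ) (I : Finset (ι →₀ ℕ))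
    (hI : ∀ n k, (P n k).support ⊆ I)
    (h0 : ∀ k α, Tendsto (fun n => (P n k).coeff α) atTop (𝓝 0))
    (hnc : ∀ n, ∃ k, ∃ α, α ≠ 0 ∧ (P n k).coeff α ≠ 0) {ε : ℝ} (hε : 0 < ε) :
    ∃ φ : ℕ → ℕ, StrictMono φ ∧ ∃ c : ℕ → ℝ, (∀ n, 0 < c n) ∧ Tendsto c atTop atTop ∧
      ∃ Q : κ → MvPolynomial ι ℝ, (∃ k, Q k ≠ 0) ∧
        (∀ (τ : ℕ → ι → ℝ) (σ : ι → ℝ), Tendsto τ atTop (𝓝 σ) → ∀ k,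
          Tendsto (fun n => MvPolynomial.eval (c n • τ n) (P (φ n) k)) atTop
            (𝓝 (MvPolynomial.eval σ (Q k)))) ∧
        ∀ σ : ι → ℝ, ‖σ‖ ≤ 1 → ∀ k, |MvPolynomial.eval σ (Q k)| ≤ ε := by
  classical
  -- S n c is the sum of the absolute values of the coefficients of P n after the variables are
  -- scaled by c.
  let S : ℕ → ℝ → ℝ := fun n c => ∑ k, ∑ α ∈ I, |(P n k).coeff α| * c ^ (∑ i, α i)
  have hScont : ∀ n, Continuous (S n) := fun n => by
    simp only [S]; fun_prop
  have hSmono : ∀ n a b, 0 ≤ a → a ≤ b → S n a ≤ S n b := fun n a b ha hab =>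
    Finset.sum_le_sum fun k _ => Finset.sum_le_sum fun α _ => by gcongr
  have hSlim : ∀ c, Tendsto (fun n => S n c) atTop (𝓝 0) := fun c => by
    have : (0 : ℝ) = ∑ k : κ, ∑ α ∈ I, |(0 : ℝ)| * c ^ (∑ i, α i) := by simp
    rw [this]
    exact tendsto_finsetSum _ fun k _ => tendsto_finsetSum _ fun α _ => ((h0 k α).abs).mul_const _
  have hSinf : ∀ n, ∃ c, 1 ≤ c ∧ ε ≤ S n c := fun n => by
    obtain ⟨k, α, hα, hc⟩ := hnc n
    have hdeg : 1 ≤ ∑ i, α i := by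
      rw [Nat.one_le_iff_ne_zero]
      intro hz
      apply hα
      ext i
      exact (Finset.sum_eq_zero_iff.1 hz) i (Finset.mem_univ i)
    have hpos := abs_pos.2 hc
    have hmax : 0 ≤ max 1 (ε / |(P n k).coeff α|) := le_trans zero_le_one (le_max_left _ _)
    refine ⟨max 1 (ε / |(P n k).coeff α|), le_max_left _ _, ?_⟩
    generalize hc₀ : max 1 (ε / |(P n k).coeff α|) = c₀ at hmax
    have h1 : |(P n k).coeff α| * c₀ ^ (∑ i, α i) ≤ S n c₀ :=
      (Finset.single_le_sum (f := fun β => |(P n k).coeff β| * c₀ ^ (∑ i, β i))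
        (fun β _ => by positivity) (hI n k (MvPolynomial.mem_support_iff.2 hc))).trans
      (Finset.single_le_sum (f := fun k => ∑ β ∈ I, |(P n k).coeff β| * c₀ ^ (∑ i, β i))
        (fun k _ => Finset.sum_nonneg fun β _ => by positivity) (Finset.mem_univ k))
    refine le_trans ?_ h1
    rw [← hc₀]
    calc ε = |(P n k).coeff α| * (ε / |(P n k).coeff α|) := by field_simp
      _ ≤ |(P n k).coeff α| * max 1 (ε / |(P n k).coeff α|) := by gcongr; exact le_max_right _ _
      _ ≤ _ := by
        gcongr
        exact le_self_pow₀ (le_max_left _ _) (by omega)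
  -- Past N the size at scale 1 is below ε, while non-constancy makes it exceed ε at large scales.
  -- The intermediate value theorem then gives a scale of size exactly ε, so the limit coefficients
  -- have total size ε: Q is non-zero, and at most ε on the unit ball.
  obtain ⟨N, hN⟩ := eventually_atTop.1 ((hSlim 1).eventually_lt_const hε)
  have hex : ∀ n, ∃ c, 1 ≤ c ∧ S (n + N) c = ε := fun n => by
    obtain ⟨b, hb, hb'⟩ := hSinf (n + N)
    obtain ⟨c, hc, hc'⟩ := intermediate_value_Icc hb (hScont (n + N)).continuousOn
      ⟨(hN (n + N) (by omega)).le, hb'⟩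
    exact ⟨c, hc.1, hc'⟩
  choose c hc1 hcS using hex
  have hctop : Tendsto c atTop atTop := by
    rw [tendsto_atTop]
    intro R
    have h1 := ((hSlim (max R 0)).comp (tendsto_add_atTop_nat N)).eventually_lt_const hε
    filter_upwards [h1] with n hn
    by_contra hlt
    push Not at hlt
    have := hSmono (n + N) (c n) (max R 0) (by linarith [hc1 n])
      (hlt.le.trans (le_max_left _ _))
    rw [hcS] at this
    exact absurd hn (not_lt.2 this)
  let v : ℕ → κ → I → ℝ := fun n k α => (P (n + N) k).coeff α * c n ^ (∑ i, α.1 i)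
  have hvsum : ∀ n, ∑ k, ∑ α : I, |v n k α| = ε := fun n => by
    rw [← hcS n]
    refine Finset.sum_congr rfl fun k _ => ?_
    rw [← Finset.sum_coe_sort I]
    refine Finset.sum_congr rfl fun α _ => ?_
    rw [abs_mul, abs_of_nonneg (pow_nonneg (zero_le_one.trans (hc1 n)) (∑ i, α.1 i))]
  have hv : ∀ n, v n ∈ Set.univ.pi fun _ : κ => Set.univ.pi fun _ : I => Set.Icc (-ε) ε := by
    intro n k _ α _
    rw [Set.mem_Icc, ← abs_le, ← hvsum n]
    refine le_trans ?_ (Finset.single_le_sum (f := fun k => ∑ α : I, |v n k α|)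
      (fun k _ => Finset.sum_nonneg fun α _ => abs_nonneg _) (Finset.mem_univ k))
    exact Finset.single_le_sum (f := fun α : I => |v n k α|) (fun α _ => abs_nonneg _)
      (Finset.mem_univ α)
  obtain ⟨w, -, ψ, hψ, hlim⟩ := (isCompact_univ_pi fun _ : κ => isCompact_univ_pi fun _ : I =>
    isCompact_Icc).tendsto_subseq hv
  have hlim' : ∀ k α, Tendsto (fun n => v (ψ n) k α) atTop (𝓝 (w k α)) := fun k α =>
    tendsto_pi_nhds.1 (tendsto_pi_nhds.1 hlim k) α
  have hwsum : ∑ k, ∑ α : I, |w k α| = ε := by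
    have h1 : Tendsto (fun n => ∑ k, ∑ α : I, |v (ψ n) k α|) atTop (𝓝 (∑ k, ∑ α : I, |w k α|)) :=
      tendsto_finsetSum _ fun k _ => tendsto_finsetSum _ fun α _ => (hlim' k α).abs
    simp only [hvsum] at h1
    exact tendsto_nhds_unique h1 tendsto_const_nhds |>.symm ▸ rfl
  let Q : κ → MvPolynomial ι ℝ := fun k => ∑ α : I, MvPolynomial.monomial α.1 (w k α)
  have hQ : ∀ σ k, MvPolynomial.eval σ (Q k) = ∑ α : I, w k α * ∏ i, σ i ^ α.1 i := fun σ k => by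
    simp [Q, map_sum, MvPolynomial.eval_monomial, Finsupp.prod_fintype]
  refine ⟨fun n => ψ n + N, fun a b hab => by simpa using hψ hab, fun n => c (ψ n),
    fun n => by linarith [hc1 (ψ n)], hctop.comp hψ.tendsto_atTop, Q, ?_, ?_, ?_⟩
  · by_contra hall
    push Not at hall
    have hw0 : ∀ k α, w k α = 0 := fun k α => by
      have := congrArg (MvPolynomial.coeff α.1) (hall k)
      simpa [Q, MvPolynomial.coeff_sum, MvPolynomial.coeff_monomial, Subtype.ext_iff.symm]
        using this
    simp [hw0] at hwsum
    exact hε.ne hwsum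
  · intro τ σ hτ k
    simp only [eval_eq_sum_of_support_subset (hI _ k), hQ]
    simp only [← Finset.sum_coe_sort I]
    refine tendsto_finsetSum _ fun α _ => (hlim' k α).mul ?_
    exact tendsto_finsetProd _ fun i _ => (tendsto_pi_nhds.1 hτ i).pow _
  · intro σ hσ k
    rw [hQ, ← hwsum]
    refine (Finset.abs_sum_le_sum_abs _ _).trans (le_trans ?_ (Finset.single_le_sum
      (f := fun k => ∑ α : I, |w k α|) (fun k _ => Finset.sum_nonneg fun α _ => abs_nonneg _)
      (Finset.mem_univ k)))
    refine Finset.sum_le_sum fun α _ => ?_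
    rw [abs_mul, Finset.abs_prod]
    refine mul_le_of_le_one_right (abs_nonneg _) (Finset.prod_le_one (fun i _ => abs_nonneg _)
      fun i _ => ?_)
    rw [abs_pow]
    exact pow_le_one₀ (abs_nonneg _) ((norm_le_pi_norm σ i).trans hσ)

end Renormalization

variable {d : ℕ} [hd : Fact (2 ≤ d)]

/-! ## The defect of an element of `G × G` -/

/-- The index set of the coordinates of the defect. -/
abbrev DefectIdx (d : ℕ) : Type := Fin (d + 1) × Option (Fin (d + 1))

/-- The defect of `(w₁, w₂)`: the coordinates of `w₁ w₂⁻¹ - 1` and of `w₁ e₊ - e₊`. It is invariant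
under right translation by the diagonal of `𝒰`. -/
def defect (w : G d × G d) : DefectIdx d → ℝ
  | (i, none) => act w.1 (eP d) i - eP d i
  | (i, some j) => toMat (w.1 * w.2⁻¹) i j - (1 : Matrix _ _ ℝ) i j

theorem continuous_defect : Continuous (defect : G d × G d → _) := by
  refine continuous_pi fun ⟨i, o⟩ => ?_
  cases o with
  | none =>
    exact ((continuous_apply i).comp ((continuous_act (eP d)).comp continuous_fst)).sub
      continuous_const
  | some j =>
    have h1 : Continuous fun w : G d × G d => toMat (w.1 * w.2⁻¹) :=
      continuous_toMat.comp (continuous_fst.mul continuous_snd.inv)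
    exact (h1.matrix_elem i j).sub continuous_const

/-- Equivalently, w and w' differ on the right by (h, h) with h fixing e₊. -/
theorem defect_eq_iff (w w' : G d × G d) : defect w = defect w' ↔
    act w.1 (eP d) = act w'.1 (eP d) ∧ w.1 * w.2⁻¹ = w'.1 * w'.2⁻¹ := by
  constructor
  · intro h
    constructor
    · ext i
      have := congrFun h (i, none)
      simpa [defect] using this
    · apply toMat_injective
      ext i j
      have := congrFun h (i, some j)
      simpa [defect] using this
  · rintro ⟨h1, h2⟩
    ext ⟨i, o⟩
    cases o with
    | none => simp [defect, h1]
    | some j => simp [defect, h2]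

@[simp] theorem defect_one : defect (1 : G d × G d) = 0 := by
  ext ⟨i, o⟩
  cases o <;> simp [defect, toMat_one]

theorem defect_eq_zero_iff (w : G d × G d) :
    defect w = 0 ↔ act w.1 (eP d) = eP d ∧ w.1 = w.2 := by
  rw [← defect_one, defect_eq_iff]
  simp [mul_inv_eq_one]

/-- The diagonal element `(u_s, u_s)`. -/
def uDiag (s : Mid d → ℝ) : G d × G d := (uElt s, uElt s)

theorem uDiag_add (s t : Mid d → ℝ) : uDiag (s + t) = uDiag s * uDiag t :=
  Prod.ext (uElt_add s t) (uElt_add s t)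

theorem uDiag_neg (s : Mid d → ℝ) : uDiag (-s) = (uDiag s)⁻¹ :=
  Prod.ext (uElt_neg s) (uElt_neg s)

@[simp] theorem uDiag_zero : uDiag (0 : Mid d → ℝ) = 1 := Prod.ext uElt_zero uElt_zero

theorem defect_mul_uDiag (w : G d × G d) (s : Mid d → ℝ) : defect (w * uDiag s) = defect w := by
  rw [defect_eq_iff]
  simp [uDiag, act_mul]

/-- If the defect is invariant under left translation by the diagonal of `𝒰`, then the element
normalizes the diagonal of `𝒰`. -/
theorem normalizes_of_defect_invariant {w : G d × G d}
    (h : ∀ s, defect (uDiag s * w) = defect w) :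
    w.1 * w.2⁻¹ ∈ Set.range (uElt : (Mid d → ℝ) → G d) ∧ ∃ s, IsAM (w.1 * uElt s) := by
  simp only [defect_eq_iff] at h
  constructor
  -- Invariance says that w₁ w₂⁻¹ is fixed under conjugation by 𝒰, hence lies in the centralizer of
  -- 𝒰, which is 𝒰.
  · obtain ⟨s, hs⟩ := eq_uElt_of_commute (q := w.1 * w.2⁻¹) fun s => by
      have := (h s).2
      simp only [uDiag, Prod.fst_mul, Prod.snd_mul, mul_inv_rev] at this
      conv_lhs => rw [← this]
      group
    exact ⟨s, hs.symm⟩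
  · have hP : act w.1 (eP d) = (-(bil d (act w.1 (eP d)) (eM d)) / 2) • eP d := by
      apply eq_smul_eP_of_fixed
      intro s
      have := (h s).1
      rwa [uDiag, Prod.fst_mul, act_mul] at this
    set c := -(bil d (act w.1 (eP d)) (eM d)) / 2
    have hc : 0 < c := by
      have := act_eP_last_pos w.1
      rw [hP] at this
      simpa using this
    set y := act w.1⁻¹ (eM d)
    have hb : bil d y (eP d) ≠ 0 := by
      rw [bil_act_left, inv_inv, hP]
      simp [hc.ne']
    refine ⟨(bil d y (eP d))⁻¹ • restr d y, isAM_of_smul (c := c) (c' := -2 / bil d y (eP d)) ?_ ?_⟩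
    · rw [act_mul, act_uElt_eP, hP]
    · rw [act_mul, exists_smul_act_uElt_eM (by simp [y, bil_act]) hb, map_smul, act_act_inv]

/-- Right translation by `𝒰` brings an element which almost fixes `e₊` into a compact set. -/
theorem exists_ht_mul_uElt_le {g : G d} (h : ∀ i, |act g (eP d) i - eP d i| ≤ 1 / 2) :
    ∃ s, ht (g * uElt s) ≤ 2 := by
  have h0 := abs_le.1 (h 0)
  have hl := abs_le.1 (h (Fin.last d))
  rw [eP_zero] at h0
  rw [eP_last] at hl
  set y := act g⁻¹ (eM d) with hy
  have hb : bil d y (eP d) = -act g (eP d) 0 - act g (eP d) (Fin.last d) := by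
    rw [hy, bil_act_left, inv_inv, bil_comm, bil_eM]
  have hb1 : bil d y (eP d) ≤ -1 := by rw [hb]; linarith
  refine ⟨(bil d y (eP d))⁻¹ • restr d y, ?_⟩
  rw [ht, basePt_eq, map_smul, map_add, act_mul, act_mul, act_uElt_eP,
    exists_smul_act_uElt_eM (by simp [hy, bil_act]) (by linarith), map_smul, hy, act_act_inv,
    ← hy]
  simp only [Pi.smul_apply, Pi.add_apply, smul_eq_mul, eM_last]
  have : -2 / bil d y (eP d) ≤ 2 := by
    rw [div_le_iff_of_neg (by linarith)]
    linarith
  linarith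

/-! ## Polynomial dependence on the horospherical parameter -/

theorem exists_mvPolynomial_emb (i : Fin (d + 1)) :
    ∃ p : MvPolynomial (Mid d) ℝ, ∀ s, MvPolynomial.eval s p = emb d s i := by
  by_cases h : i ≠ 0 ∧ i ≠ Fin.last d
  · exact ⟨MvPolynomial.X ⟨i, h⟩, fun s => by simp [emb, h]⟩
  · exact ⟨0, fun s => by simp [emb, h]⟩

theorem exists_mvPolynomial_uElt (i j : Fin (d + 1)) :
    ∃ p : MvPolynomial (Mid d) ℝ, ∀ s, MvPolynomial.eval s p = toMat (uElt s) i j := by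
  choose E hE using exists_mvPolynomial_emb (d := d)
  let x : Fin (d + 1) → ℝ := Pi.single j 1
  let L : MvPolynomial (Mid d) ℝ := ∑ l : Mid d, MvPolynomial.C (x l) * MvPolynomial.X l
  let N : MvPolynomial (Mid d) ℝ := ∑ l : Mid d, MvPolynomial.X l * MvPolynomial.X l
  refine ⟨MvPolynomial.C (x i) + MvPolynomial.C (bil d x (eP d)) * E i
    - L * MvPolynomial.C (eP d i)
    - MvPolynomial.C (2⁻¹ * bil d x (eP d) * eP d i) * N, fun s => ?_⟩
  rw [toMat_apply, act_uElt, bil_emb, bil_emb_emb]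
  simp only [L, N, map_add, map_sub, map_mul, map_sum, MvPolynomial.eval_C, MvPolynomial.eval_X,
    hE, Pi.add_apply, Pi.sub_apply, Pi.smul_apply, smul_eq_mul]
  ring

/-- Left translation by u_{-s} fixes e₊, and it acts on w₁ w₂⁻¹ by conjugation, which fixes 1. Hence
it acts linearly on defects, by a matrix polynomial in s and independent of q: for q → 1 all
coefficients tend to 0, with monomials in a fixed finite set. -/
theorem exists_mvPolynomial_defect : ∃ f : DefectIdx d → DefectIdx d → MvPolynomial (Mid d) ℝ,
    ∀ (q : G d × G d) s k, defect (uDiag (-s) * q) k =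
      ∑ l, defect q l * MvPolynomial.eval s (f k l) := by
  choose B hB using exists_mvPolynomial_uElt (d := d)
  have hA' : ∀ i j : Fin (d + 1), ∃ p : MvPolynomial (Mid d) ℝ, ∀ s,
      MvPolynomial.eval s p = toMat (uElt (-s)) i j := fun i j => by
    refine ⟨MvPolynomial.bind₁ (fun l => -MvPolynomial.X l) (B i j), fun s => ?_⟩
    rw [← hB, MvPolynomial.hom_bind₁]
    have hid : (MvPolynomial.eval s).comp MvPolynomial.C = RingHom.id ℝ := by ext; simp
    rw [hid]
    simp only [map_neg, MvPolynomial.eval_X]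
    rfl
  choose A hA using hA'
  refine ⟨fun k l => match k, l with
    | (i, none), (a, none) => A i a
    | (i, some j), (a, some b) => A i a * B b j
    | _, _ => 0, fun q s k => ?_⟩
  obtain ⟨i, o⟩ := k
  rw [Fintype.sum_prod_type]
  cases o with
  | none =>
    simp only [Fintype.sum_option, map_zero, mul_zero, Finset.sum_const_zero, add_zero, hA]
    have h1 : act (uElt (-s)) (act q.1 (eP d) - eP d) i =
        defect (uDiag (-s) * q) (i, none) := by
      rw [map_sub, act_uElt_eP, defect, uDiag, Prod.fst_mul, act_mul]
      rfl
    rw [← h1, act_apply, Matrix.mulVec, dotProduct]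
    exact Finset.sum_congr rfl fun a _ => mul_comm _ _
  | some j =>
    simp only [Fintype.sum_option, map_zero, mul_zero, zero_add, map_mul, hA, hB]
    have h1 : (toMat (uElt (-s)) * (toMat (q.1 * q.2⁻¹) - 1) * toMat (uElt s)) i j =
        defect (uDiag (-s) * q) (i, some j) := by
      rw [mul_sub, sub_mul, ← toMat_mul, ← toMat_mul, mul_one, ← toMat_mul, uElt_neg,
        inv_mul_cancel, toMat_one, Matrix.sub_apply, defect, uDiag, uElt_neg]
      congr 2
      simp [mul_assoc]
    rw [← h1, Matrix.mul_apply]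
    simp only [Matrix.mul_apply, Finset.sum_mul]
    rw [Finset.sum_comm]
    refine Finset.sum_congr rfl fun a _ => Finset.sum_congr rfl fun b _ => ?_
    simp only [defect, Matrix.sub_apply]
    ring

end OrbitClosure

end

noncomputable section

set_option linter.unusedSectionVars false

namespace OrbitClosure

variable {d : ℕ} [hd : Fact (2 ≤ d)]

/-! ## Unipotent blow-up -/

/-- A closed subset of `G × G` which is invariant under `Γ₁ × Γ₂` on the left and under the
diagonal of `𝒰` on the right. -/
structure IsLiftInvariant (Γ₁ Γ₂ : Subgroup (G d)) (Y : Set (G d × G d)) : Prop where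
  isClosed : IsClosed Y
  left : ∀ g ∈ Y, ∀ γ₁ ∈ Γ₁, ∀ γ₂ ∈ Γ₂, (γ₁, γ₂) * g ∈ Y
  right : ∀ g ∈ Y, ∀ s, g * uDiag s ∈ Y

theorem tendsto_of_defect {w : ℕ → G d × G d} {D : DefectIdx d → ℝ}
    (h : Tendsto (fun n => defect (w n)) atTop (𝓝 D)) {w₀ : G d × G d}
    (hw : Tendsto w atTop (𝓝 w₀)) : defect w₀ = D :=
  tendsto_nhds_unique ((continuous_defect.tendsto w₀).comp hw) h

theorem ht_mul_inv_le {w : G d × G d} {ε : ℝ} (h : ‖defect w‖ ≤ ε) (hε : ε ≤ 1) :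
    ht (w.1 * w.2⁻¹) ≤ 2 := by
  have h1 : |defect w (Fin.last d, some (Fin.last d))| ≤ 1 :=
    (norm_le_pi_norm (defect w) _).trans (h.trans hε)
  have h2 := (abs_le.1 h1).2
  simp only [defect, toMat_apply, Matrix.one_apply_eq] at h2
  rw [ht, basePt]
  linarith

/-- The two nearby points k n and k n q n are pushed along U to visiting times of k n at which their
divergence has a prescribed small size. The U-invariance of the limiting defect is the reason w
normalizes U. -/
theorem exists_normalizing_limit {Γ₁ Γ₂ : Subgroup (G d)} (hcc : IsConvexCocompact Γ₁)
    (hzd : IsZariskiDense Γ₁) (hc₂ : CompactSpace (LeftQuot Γ₂)) {Y : Set (G d × G d)}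
    (hY : IsLiftInvariant Γ₁ Γ₂ Y) {k q : ℕ → G d × G d} (hkE : ∀ n, EndsIn Γ₁ (k n).1)
    (hkY : ∀ n, k n ∈ Y) (hkq : ∀ n, k n * q n ∈ Y) (hq : Tendsto q atTop (𝓝 1))
    (hnc : ∀ n, ∃ s, defect (uDiag s * q n) ≠ defect (q n)) {ε : ℝ} (hε : 0 < ε) (hε' : ε ≤ 1 / 4) :
    ∃ g ∈ Y, EndsIn Γ₁ g.1 ∧ ∃ w, (∀ s, defect (uDiag s * w) = defect w) ∧ g * w ∈ Y ∧
      defect w ≠ 0 ∧ ‖defect w‖ ≤ ε := by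
  classical
  obtain ⟨f, hf⟩ := exists_mvPolynomial_defect (d := d)
  let P : ℕ → DefectIdx d → MvPolynomial (Mid d) ℝ := fun n i => ∑ l, defect (q n) l • f i l
  have hPeval : ∀ n s i, MvPolynomial.eval s (P n i) = defect (uDiag (-s) * q n) i := by
    intro n s i
    rw [hf, map_sum]
    simp [MvPolynomial.smul_eval]
  have hPsupp : ∀ n i, (P n i).support ⊆
      Finset.univ.biUnion fun j : DefectIdx d × DefectIdx d => (f j.1 j.2).support := by
    intro n i
    refine MvPolynomial.support_sum.trans (Finset.biUnion_subset.2 fun l _ => ?_)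
    exact MvPolynomial.support_smul.trans
      (Finset.subset_biUnion_of_mem (fun j : DefectIdx d × DefectIdx d => (f j.1 j.2).support)
        (Finset.mem_univ (i, l)))
  have hdq : Tendsto (fun n => defect (q n)) atTop (𝓝 0) := by
    rw [← defect_one]
    exact (continuous_defect.tendsto 1).comp hq
  have hPcoeff : ∀ i α, Tendsto (fun n => (P n i).coeff α) atTop (𝓝 0) := by
    intro i α
    simp only [P, MvPolynomial.coeff_sum, MvPolynomial.coeff_smul, smul_eq_mul]
    have : (0 : ℝ) = ∑ l : DefectIdx d, 0 * (f i l).coeff α := by simp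
    rw [this]
    exact tendsto_finsetSum _ fun l _ => ((tendsto_pi_nhds.1 hdq) l).mul_const _
  have hPnc : ∀ n, ∃ i, ∃ α, α ≠ 0 ∧ (P n i).coeff α ≠ 0 := by
    intro n
    by_contra hall
    push Not at hall
    obtain ⟨s, hs⟩ := hnc n
    apply hs
    ext i
    have hconst : P n i = MvPolynomial.C ((P n i).coeff 0) := by
      ext α
      rw [MvPolynomial.coeff_C]
      split_ifs with h
      · rw [h]
      · exact hall i α (Ne.symm h)
    have h1 := hPeval n (-s) i
    have h2 := hPeval n 0 i
    rw [hconst, MvPolynomial.eval_C] at h1 h2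
    rw [neg_neg] at h1
    rw [neg_zero, uDiag_zero, one_mul] at h2
    rw [← h1, ← h2]
  obtain ⟨φ, hφ, c, hc0, hctop, Q, ⟨i₀, hQ0⟩, hQlim, hQle⟩ :=
    exists_renormalization P _ hPsupp hPcoeff hPnc hε
  -- visiting times at the scale `c n`
  obtain ⟨γ, hγ, h, hh, ψ, hψ, hlim⟩ := exists_subseq_of_endsIn hcc
    (g := fun n => (k (φ n)).1 * aElt d (Real.log (c n))) fun n => (hkE _).mul_aElt _
  obtain ⟨σ, hσ1, hσ, hσQ⟩ := exists_endsIn_eval_ne_zero hcc hzd hh hQ0 one_pos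
  obtain ⟨τ, hτ, hτk⟩ := exists_tendsto_uElt hlim σ
  have hvisit : ∀ᶠ n in atTop, EndsIn Γ₁ ((k (φ (ψ n))).1 * uElt (c (ψ n) • τ n)) := by
    filter_upwards [hτk] with n hn
    rw [← hn] at hσ
    have := (klein_mul_aElt_uElt (hγ _) _ _).1 hσ
    rw [Real.exp_log (hc0 _)] at this
    exact endsIn_mul_uElt (hkE _) this
  -- convergence of the defects
  set s : ℕ → Mid d → ℝ := fun n => c (ψ n) • τ n with hs
  have hconv : ∀ δ : Mid d → ℝ, Tendsto (fun n => defect (uDiag (-(s n + δ)) * q (φ (ψ n)))) atTop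
      (𝓝 fun i => MvPolynomial.eval σ (Q i)) := by
    intro δ
    rw [tendsto_pi_nhds]
    intro i
    -- A fixed shift δ of the time disappears after division by c n, so the limit defect is
    -- independent of δ.
    have h1 : Tendsto (fun n => (c n)⁻¹ • δ) atTop (𝓝 0) := by
      simpa using (tendsto_inv_atTop_zero.comp hctop).smul_const δ
    -- extend `τ` along `ψ` to a sequence indexed by all of `ℕ`
    let τ' : ℕ → Mid d → ℝ := fun m => if hm : ∃ n, ψ n = m then τ hm.choose else σ
    have hτ' : ∀ n, τ' (ψ n) = τ n := fun n => by
      have hm : ∃ n', ψ n' = ψ n := ⟨n, rfl⟩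
      simp only [τ', dif_pos hm]
      rw [hψ.injective hm.choose_spec]
    have hτ'lim : Tendsto τ' atTop (𝓝 σ) := by
      rw [tendsto_atTop_nhds]
      intro U hU hUo
      obtain ⟨N, hN⟩ := tendsto_atTop_nhds.1 hτ U hU hUo
      refine ⟨ψ N, fun m hm => ?_⟩
      by_cases h : ∃ n, ψ n = m
      · obtain ⟨n, rfl⟩ := h
        rw [hτ']
        exact hN n (hψ.le_iff_le.1 hm)
      · simp only [τ', dif_neg h]
        exact hU
    have h2 := (hQlim (fun m => τ' m + (c m)⁻¹ • δ) σ (by simpa using hτ'lim.add h1) i).comp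
      hψ.tendsto_atTop
    refine h2.congr fun n => ?_
    simp only [Function.comp_apply, hPeval, hτ', smul_add, smul_smul,
      mul_inv_cancel₀ (hc0 (ψ n)).ne', one_smul, hs]
  set D : DefectIdx d → ℝ := fun i => MvPolynomial.eval σ (Q i) with hD
  have hD0 : D ≠ 0 := fun h0 => hσQ (congrFun h0 i₀)
  have hDle : ‖D‖ ≤ ε := (pi_norm_le_iff_of_nonneg hε.le).2 fun i => hQle σ hσ1.le i
  have hconv0 : Tendsto (fun n => defect (uDiag (-s n) * q (φ (ψ n)))) atTop (𝓝 D) := by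
    simpa using hconv 0
  -- The assumption ε ≤ 1/4 leaves room below 1/2, the bound required by `exists_ht_mul_uElt_le`.
  have hsmall : ∀ᶠ n in atTop, ‖defect (uDiag (-s n) * q (φ (ψ n)))‖ ≤ 1 / 2 :=
    (hconv0.norm.eventually_lt_const (lt_of_le_of_lt hDle (by linarith))).mono fun n hn => hn.le
  obtain ⟨N, hN⟩ := eventually_atTop.1 (hvisit.and hsmall)
  -- representatives in compact sets
  obtain ⟨R₁, hR₁⟩ := exists_ht_le_of_endsIn hcc
  obtain ⟨R₂, hR₂⟩ := exists_ht_le_of_isCompact (Γ := Γ₂) isCompact_univ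
  let q' : ℕ → G d × G d := fun n => uDiag (-s (n + N)) * q (φ (ψ (n + N)))
  let k' : ℕ → G d × G d := fun n => k (φ (ψ (n + N))) * uDiag (s (n + N))
  have hq'le : ∀ n, ‖defect (q' n)‖ ≤ 1 / 2 := fun n => (hN (n + N) (by omega)).2
  choose η₁ hη₁ hη₁R using fun n => hR₁ (k' n).1 (hN (n + N) (by omega)).1
  choose η₂ hη₂ hη₂R using fun n => hR₂ (k' n).2 (Set.mem_univ _)
  choose θ hθ using fun n => exists_ht_mul_uElt_le (g := (q' n).1) fun i =>
    (norm_le_pi_norm (defect (q' n)) (i, none)).trans (hq'le n)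
  -- Small defect does not bound q' itself, only q'₁ q'₂⁻¹ and, after a right translation by some
  -- u_θ, q'₁. These two determine the translate of q', whose second entry is (q'₁ q'₂⁻¹)⁻¹ q'₁ u_θ.
  let Ψ : ℕ → (G d × G d) × (G d × G d) := fun n => ((η₁ n, η₂ n) * k' n,
    ((q' n).1 * (q' n).2⁻¹, (q' n).1 * uElt (θ n)))
  have hΨ : ∀ n, Ψ n ∈ (({g : G d | ht g ≤ R₁} ∩ {g | EndsIn Γ₁ g}) ×ˢ {g : G d | ht g ≤ R₂}) ×ˢ
      ({g : G d | ht g ≤ 2} ×ˢ {g : G d | ht g ≤ 2}) := fun n =>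
    ⟨⟨⟨hη₁R n, (hN (n + N) (by omega)).1.mul_left (hη₁ n)⟩, hη₂R n⟩,
      ⟨ht_mul_inv_le (hq'le n) (by norm_num), hθ n⟩⟩
  have hcomp : IsCompact ((({g : G d | ht g ≤ R₁} ∩ {g | EndsIn Γ₁ g}) ×ˢ {g : G d | ht g ≤ R₂}) ×ˢ
      ({g : G d | ht g ≤ 2} ×ˢ {g : G d | ht g ≤ 2})) :=
    (((isCompact_ht_le R₁).inter_right (isClosed_endsIn Γ₁)).prod (isCompact_ht_le R₂)).prod
      ((isCompact_ht_le 2).prod (isCompact_ht_le 2))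
  obtain ⟨⟨g, x, v⟩, ⟨⟨⟨-, hgE⟩, -⟩, -⟩, χ, hχ, hχlim⟩ := hcomp.tendsto_subseq hΨ
  have hg : Tendsto (fun n => (η₁ (χ n), η₂ (χ n)) * k' (χ n)) atTop (𝓝 g) := hχlim.fst_nhds
  have hx : Tendsto (fun n => (q' (χ n)).1 * (q' (χ n)).2⁻¹) atTop (𝓝 x) := hχlim.snd_nhds.fst_nhds
  have hv : Tendsto (fun n => (q' (χ n)).1 * uElt (θ (χ n))) atTop (𝓝 v) := hχlim.snd_nhds.snd_nhds
  have hw : Tendsto (fun n => q' (χ n) * uDiag (θ (χ n))) atTop (𝓝 (v, x⁻¹ * v)) := by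
    refine (hv.prodMk_nhds (hx.inv.mul hv)).congr fun n => ?_
    refine Prod.ext rfl ?_
    simp [uDiag, mul_assoc]
  have hgY : g ∈ Y := by
    refine hY.isClosed.mem_of_tendsto hg (Eventually.of_forall fun n => ?_)
    exact hY.left _ (hY.right _ (hkY _) _) _ (hη₁ _) _ (hη₂ _)
  have hgw : g * (v, x⁻¹ * v) ∈ Y := by
    refine hY.isClosed.mem_of_tendsto (hg.mul hw) (Eventually.of_forall fun n => ?_)
    have : (η₁ (χ n), η₂ (χ n)) * k' (χ n) * (q' (χ n) * uDiag (θ (χ n))) =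
        (η₁ (χ n), η₂ (χ n)) * (k (φ (ψ (χ n + N))) * q (φ (ψ (χ n + N))) *
          uDiag (θ (χ n))) := by
      simp only [k', q', uDiag_neg]
      group
    rw [this]
    exact hY.left _ (hY.right _ (hkq _) _) _ (hη₁ _) _ (hη₂ _)
  have hdef : ∀ δ, defect (uDiag (-δ) * (v, x⁻¹ * v)) = D := by
    intro δ
    refine tendsto_of_defect ?_ ((tendsto_const_nhds (x := uDiag (-δ))).mul hw)
    have h1 := (hconv δ).comp ((tendsto_add_atTop_nat N).comp hχ.tendsto_atTop)
    refine h1.congr fun n => ?_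
    rw [← mul_assoc, defect_mul_uDiag]
    simp only [Function.comp_apply, q']
    rw [neg_add_rev, uDiag_add, mul_assoc]
  have hdef0 : defect (v, x⁻¹ * v) = D := by simpa using hdef 0
  refine ⟨g, hgY, hgE, (v, x⁻¹ * v), fun δ => ?_, hgw, hdef0 ▸ hD0, hdef0 ▸ hDle⟩
  rw [hdef0, ← hdef (-δ), neg_neg]

/-- Elements of `Y` which return close to each other yield elements of the normalizer of small
non-zero defect. -/
theorem exists_small_defect {Γ₁ Γ₂ : Subgroup (G d)} (hcc : IsConvexCocompact Γ₁)
    (hzd : IsZariskiDense Γ₁) (hc₂ : CompactSpace (LeftQuot Γ₂)) {Y : Set (G d × G d)}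
    (hY : IsLiftInvariant Γ₁ Γ₂ Y) {k q : ℕ → G d × G d} (hkE : ∀ n, EndsIn Γ₁ (k n).1)
    (hkY : ∀ n, k n ∈ Y) (hkq : ∀ n, k n * q n ∈ Y) (hq : Tendsto q atTop (𝓝 1))
    (hq0 : ∀ n, defect (q n) ≠ 0) {ε : ℝ} (hε : 0 < ε) :
    ∃ g ∈ Y, EndsIn Γ₁ g.1 ∧ ∃ w, IsAM w.1 ∧ w.1 * w.2⁻¹ ∈ Set.range (uElt : (Mid d → ℝ) → G d) ∧
      g * w ∈ Y ∧ defect w ≠ 0 ∧ ‖defect w‖ ≤ ε := by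
  suffices h : ∃ g ∈ Y, EndsIn Γ₁ g.1 ∧ ∃ w, (∀ s, defect (uDiag s * w) = defect w) ∧ g * w ∈ Y ∧
      defect w ≠ 0 ∧ ‖defect w‖ ≤ ε by
    obtain ⟨g, hg, hgE, w, hinv, hgw, hw0, hwε⟩ := h
    obtain ⟨h1, s, hs⟩ := normalizes_of_defect_invariant hinv
    refine ⟨g, hg, hgE, w * uDiag s, hs, ?_, ?_, ?_, ?_⟩
    · simpa [uDiag] using h1
    · rw [← mul_assoc]; exact hY.right _ hgw _
    · rwa [defect_mul_uDiag]
    · rwa [defect_mul_uDiag]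
  -- If some q n already has a small invariant defect, it serves as w. Otherwise the defect is
  -- eventually non-constant under U and the blow-up applies.
  by_cases hcase : ∃ n, (∀ s, defect (uDiag s * q n) = defect (q n)) ∧ ‖defect (q n)‖ ≤ ε
  · obtain ⟨n, h1, h2⟩ := hcase
    exact ⟨k n, hkY n, hkE n, q n, h1, hkq n, hq0 n, h2⟩
  · push Not at hcase
    have hdq : Tendsto (fun n => ‖defect (q n)‖) atTop (𝓝 0) := by
      have := ((continuous_defect.tendsto (1 : G d × G d)).comp hq).norm
      simpa using this
    obtain ⟨N, hN⟩ := eventually_atTop.1 (hdq.eventually_lt_const hε)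
    obtain ⟨g, hg, hgE, w, h1, h2, h3, h4⟩ := exists_normalizing_limit hcc hzd hc₂ hY
      (k := fun n => k (n + N)) (q := fun n => q (n + N)) (fun n => hkE _) (fun n => hkY _)
      (fun n => hkq _) (hq.comp (tendsto_add_atTop_nat N))
      (fun n => by
        by_contra hall
        push Not at hall
        exact absurd (hcase (n + N) hall) (not_lt.2 (hN (n + N) (by omega)).le))
      (ε := min ε (1 / 4)) (lt_min hε (by norm_num)) (min_le_right _ _)
    exact ⟨g, hg, hgE, w, h1, h2, h3, h4.trans (min_le_left _ _)⟩

/-! ## Recurrence -/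

/-- At visiting times the orbit returns to a compact set modulo Γ₁ × Γ₂. The quotient of two returns
far apart in time tends to 1, and it cannot lie in diag(𝒰ℳ): Γ₂ would then contribute no element,
and the quotient would be a u_s with |s| ≥ 1 in its second entry. -/
theorem exists_recurrence {Γ₁ Γ₂ : Subgroup (G d)} [DiscreteTopology Γ₂]
    (hcc : IsConvexCocompact Γ₁) (hzd : IsZariskiDense Γ₁) (htf : IsTorsionFreeSubgroup Γ₂)
    (hc₂ : CompactSpace (LeftQuot Γ₂)) {Y : Set (G d × G d)} (hY : IsLiftInvariant Γ₁ Γ₂ Y)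
    {g₀ : G d × G d} (hg₀ : g₀ ∈ Y) (hg₀E : EndsIn Γ₁ g₀.1) :
    ∃ k q : ℕ → G d × G d, (∀ n, EndsIn Γ₁ (k n).1) ∧ (∀ n, k n ∈ Y) ∧ (∀ n, k n * q n ∈ Y) ∧
      Tendsto q atTop (𝓝 1) ∧ ∀ n, defect (q n) ≠ 0 := by
  choose s hsn hsE using fun n : ℕ => exists_endsIn_norm_ge hcc hzd hg₀E (n : ℝ)
  obtain ⟨R₁, hR₁⟩ := exists_ht_le_of_endsIn hcc
  obtain ⟨R₂, hR₂⟩ := exists_ht_le_of_isCompact (Γ := Γ₂) isCompact_univ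
  choose η₁ hη₁ hη₁R using fun n => hR₁ (g₀.1 * uElt (s n)) (hsE n)
  choose η₂ hη₂ hη₂R using fun n => hR₂ (g₀.2 * uElt (s n)) (Set.mem_univ _)
  let x : ℕ → G d × G d := fun n => (η₁ n, η₂ n) * (g₀ * uDiag (s n))
  have hx : ∀ n, x n ∈ {g : G d | ht g ≤ R₁} ×ˢ {g : G d | ht g ≤ R₂} := fun n =>
    ⟨hη₁R n, hη₂R n⟩
  have hxY : ∀ n, x n ∈ Y := fun n => hY.left _ (hY.right _ hg₀ _) _ (hη₁ n) _ (hη₂ n)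
  have hxE : ∀ n, EndsIn Γ₁ (x n).1 := fun n => (hsE n).mul_left (hη₁ n)
  obtain ⟨y, -, φ, hφ, hlim⟩ :=
    ((isCompact_ht_le R₁).prod (isCompact_ht_le R₂)).tendsto_subseq hx
  have hfar : ∀ n, ∃ m, n ≤ m ∧ 1 ≤ ‖s (φ m) - s (φ n)‖ := by
    intro n
    obtain ⟨m, hm⟩ := exists_nat_ge (‖s (φ n)‖ + 1)
    refine ⟨max m n, le_max_right _ _, ?_⟩
    have h1 : (m : ℝ) ≤ φ (max m n) := by
      exact_mod_cast (le_max_left m n).trans (hφ.id_le _)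
    have h2 := norm_sub_norm_le (s (φ (max m n))) (s (φ n))
    linarith [hsn (φ (max m n))]
  choose m hmn hm1 using hfar
  have hmtop : Tendsto m atTop atTop := tendsto_atTop_mono hmn tendsto_id
  let q : ℕ → G d × G d := fun n => (x (φ n))⁻¹ * x (φ (m n))
  have hq : Tendsto q atTop (𝓝 1) := by
    have := hlim.inv.mul (hlim.comp hmtop)
    rwa [inv_mul_cancel] at this
  -- The second entry is a conjugate of an element γ of Γ₂ times a u_s. If it fixes e₊, so does the
  -- conjugate of γ, whence γ = 1.
  have hq2 : ∀ n, act (q n).2 (eP d) = eP d → (q n).2 = uElt (s (φ (m n)) - s (φ n)) := by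
    intro n hn
    set γ := η₂ (φ (m n)) * (η₂ (φ n))⁻¹ with hγ
    have h1 : (q n).2 = ((x (φ n)).2⁻¹ * γ * (x (φ n)).2) * uElt (s (φ (m n)) - s (φ n)) := by
      rw [sub_eq_neg_add]
      simp only [q, x, uDiag, hγ, uElt_add, uElt_neg, Prod.snd_mul, Prod.snd_inv]
      group
    have h2 : γ = 1 := by
      refine eq_one_of_conj_fixes_eP htf hc₂ (k := (x (φ n)).2)
        (Γ₂.mul_mem (hη₂ _) (Γ₂.inv_mem (hη₂ _))) ?_
      rw [h1, act_mul, act_uElt_eP] at hn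
      exact hn
    rw [h1, h2]
    simp
  have hbad : ∀ᶠ n in atTop, act (q n).2 (eP d) ≠ eP d := by
    have h1 : Tendsto (fun n => restr d (act (q n).2 (eM d))) atTop (𝓝 0) := by
      have h2 := ((continuous_restr (d := d)).comp (continuous_act (eM d))).tendsto 1
      have h3 := h2.comp hq.snd_nhds
      have h4 : restr d (eM d) = 0 := by ext i; simp
      simpa [Function.comp_def, h4] using h3
    filter_upwards [h1.norm.eventually_lt_const (show ‖(0 : Mid d → ℝ)‖ < 1 by simp)] with n hn hcon
    rw [hq2 n hcon, restr_act_uElt_eM, norm_smul] at hn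
    norm_num at hn
    linarith [hm1 n]
  obtain ⟨N, hN⟩ := eventually_atTop.1 hbad
  refine ⟨fun n => x (φ (n + N)), fun n => q (n + N), fun n => hxE _, fun n => hxY _, fun n => ?_,
    hq.comp (tendsto_add_atTop_nat N), fun n h0 => ?_⟩
  · simp only [q, mul_inv_cancel_left]
    exact hxY _
  · rw [defect_eq_zero_iff] at h0
    exact hN (n + N) (by omega) (h0.2 ▸ h0.1)

end OrbitClosure

end

noncomputable section

set_option linter.unusedSectionVars false

namespace OrbitClosure

/-! ## One-parameter semigroups in closed semigroups -/

section Semigroup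

variable {𝔸 : Type*} [NormedRing 𝔸] [NormOneClass 𝔸] [NormedAlgebra ℝ 𝔸] [CompleteSpace 𝔸]

theorem norm_pow_sub_pow_le' {a b : 𝔸} {M : ℝ} (hM : 1 ≤ M) (ha : ‖a‖ ≤ M) (hb : ‖b‖ ≤ M) (n : ℕ) :
    ‖a ^ n - b ^ n‖ ≤ n * M ^ n * ‖a - b‖ := by
  have hM0 : 0 ≤ M := zero_le_one.trans hM
  induction n with
  | zero => simp
  | succ n ih =>
    have h1 : a ^ (n + 1) - b ^ (n + 1) = a * (a ^ n - b ^ n) + (a - b) * b ^ n := by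
      rw [pow_succ', pow_succ']; noncomm_ring
    have h2 : ‖b ^ n‖ ≤ M ^ (n + 1) := (norm_pow_le b n).trans
      ((pow_le_pow_left₀ (norm_nonneg _) hb n).trans (pow_le_pow_right₀ hM (Nat.le_succ n)))
    calc ‖a ^ (n + 1) - b ^ (n + 1)‖ ≤ ‖a‖ * ‖a ^ n - b ^ n‖ + ‖a - b‖ * ‖b ^ n‖ := by
          rw [h1]
          exact (norm_add_le _ _).trans (add_le_add (norm_mul_le _ _) (norm_mul_le _ _))
      _ ≤ M * (n * M ^ n * ‖a - b‖) + ‖a - b‖ * M ^ (n + 1) := by gcongr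
      _ = (n + 1 : ℕ) * M ^ (n + 1) * ‖a - b‖ := by push_cast; ring

theorem eventually_norm_exp_sub_le {η : ℝ} (hη : 0 < η) :
    ∀ᶠ y : 𝔸 in 𝓝 0, ‖NormedSpace.exp y - 1 - y‖ ≤ η * ‖y‖ := by
  have h := (hasFDerivAt_exp_zero (𝕂 := ℝ) (𝔸 := 𝔸)).isLittleO.def hη
  simpa using h

/-- The powers of exp(y k) converge by continuity. Replacing exp(y k) by 1 + y k costs o(|y k|) per
factor, and n k |y k| stays bounded. -/
theorem tendsto_one_add_pow_exp {y : ℕ → 𝔸} {n : ℕ → ℕ} {z : 𝔸} (hy : Tendsto y atTop (𝓝 0))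
    (hn : Tendsto (fun k => n k • y k) atTop (𝓝 z)) :
    Tendsto (fun k => (1 + y k) ^ n k) atTop (𝓝 (NormedSpace.exp z)) := by
  let : NormedAlgebra ℚ 𝔸 := NormedAlgebra.restrictScalars ℚ ℝ 𝔸
  have h1 : Tendsto (fun k => NormedSpace.exp (y k) ^ n k) atTop (𝓝 (NormedSpace.exp z)) := by
    simp only [← NormedSpace.exp_nsmul]
    exact (NormedSpace.exp_continuous.tendsto z).comp hn
  set C := ‖z‖ + 1
  have hC : ∀ᶠ k in atTop, n k * ‖y k‖ ≤ C := by
    filter_upwards [hn.norm.eventually_lt_const (show ‖z‖ < C by simp [C])] with k hk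
    rw [← Nat.cast_smul_eq_nsmul ℝ, norm_smul, Real.norm_natCast] at hk
    exact hk.le
  have h2 : Tendsto (fun k => (1 + y k) ^ n k - NormedSpace.exp (y k) ^ n k) atTop (𝓝 0) := by
    rw [Metric.tendsto_atTop']
    intro ε hε
    have hC0 : 0 < C := by positivity
    set η := min 1 (ε / (2 * (Real.exp (2 * C) * C)))
    have hη : 0 < η := lt_min one_pos (by positivity)
    obtain ⟨N, hN⟩ := eventually_atTop.1 (hC.and (hy.eventually (eventually_norm_exp_sub_le hη)))
    refine ⟨N, fun k hk => ?_⟩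
    obtain ⟨hk1, hk2⟩ := hN k hk.le
    rw [dist_zero_right]
    have hr : ‖NormedSpace.exp (y k) - 1 - y k‖ ≤ ‖y k‖ := hk2.trans
      (mul_le_of_le_one_left (norm_nonneg _) (min_le_left _ _))
    have he : 1 + 2 * ‖y k‖ ≤ Real.exp (2 * ‖y k‖) := by
      linarith [Real.add_one_le_exp (2 * ‖y k‖)]
    have ha : ‖1 + y k‖ ≤ Real.exp (2 * ‖y k‖) := by
      have := norm_add_le (1 : 𝔸) (y k)
      rw [norm_one] at this
      linarith [norm_nonneg (y k)]
    have hb : ‖NormedSpace.exp (y k)‖ ≤ Real.exp (2 * ‖y k‖) := by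
      have h3 : NormedSpace.exp (y k) = (NormedSpace.exp (y k) - 1 - y k) + (1 + y k) := by abel
      have h4 := norm_add_le (NormedSpace.exp (y k) - 1 - y k) (1 + y k)
      have h5 := norm_add_le (1 : 𝔸) (y k)
      rw [norm_one] at h5
      rw [← h3] at h4
      linarith
    have hexp : Real.exp (2 * ‖y k‖) ^ n k ≤ Real.exp (2 * C) := by
      rw [← Real.exp_nat_mul]
      apply Real.exp_le_exp.2
      linarith
    have hnorm : ‖1 + y k - NormedSpace.exp (y k)‖ ≤ η * ‖y k‖ := by
      rwa [show 1 + y k - NormedSpace.exp (y k) = -(NormedSpace.exp (y k) - 1 - y k) by abel,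
        norm_neg]
    calc ‖(1 + y k) ^ n k - NormedSpace.exp (y k) ^ n k‖
        ≤ n k * Real.exp (2 * ‖y k‖) ^ n k * ‖1 + y k - NormedSpace.exp (y k)‖ :=
          norm_pow_sub_pow_le' (by linarith [norm_nonneg (y k)]) ha hb _
      _ ≤ n k * Real.exp (2 * C) * (η * ‖y k‖) := by gcongr
      _ = (n k * ‖y k‖) * (Real.exp (2 * C) * η) := by ring
      _ ≤ C * (Real.exp (2 * C) * η) := by gcongr
      _ ≤ C * (Real.exp (2 * C) * (ε / (2 * (Real.exp (2 * C) * C)))) := by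
        gcongr; exact min_le_right _ _
      _ = ε / 2 := by field_simp
      _ < ε := by linarith
  simpa using h2.add h1

variable {𝒢 : Type*} [Group 𝒢] [TopologicalSpace 𝒢] [IsTopologicalGroup 𝒢]
  [FirstCountableTopology 𝒢]

/-- A compact subsemigroup of a topological group is closed under inversion. -/
theorem inv_mem_of_isCompact [T2Space 𝒢] {M : Set 𝒢} (hM : IsCompact M)
    (hmul : ∀ a ∈ M, ∀ b ∈ M, a * b ∈ M) {h : 𝒢} (hh : h ∈ M) : h⁻¹ ∈ M := by
  have hpow : ∀ n : ℕ, h ^ (n + 1) ∈ M := fun n => by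
    induction n with
    | zero => simpa
    | succ n ih => rw [pow_succ]; exact hmul _ ih _ hh
  obtain ⟨x, -, φ, hφ, hlim⟩ := hM.tendsto_subseq hpow
  have h1 : Tendsto (fun n => (h ^ (φ n + 1))⁻¹ * h ^ (φ (n + 2) + 1) * h⁻¹) atTop (𝓝 h⁻¹) := by
    have := (hlim.inv.mul (hlim.comp (tendsto_add_atTop_nat 2))).mul_const h⁻¹
    simpa using this
  refine hM.isClosed.mem_of_tendsto h1 (Eventually.of_forall fun n => ?_)
  -- Skipping two indices keeps the exponent below at least 1; the identity is not assumed to belong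
  -- to M.
  have h2 : φ n + 2 ≤ φ (n + 2) := by
    have a1 : φ n < φ (n + 1) := hφ (by omega)
    have a2 : φ (n + 1) < φ (n + 2) := hφ (by omega)
    omega
  have h3 : (h ^ (φ n + 1))⁻¹ * h ^ (φ (n + 2) + 1) * h⁻¹ = h ^ (φ (n + 2) - φ n - 2 + 1) := by
    rw [mul_inv_eq_iff_eq_mul, inv_mul_eq_iff_eq_mul, ← pow_succ, ← pow_add]
    congr 1
    omega
  rw [h3]
  exact hpow _

/-- A closed subsemigroup which accumulates, outside of a subgroup `D`, at a point of `D`, contains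
a one-parameter semigroup outside of `D`. The direction of this semigroup is obtained as a limit
of rescaled elements of the group. -/
theorem exists_direction [T2Space 𝒢] [FiniteDimensional ℝ 𝔸] (T : 𝒢 →* 𝔸) (hT : IsEmbedding T)
    {W : Set 𝒢} (hW : IsClosed W) (hW1 : 1 ∈ W) (hWmul : ∀ a ∈ W, ∀ b ∈ W, a * b ∈ W)
    (D : Subgroup 𝒢) (hWD : IsCompact (W ∩ D)) {w : ℕ → 𝒢} {w₀ : 𝒢} (hw : ∀ n, w n ∈ W)
    (hwD : ∀ n, w n ∉ D) (hw₀ : w₀ ∈ W ∩ D) (hlim : Tendsto w atTop (𝓝 w₀)) :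
    ∃ ξ : 𝔸, ξ ≠ 0 ∧
      (∃ v : ℕ → 𝒢, ∃ δ : ℕ → ℝ, (∀ n, 0 < δ n) ∧ Tendsto δ atTop (𝓝 0) ∧
        Tendsto (fun n => (δ n)⁻¹ • (T (v n) - 1)) atTop (𝓝 ξ)) ∧
      (∀ e : 𝒢, ∀ t : ℝ, 0 ≤ t → T e = NormedSpace.exp (t • ξ) → e ∈ W) ∧
      ∀ E : ℝ → 𝒢, (∀ t, T (E t) = NormedSpace.exp (t • ξ)) → ∃ t, 0 ≤ t ∧ E t ∉ D := by
  let : NormedAlgebra ℚ 𝔸 := NormedAlgebra.restrictScalars ℚ ℝ 𝔸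
  have hinv : ∀ h ∈ W ∩ (D : Set 𝒢), h⁻¹ ∈ W ∩ (D : Set 𝒢) := fun h hh =>
    inv_mem_of_isCompact hWD (fun a ha b hb => ⟨hWmul a ha.1 b hb.1, D.mul_mem ha.2 hb.2⟩) hh
  have hTc : Continuous T := hT.continuous
  -- Translate w n by the compact group W ∩ D to bring it as close to 1 as possible. This removes
  -- the component along D and is what later keeps the direction out of D.
  have hmin : ∀ n, ∃ h ∈ W ∩ (D : Set 𝒢), ∀ h' ∈ W ∩ (D : Set 𝒢),
      ‖T (w n * h) - 1‖ ≤ ‖T (w n * h') - 1‖ := fun n => by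
    have hcont : Continuous fun h => ‖T (w n * h) - 1‖ := by fun_prop
    exact hWD.exists_isMinOn ⟨1, hW1, D.one_mem⟩ hcont.continuousOn
  choose h hh hhmin using hmin
  set v : ℕ → 𝒢 := fun n => w n * h n with hv
  set δ : ℕ → ℝ := fun n => ‖T (v n) - 1‖ with hδ
  have hvW : ∀ n, v n ∈ W := fun n => hWmul _ (hw n) _ (hh n).1
  have hvD : ∀ n, v n ∉ D := fun n hn => hwD n (by
    simpa [v] using D.mul_mem hn (D.inv_mem (hh n).2))
  have hδ0 : ∀ n, 0 < δ n := fun n => by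
    refine norm_pos_iff.2 fun h0 => hvD n ?_
    have h1 : T (v n) = T 1 := by rw [map_one]; exact sub_eq_zero.1 h0
    rw [hT.injective h1]
    exact D.one_mem
  have hδlim : Tendsto δ atTop (𝓝 0) := by
    have h1 : Tendsto (fun n => ‖T (w n * w₀⁻¹) - 1‖) atTop (𝓝 0) := by
      have h2 : Tendsto (fun n => w n * w₀⁻¹) atTop (𝓝 1) := by
        simpa using hlim.mul_const w₀⁻¹
      have h3 := ((hTc.tendsto 1).comp h2).sub_const 1
      simpa using h3.norm
    exact squeeze_zero (fun n => norm_nonneg _) (fun n => hhmin n _ (hinv _ hw₀)) h1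
  have hsphere : ∀ n, (δ n)⁻¹ • (T (v n) - 1) ∈ Metric.sphere (0 : 𝔸) 1 := fun n => by
    rw [mem_sphere_zero_iff_norm, norm_smul, norm_inv, Real.norm_of_nonneg (hδ0 n).le]
    exact inv_mul_cancel₀ (hδ0 n).ne'
  have : ProperSpace 𝔸 := FiniteDimensional.proper ℝ 𝔸
  obtain ⟨ξ, hξ, φ, hφ, hφlim⟩ := (isCompact_sphere (0 : 𝔸) 1).tendsto_subseq hsphere
  have hξ1 : ‖ξ‖ = 1 := mem_sphere_zero_iff_norm.1 hξ
  have hδφ : Tendsto (fun n => δ (φ n)) atTop (𝓝 0) := hδlim.comp hφ.tendsto_atTop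
  have hmem : ∀ e : 𝒢, ∀ t : ℝ, 0 ≤ t → T e = NormedSpace.exp (t • ξ) → e ∈ W := by
    intro e t ht he
    -- With v n ≈ 1 + δ n ξ, the power ⌊t / δ n⌋ of v n tends to exp(tξ).
    set N : ℕ → ℕ := fun n => ⌊t / δ (φ n)⌋₊
    have hNδ : Tendsto (fun n => (N n : ℝ) * δ (φ n)) atTop (𝓝 t) := by
      have hl : ∀ n, t - δ (φ n) ≤ N n * δ (φ n) := fun n => by
        have h1 := (Nat.lt_floor_add_one (t / δ (φ n))).le
        have h2 := mul_le_mul_of_nonneg_right h1 (hδ0 (φ n)).le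
        rw [div_mul_cancel₀ _ (hδ0 (φ n)).ne'] at h2
        simp only [N]
        linarith
      have hu : ∀ n, N n * δ (φ n) ≤ t := fun n => by
        have h1 := Nat.floor_le (div_nonneg ht (hδ0 (φ n)).le)
        have h2 := mul_le_mul_of_nonneg_right h1 (hδ0 (φ n)).le
        rwa [div_mul_cancel₀ _ (hδ0 (φ n)).ne'] at h2
      refine tendsto_of_tendsto_of_tendsto_of_le_of_le ?_ tendsto_const_nhds hl hu
      simpa using tendsto_const_nhds.sub hδφ
    have hpow : Tendsto (fun n => (1 + (T (v (φ n)) - 1)) ^ N n) atTop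
        (𝓝 (NormedSpace.exp (t • ξ))) := by
      apply tendsto_one_add_pow_exp
      · rw [tendsto_zero_iff_norm_tendsto_zero]
        exact hδφ
      · refine (hNδ.smul hφlim).congr fun n => ?_
        rw [Function.comp_apply, smul_smul, mul_assoc, mul_inv_cancel₀ (hδ0 _).ne', mul_one,
          Nat.cast_smul_eq_nsmul]
    have hconv : Tendsto (fun n => v (φ n) ^ N n) atTop (𝓝 e) := by
      rw [hT.tendsto_nhds_iff, he]
      simpa [Function.comp_def] using hpow
    refine hW.mem_of_tendsto hconv (Eventually.of_forall fun n => ?_)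
    induction N n with
    | zero => simpa
    | succ m ih => rw [pow_succ]; exact hWmul _ ih _ (hvW _)
  refine ⟨ξ, fun h0 => by simp [h0] at hξ1, ⟨fun n => v (φ n), fun n => δ (φ n), fun n => hδ0 _,
    hδφ, hφlim⟩, hmem, ?_⟩
  · intro E hE
    by_contra hall
    push Not at hall
    have hEW : ∀ t, 0 ≤ t → E t ∈ W ∩ (D : Set 𝒢) := fun t ht =>
      ⟨hmem _ t ht (hE t), hall t ht⟩
    have hEinv : ∀ t, T (E t)⁻¹ = NormedSpace.exp (-(t • ξ)) := fun t => by
      have h1 : E t * E (-t) = 1 := hT.injective (by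
        rw [map_mul, hE, hE, neg_smul, ← NormedSpace.exp_add_of_commute
          (Commute.neg_right (Commute.refl _)), add_neg_cancel, NormedSpace.exp_zero, map_one])
      rw [← eq_inv_of_mul_eq_one_right h1, hE, neg_smul]
    -- The three error terms below are bounded by a/8, a/8 and a/4, where a is the value of δ; their
    -- sum a/2 contradicts the lower bound a.
    have hsmall : ∀ᶠ n in atTop, ‖NormedSpace.exp (-(δ (φ n) • ξ)) - 1 - -(δ (φ n) • ξ)‖ ≤
        1 / 8 * ‖-(δ (φ n) • ξ)‖ := by
      have h0 : Tendsto (fun n => -(δ (φ n) • ξ)) atTop (𝓝 0) := by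
        simpa using (hδφ.smul_const ξ).neg
      exact h0.eventually (eventually_norm_exp_sub_le (by norm_num))
    have hclose : ∀ᶠ n in atTop, ‖(δ (φ n))⁻¹ • (T (v (φ n)) - 1) - ξ‖ < 1 / 8 := by
      have := (hφlim.sub_const ξ).norm
      rw [sub_self, norm_zero] at this
      exact this.eventually_lt_const (by norm_num)
    obtain ⟨n, ⟨hn1, hn2⟩, hn3⟩ := ((hsmall.and hclose).and
      (hδφ.eventually_lt_const (show (0 : ℝ) < 1 / 8 by norm_num))).exists
    -- If exp(tξ) stayed in D, then h n exp(-δ n ξ) would compete in the minimization, and it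
    -- cancels the first-order term of v n - 1.
    have hge : δ (φ n) ≤ ‖T (v (φ n) * (E (δ (φ n)))⁻¹) - 1‖ := by
      have h1 := hhmin (φ n) (h (φ n) * (E (δ (φ n)))⁻¹)
        ⟨hWmul _ (hh _).1 _ (hinv _ (hEW _ (hδ0 _).le)).1,
          D.mul_mem (hh _).2 (hinv _ (hEW _ (hδ0 _).le)).2⟩
      rwa [← mul_assoc] at h1
    rw [map_mul, hEinv] at hge
    have hp := hδ0 (φ n)
    have hX := hsphere (φ n)
    rw [mem_sphere_zero_iff_norm] at hX
    generalize hXd : (δ (φ n))⁻¹ • (T (v (φ n)) - 1) = X at hn2 hX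
    have hTv : T (v (φ n)) = 1 + δ (φ n) • X := by
      rw [← hXd, smul_smul, mul_inv_cancel₀ hp.ne', one_smul]; abel
    generalize δ (φ n) = a at *
    generalize hrd : NormedSpace.exp (-(a • ξ)) - 1 - -(a • ξ) = r at hn1
    have hexp : NormedSpace.exp (-(a • ξ)) = 1 - a • ξ + r := by rw [← hrd]; abel
    rw [norm_neg, norm_smul, hξ1, Real.norm_of_nonneg hp.le, mul_one] at hn1
    have hprod : T (v (φ n)) * NormedSpace.exp (-(a • ξ)) - 1 =
        a • (X - ξ) - (a * a) • (X * ξ) + (1 + a • X) * r := by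
      rw [hTv, hexp]
      simp only [mul_add, add_mul, mul_sub, one_mul, mul_one, smul_mul_assoc, mul_smul_comm]
      module
    rw [hprod] at hge
    have b1 : ‖a • (X - ξ)‖ ≤ a * (1 / 8) := by
      rw [norm_smul, Real.norm_of_nonneg hp.le]; gcongr
    have b2 : ‖(a * a) • (X * ξ)‖ ≤ a * (1 / 8) := by
      rw [norm_smul, Real.norm_of_nonneg (mul_pos hp hp).le]
      have := norm_mul_le X ξ
      rw [hX, hξ1, mul_one] at this
      calc a * a * ‖X * ξ‖ ≤ a * (1 / 8) * 1 := by gcongr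
        _ = _ := mul_one _
    have b3 : ‖(1 + a • X) * r‖ ≤ 2 * (1 / 8 * a) := by
      refine (norm_mul_le _ _).trans ?_
      have h1 := norm_add_le (1 : 𝔸) (a • X)
      rw [norm_one, norm_smul, Real.norm_of_nonneg hp.le, hX, mul_one] at h1
      gcongr
      linarith
    have b4 := norm_add_le (a • (X - ξ) - (a * a) • (X * ξ)) ((1 + a • X) * r)
    have b5 := norm_sub_le (a • (X - ξ)) ((a * a) • (X * ξ))
    linarith

end Semigroup

end OrbitClosure

end

noncomputable section

set_option linter.unusedSectionVars false

namespace OrbitClosure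

variable {d : ℕ} [hd : Fact (2 ≤ d)]

/-! ## The semigroup of elements of `𝒜ℳ𝒰₂` preserving a minimal set -/

/-- Since w₂ is w₁ up to a left factor in the abelian group 𝒰, both entries conjugate u_s to the
same element. -/
theorem exists_uDiag_mul_comm {w : G d × G d} (hw : IsAM w.1)
    (hw' : w.1 * w.2⁻¹ ∈ Set.range (uElt : (Mid d → ℝ) → G d)) (s : Mid d → ℝ) :
    ∃ s', uDiag s * w = w * uDiag s' := by
  obtain ⟨v, hv⟩ := hw'
  obtain ⟨s', hs'⟩ := hw.inv.conj_uElt s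
  rw [inv_inv] at hs'
  refine ⟨s', Prod.ext ?_ ?_⟩
  · change uElt s * w.1 = w.1 * uElt s'
    rw [← hs']; group
  · change uElt s * w.2 = w.2 * uElt s'
    have h2 : w.2 = (uElt v)⁻¹ * w.1 := by rw [hv]; group
    have h3 : uElt s * (uElt v)⁻¹ = (uElt v)⁻¹ * uElt s := by rw [← uElt_neg, uElt_comm]
    rw [h2, ← hs', ← mul_assoc, h3]
    group

/-- The elements of `𝒜ℳ𝒰₂` which map `Y` into itself. -/
def stabSemigroup {Γ₁ Γ₂ : Subgroup (G d)} (Y : Set (ZSpace Γ₁ Γ₂)) : Set (G d × G d) :=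
  {w | IsAM w.1 ∧ w.1 * w.2⁻¹ ∈ Set.range (uElt : (Mid d → ℝ) → G d) ∧ ∀ z ∈ Y, ztr z w ∈ Y}

variable {Γ₁ Γ₂ : Subgroup (G d)}

/-- The projection `G × G → Z`. -/
def zproj (Γ₁ Γ₂ : Subgroup (G d)) (g : G d × G d) : ZSpace Γ₁ Γ₂ := (proj Γ₁ g.1, proj Γ₂ g.2)

theorem continuous_zproj : Continuous (zproj Γ₁ Γ₂) :=
  ((continuous_proj Γ₁).comp continuous_fst).prodMk ((continuous_proj Γ₂).comp continuous_snd)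

theorem zproj_surjective (z : ZSpace Γ₁ Γ₂) : ∃ g, zproj Γ₁ Γ₂ g = z := by
  obtain ⟨g₁, h₁⟩ := proj_surjective Γ₁ z.1
  obtain ⟨g₂, h₂⟩ := proj_surjective Γ₂ z.2
  exact ⟨(g₁, g₂), Prod.ext h₁ h₂⟩

theorem ztr_zproj (g h : G d × G d) : ztr (zproj Γ₁ Γ₂ g) h = zproj Γ₁ Γ₂ (g * h) := rfl

theorem ztr_ztr (z : ZSpace Γ₁ Γ₂) (g h : G d × G d) : ztr (ztr z g) h = ztr z (g * h) := by
  obtain ⟨k, rfl⟩ := zproj_surjective z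
  rw [ztr_zproj, ztr_zproj, ztr_zproj, mul_assoc]

theorem ztr_one (z : ZSpace Γ₁ Γ₂) : ztr z 1 = z := by
  obtain ⟨k, rfl⟩ := zproj_surjective z
  rw [ztr_zproj, mul_one]

theorem isClosed_stabSemigroup {Y : Set (ZSpace Γ₁ Γ₂)} (hY : IsClosed Y) :
    IsClosed (stabSemigroup Y) := by
  refine (isClosed_isAM.preimage continuous_fst).inter ((isClosed_range_uElt.preimage
    (continuous_fst.mul continuous_snd.inv)).inter ?_)
  have : {w : G d × G d | ∀ z ∈ Y, ztr z w ∈ Y} = ⋂ z ∈ Y, {w | ztr z w ∈ Y} := by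
    ext w; simp only [Set.mem_ofPred_eq, Set.mem_iInter]
  change IsClosed {w : G d × G d | ∀ z ∈ Y, ztr z w ∈ Y}
  rw [this]
  refine isClosed_biInter fun z _ => hY.preimage ?_
  obtain ⟨k, rfl⟩ := zproj_surjective z
  exact continuous_zproj.comp (continuous_const_mul k)

theorem one_mem_stabSemigroup (Y : Set (ZSpace Γ₁ Γ₂)) : 1 ∈ stabSemigroup Y :=
  ⟨IsAM.one, ⟨0, by simp⟩, fun z hz => by rwa [ztr_one]⟩

theorem mul_mem_stabSemigroup {Y : Set (ZSpace Γ₁ Γ₂)} {a b : G d × G d}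
    (ha : a ∈ stabSemigroup Y) (hb : b ∈ stabSemigroup Y) : a * b ∈ stabSemigroup Y := by
  obtain ⟨ha1, ⟨s, hs⟩, ha3⟩ := ha
  obtain ⟨hb1, ⟨t, ht⟩, hb3⟩ := hb
  refine ⟨ha1.mul hb1, ?_, fun z hz => ?_⟩
  · obtain ⟨t', ht'⟩ := ha1.conj_uElt t
    refine ⟨t' + s, ?_⟩
    rw [uElt_add, ← ht', hs, ht]
    simp only [Prod.fst_mul, Prod.snd_mul]
    group
  · rw [← ztr_ztr]
    exact hb3 _ (ha3 z hz)

theorem stabSemigroup_subset (Y : Set (ZSpace Γ₁ Γ₂)) : stabSemigroup Y ⊆ grpAMU₂ d := by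
  rintro w ⟨h1, ⟨v, hv⟩, -⟩
  obtain ⟨t, m, hm, hw⟩ := h1.exists_mul
  obtain ⟨v', hv'⟩ := h1.inv.conj_uElt (-v)
  refine ⟨(aElt d t, aElt d t) * (m, m), ⟨_, ⟨_, ⟨t, rfl⟩, rfl⟩, _, ⟨_, hm, rfl⟩, rfl⟩,
    (1, uElt v'), ⟨_, (mem_grpU_iff _).2 ⟨v', rfl⟩, rfl⟩, ?_⟩
  refine Prod.ext ?_ ?_
  · simp [hw]
  · change aElt d t * m * uElt v' = w.2
    rw [← hw, ← hv', uElt_neg, hv]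
    group

/-! ### Minimality, compactness and small elements of the semigroup -/

/-- Because w normalizes U, y U w = y w U ⊆ Y; the closed condition z w ∈ Y then passes from the
dense orbit y U to all of Y. -/
theorem mem_stabSemigroup_of_minimal {X Y : Set (ZSpace Γ₁ Γ₂)} (hY : IsUMinimal X Y)
    {y : ZSpace Γ₁ Γ₂} (hy : y ∈ Y ∩ OmegaSet Γ₁ Γ₂) {w : G d × G d} (hw : IsAM w.1)
    (hw' : w.1 * w.2⁻¹ ∈ Set.range (uElt : (Mid d → ℝ) → G d)) (hyw : ztr y w ∈ Y) :
    w ∈ stabSemigroup Y := by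
  refine ⟨hw, hw', fun z hz => ?_⟩
  have hcl : IsClosed {z : ZSpace Γ₁ Γ₂ | ztr z w ∈ Y} := hY.isClosed.preimage (continuous_ztr w)
  refine closure_minimal ?_ hcl (hY.dense_orbit y hy hz)
  rintro _ ⟨_, ⟨u, hu, rfl⟩, rfl⟩
  obtain ⟨s, rfl⟩ := (mem_grpU_iff u).1 hu
  obtain ⟨s', hs'⟩ := exists_uDiag_mul_comm hw hw' s
  change ztr (ztr y (uDiag s)) w ∈ Y
  rw [ztr_ztr, hs', ← ztr_ztr]
  exact hY.invariant _ hyw _ ⟨uElt s', (mem_grpU_iff _).2 ⟨s', rfl⟩, rfl⟩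

/-- The elements of zero defect. -/
def defectZero (d : ℕ) [Fact (2 ≤ d)] : Subgroup (G d × G d) where
  carrier := {w | defect w = 0}
  mul_mem' {a b} ha hb := by
    simp only [Set.mem_ofPred_eq, defect_eq_zero_iff] at *
    exact ⟨by rw [Prod.fst_mul, act_mul, hb.1, ha.1], by rw [Prod.fst_mul, Prod.snd_mul, ha.2, hb.2]⟩
  one_mem' := defect_one
  inv_mem' {a} ha := by
    simp only [Set.mem_ofPred_eq, defect_eq_zero_iff] at *
    exact ⟨by rw [Prod.fst_inv, act_inv_eq_iff, ha.1], by rw [Prod.fst_inv, Prod.snd_inv, ha.2]⟩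

theorem mem_defectZero {w : G d × G d} : w ∈ defectZero d ↔ defect w = 0 := Iff.rfl

theorem diag_grpM_subset_defectZero : diag (grpM d) ⊆ (defectZero d : Set (G d × G d)) := by
  rintro _ ⟨m, hm, rfl⟩
  rw [SetLike.mem_coe, mem_defectZero, defect_eq_zero_iff]
  exact ⟨((mem_grpM_iff m).1 hm).1, rfl⟩

theorem ht_le_of_isAM {w : G d × G d} (hw : IsAM w.1) (hd : ‖defect w‖ ≤ 1 / 2) : ht w.1 ≤ 2 := by
  obtain ⟨t, hP, hM⟩ := hw
  have h1 : |defect w (Fin.last d, none)| ≤ 1 / 2 := (norm_le_pi_norm (defect w) _).trans hd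
  have h2 := abs_le.1 h1
  simp only [defect, hP, Pi.smul_apply, eP_last, smul_eq_mul, mul_one] at h2
  have h3 : Real.exp (-t) ≤ 2 := by
    rw [Real.exp_neg]
    exact inv_le_of_inv_le₀ (by norm_num) (by linarith)
  rw [ht, basePt_eq, map_smul, map_add, hP, hM]
  simp only [Pi.smul_apply, Pi.add_apply, eP_last, eM_last, smul_eq_mul, mul_one]
  linarith

/-- On 𝒜ℳ the defect contains e^t - 1, so a bound by 1/2 confines t, while ℳ is compact; the second
entry is controlled by w₁ w₂⁻¹. -/
theorem isCompact_small_defect : IsCompact {w : G d × G d | IsAM w.1 ∧ ‖defect w‖ ≤ 1 / 2} := by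
  have hK := ((isCompact_ht_le (d := d) 2).prod (isCompact_ht_le (d := d) 2)).image
    (show Continuous fun p : G d × G d => (p.1, p.2⁻¹ * p.1) by fun_prop)
  refine hK.of_isClosed_subset ?_ ?_
  · exact (isClosed_isAM.preimage continuous_fst).inter
      (isClosed_le continuous_defect.norm continuous_const)
  · rintro w ⟨h1, h2⟩
    refine ⟨(w.1, w.1 * w.2⁻¹), ⟨ht_le_of_isAM (w := w) h1 h2, ht_mul_inv_le h2 (by norm_num)⟩, ?_⟩
    refine Prod.ext rfl ?_
    simp

/-- The semigroup contains elements of arbitrarily small non-zero defect. -/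
theorem exists_mem_stabSemigroup_small_defect [DiscreteTopology Γ₁] [DiscreteTopology Γ₂]
    (hcc : IsConvexCocompact Γ₁) (hzd : IsZariskiDense Γ₁) (htf : IsTorsionFreeSubgroup Γ₂)
    (hc₂ : CompactSpace (LeftQuot Γ₂)) {X Y : Set (ZSpace Γ₁ Γ₂)} (hY : IsUMinimal X Y)
    {ε : ℝ} (hε : 0 < ε) : ∃ w ∈ stabSemigroup Y, defect w ≠ 0 ∧ ‖defect w‖ ≤ ε := by
  have hlift : IsLiftInvariant Γ₁ Γ₂ (zproj Γ₁ Γ₂ ⁻¹' Y) := by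
    refine ⟨hY.isClosed.preimage continuous_zproj, ?_, ?_⟩
    · intro g hg γ₁ h₁ γ₂ h₂
      have : zproj Γ₁ Γ₂ ((γ₁, γ₂) * g) = zproj Γ₁ Γ₂ g :=
        Prod.ext (proj_mul_left h₁ _) (proj_mul_left h₂ _)
      rwa [Set.mem_preimage, this]
    · intro g hg s
      exact hY.invariant _ hg _ ⟨uElt s, (mem_grpU_iff _).2 ⟨s, rfl⟩, rfl⟩
  obtain ⟨y, hyY, hyΩ⟩ := hY.meets
  obtain ⟨g₀, rfl⟩ := zproj_surjective y
  obtain ⟨k, q, hkE, hkY, hkq, hq, hq0⟩ := exists_recurrence hcc hzd htf hc₂ hlift hyY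
    (endsIn_of_mem_RF hyΩ.1)
  obtain ⟨g, hg, hgE, w, hw1, hw2, hgw, hw0, hwε⟩ :=
    exists_small_defect hcc hzd hc₂ hlift hkE hkY hkq hq hq0 hε
  exact ⟨w, mem_stabSemigroup_of_minimal hY ⟨hg, hgE.mem_RF hcc, Set.mem_univ _⟩ hw1 hw2 hgw,
    hw0, hwε⟩

/-! ## The embedding of `G × G` in an algebra of matrices -/

section

attribute [local instance] Matrix.linftyOpNormedRing Matrix.linftyOpNormedAlgebra

/-- The embedding of `G × G` in the algebra of pairs of matrices. -/
def pairMat (d : ℕ) : G d × G d →*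
    Matrix (Fin (d + 1)) (Fin (d + 1)) ℝ × Matrix (Fin (d + 1)) (Fin (d + 1)) ℝ where
  toFun w := (toMat w.1, toMat w.2)
  map_one' := rfl
  map_mul' _ _ := rfl

theorem isEmbedding_pairMat : IsEmbedding (pairMat d) :=
  (isClosedEmbedding_toMat (d := d)).isEmbedding.prodMap
    (isClosedEmbedding_toMat (d := d)).isEmbedding

/-- Expand gᵀ J g = J at g = 1 + δ x, divide by δ and let δ → 0. -/
theorem mem_so_of_tendsto {v : ℕ → G d} {δ : ℕ → ℝ} {ξ : Matrix (Fin (d + 1)) (Fin (d + 1)) ℝ}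
    (hδ0 : ∀ n, 0 < δ n) (hδ : Tendsto δ atTop (𝓝 0))
    (h : Tendsto (fun n => (δ n)⁻¹ • (toMat (v n) - 1)) atTop (𝓝 ξ)) : ξ ∈ so d := by
  set x : ℕ → Matrix (Fin (d + 1)) (Fin (d + 1)) ℝ := fun n => (δ n)⁻¹ • (toMat (v n) - 1) with hx
  have hv : ∀ n, toMat (v n) = 1 + δ n • x n := fun n => by
    rw [hx, smul_smul, mul_inv_cancel₀ (hδ0 n).ne', one_smul]; abel
  have key : ∀ n, (x n)ᵀ * formJ d + formJ d * x n + δ n • ((x n)ᵀ * formJ d * x n) = 0 := by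
    intro n
    have h1 := toMat_preserves (v n)
    rw [hv] at h1
    simp only [Matrix.transpose_add, Matrix.transpose_one, Matrix.transpose_smul, add_mul, mul_add,
      one_mul, mul_one, smul_mul_assoc, mul_smul_comm] at h1
    have h2 : δ n • ((x n)ᵀ * formJ d + formJ d * x n + δ n • ((x n)ᵀ * formJ d * x n)) = 0 := by
      rw [← sub_eq_zero] at h1
      rw [← h1]
      module
    exact (smul_eq_zero.1 h2).resolve_left (hδ0 n).ne'
  have hcont : Continuous fun p : ℝ × Matrix (Fin (d + 1)) (Fin (d + 1)) ℝ =>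
      (p.2)ᵀ * formJ d + formJ d * p.2 + p.1 • ((p.2)ᵀ * formJ d * p.2) := by fun_prop
  have hlim := (hcont.tendsto (0, ξ)).comp (hδ.prodMk_nhds h)
  have h0 := tendsto_nhds_unique hlim (tendsto_const_nhds.congr fun n => (key n).symm)
  rw [mem_skewAdjointMatricesSubmodule]
  change ξᵀ * formJ d = formJ d * (-ξ)
  simp only [zero_smul, add_zero] at h0
  rw [mul_neg, eq_neg_iff_add_eq_zero, h0]

/-! ### Extraction of the one-parameter semigroup -/

theorem exists_oneParam [DiscreteTopology Γ₁] [DiscreteTopology Γ₂]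
    (hcc : IsConvexCocompact Γ₁) (hzd : IsZariskiDense Γ₁) (htf : IsTorsionFreeSubgroup Γ₂)
    (hc₂ : CompactSpace (LeftQuot Γ₂)) {X Y : Set (ZSpace Γ₁ Γ₂)} (hY : IsUMinimal X Y) :
    ∃ ξ : so d × so d, ξ ≠ 0 ∧
      (∀ t : ℝ, 0 ≤ t → (expG (t • ξ.1), expG (t • ξ.2)) ∈ stabSemigroup Y) ∧
      ∃ t : ℝ, 0 ≤ t ∧ (expG (t • ξ.1), expG (t • ξ.2)) ∉ defectZero d := by
  -- The bounds 1/(n + 2) tend to 0 and never exceed 1/2, the threshold of `isCompact_small_defect`.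
  choose w hwS hw0 hwε using fun n : ℕ => exists_mem_stabSemigroup_small_defect hcc hzd htf hc₂ hY
    (ε := 1 / ((n : ℝ) + 2)) (by positivity)
  have hSc := isClosed_stabSemigroup hY.isClosed
  have hwK : ∀ n, w n ∈ {w : G d × G d | IsAM w.1 ∧ ‖defect w‖ ≤ 1 / 2} := fun n =>
    ⟨(hwS n).1, (hwε n).trans (one_div_le_one_div_of_le (by norm_num) (by
      linarith [(Nat.cast_nonneg n : (0 : ℝ) ≤ n)]))⟩
  obtain ⟨w₀, -, φ, hφ, hlim⟩ := isCompact_small_defect.tendsto_subseq hwK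
  have hw₀ : w₀ ∈ stabSemigroup Y ∩ defectZero d := by
    refine ⟨hSc.mem_of_tendsto hlim (Eventually.of_forall fun n => hwS _), ?_⟩
    refine tendsto_of_defect (w := fun n => w (φ n)) ?_ hlim
    refine squeeze_zero_norm (fun n => hwε (φ n)) ?_
    refine (tendsto_one_div_add_atTop_nhds_zero_nat (𝕜 := ℝ)).comp
      (tendsto_add_atTop_nat 1) |>.comp hφ.tendsto_atTop |>.congr fun n => ?_
    simp only [Function.comp_apply]
    push_cast
    ring_nf
  have hcomp : IsCompact (stabSemigroup Y ∩ defectZero d) := by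
    refine isCompact_small_defect.of_isClosed_subset (hSc.inter
      (isClosed_eq continuous_defect continuous_const)) ?_
    rintro x ⟨hx, hx0⟩
    refine ⟨hx.1, ?_⟩
    rw [mem_defectZero.1 hx0]
    norm_num
  obtain ⟨ξ, hξ0, ⟨v, δ, hδ0, hδ, hvlim⟩, hmem, hout⟩ := exists_direction (pairMat d)
    isEmbedding_pairMat hSc (one_mem_stabSemigroup Y) (fun a ha b hb => mul_mem_stabSemigroup ha hb)
    (defectZero d) hcomp (fun n => hwS (φ n)) (fun n h => hw0 (φ n) h) hw₀ hlim
  have h1 : ξ.1 ∈ so d := mem_so_of_tendsto hδ0 hδ hvlim.fst_nhds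
  have h2 : ξ.2 ∈ so d := mem_so_of_tendsto hδ0 hδ hvlim.snd_nhds
  have hexp : ∀ t : ℝ, pairMat d (expG (t • (⟨ξ.1, h1⟩ : so d)), expG (t • (⟨ξ.2, h2⟩ : so d))) =
      NormedSpace.exp (t • ξ) := fun t => by
    let : NormedAlgebra ℚ (Matrix (Fin (d + 1)) (Fin (d + 1)) ℝ) :=
      NormedAlgebra.restrictScalars ℚ ℝ _
    refine Prod.ext ?_ ?_
    · exact (NormedSpace.map_exp (RingHom.fst _ _) continuous_fst (t • ξ)).symm
    · exact (NormedSpace.map_exp (RingHom.snd _ _) continuous_snd (t • ξ)).symm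
  refine ⟨(⟨ξ.1, h1⟩, ⟨ξ.2, h2⟩), fun h0 => hξ0 ?_, fun t ht => hmem _ t ht (hexp t),
    hout _ hexp⟩
  refine Prod.ext ?_ ?_
  · exact congrArg (fun z : so d × so d => z.1.1) h0
  · exact congrArg (fun z : so d × so d => z.2.1) h0

end

end OrbitClosure

end

theorem mainTheorem6 (d : ℕ) (hd : 2 ≤ d)
    (Γ₁ Γ₂ : Subgroup (OrbitClosure.G d))
    -- `Γ₁` is a torsion-free, Zariski dense, convex cocompact discrete subgroup
    (hΓ₁ : DiscreteTopology Γ₁) (hΓ₁tf : OrbitClosure.IsTorsionFreeSubgroup Γ₁)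
    (hΓ₁zd : OrbitClosure.IsZariskiDense Γ₁) (hΓ₁cc : OrbitClosure.IsConvexCocompact Γ₁)
    -- `Γ₂` is a torsion-free cocompact lattice
    (hΓ₂ : DiscreteTopology Γ₂) (hΓ₂tf : OrbitClosure.IsTorsionFreeSubgroup Γ₂)
    (hΓ₂c : CompactSpace (OrbitClosure.LeftQuot Γ₂))
    -- `X` is a closed subset of `Z`, invariant under the diagonal `H`
    (X : Set (OrbitClosure.ZSpace Γ₁ Γ₂)) (hXc : IsClosed X)
    (hXH : OrbitClosure.IsInvariantUnder X (OrbitClosure.diag Set.univ))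
    (Y : Set (OrbitClosure.ZSpace Γ₁ Γ₂)) (hY : OrbitClosure.IsUMinimal X Y) :
    ∃ S : Set (OrbitClosure.G d × OrbitClosure.G d),
      OrbitClosure.IsOneParamSemigroup S ∧
      S ⊆ OrbitClosure.grpAMU₂ d ∧
      ¬ S ⊆ OrbitClosure.diag (OrbitClosure.grpM d) ∧
      OrbitClosure.IsInvariantUnder Y S := by
  have : Fact (2 ≤ d) := ⟨hd⟩
  obtain ⟨ξ, hξ0, hmem, t, ht, hout⟩ :=
    OrbitClosure.exists_oneParam hΓ₁cc hΓ₁zd hΓ₂tf hΓ₂c hY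
  refine ⟨_, ⟨ξ, hξ0, rfl⟩, ?_, fun hsub => ?_, ?_⟩
  · rintro _ ⟨t, ht, rfl⟩
    exact OrbitClosure.stabSemigroup_subset Y (hmem t ht)
  -- Elements of M have zero defect, so leaving the zero-defect subgroup means leaving M.
  · exact hout (OrbitClosure.diag_grpM_subset_defectZero (hsub ⟨t, ht, rfl⟩))
  · rintro z hz _ ⟨t, ht, rfl⟩
    exact (hmem t ht).2.2 z hz
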